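/- For a homogeneous polynomial $f$ in $n$ real variables let $\|f\|_2:=\sup_{\|x\|_2=1}|f(x)|$, and for $f$ of even degree $d$ let $$\Lambda(f):=\inf\Big\{\sup_{\|z\|_2=1}z^{T}Mz\ :\ M\in\mathbb R^{[n]^{d/2}\times[n]^{d/2}}\text{ symmetric},\ (x^{\otimes d/2})^{T}M\,x^{\otimes d/2}=f(x)\ \text{ for all }x\in\mathbb R^n\Big\}$$ be the value of its degree-$d$ sum-of-squares relaxation on the sphere. For a graph $G$ on $[n]$ let $$f_G(x):=\sum_{\{i_1,i_2,i_3,i_4\}\ \text{a 4-clique of }G}x_{i_1}x_{i_2}x_{i_3}x_{i_4}.$$ **Theorem.** There are absolute constants $C\in\mathbb N$, $c>0$ and $N\in\mathbb N$ such that for every $n\ge N$ the following holds. If $G$ is a random graph drawn from $G(n,p)$ with $p=n^{-1/3}$, then $$\Pr\big[\|f_G\|_2\le(\log n)^{C}\big]\ge 1-\tfrac1n\qquad\text{and}\qquad \Pr\Big[\Lambda(f_G)\ge \frac{c\,n^{1/6}}{(\log n)^{C}}\Big]\ge 1-\tfrac1n .$$ In particular, for every $n\ge N$ there is an $n$-variate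 homogeneous polynomial $f$ of degree $4$ with non-negative coefficients, namely $f=f_G$ for some graph $G$ on $[n]$, such that $$\|f\|_2\le(\log n)^{C}\qquad\text{and}\qquad \Lambda(f)\ge \frac{c\,n^{1/6}}{(\log n)^{C}} .$$ -/

import Mathlib

open MvPolynomial

/-- The sup norm of a polynomial on the Euclidean unit sphere:
`‖f‖₂ = sup { |f x| : x ∈ ℝⁿ, ∑ xᵢ² = 1 }`. -/
noncomputable def sphereNorm {n : ℕ} (f : MvPolynomial (Fin n) ℝ) : ℝ :=
  sSup {r : ℝ | ∃ x : Fin n → ℝ, ∑ i, x i ^ 2 = 1 ∧ r = |eval x f|}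

/-- The tensor power `x^{⊗ k}`, a vector indexed by `k`-tuples. -/
def tensorPow {n : ℕ} (k : ℕ) (x : Fin n → ℝ) : (Fin k → Fin n) → ℝ :=
  fun I => ∏ j, x (I j)

/-- `M` is a (symmetric) matrix representation of the degree-`2k` form `f`:
`(x^{⊗ k})ᵀ M x^{⊗ k} = f x` for all `x ∈ ℝⁿ`. -/
def IsMatrixRep {n : ℕ} (k : ℕ) (f : MvPolynomial (Fin n) ℝ)
    (M : Matrix (Fin k → Fin n) (Fin k → Fin n) ℝ) : Prop :=
  M.IsSymm ∧ ∀ x : Fin n → ℝ, tensorPow k x ⬝ᵥ M.mulVec (tensorPow k x) = eval x f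

/-- `sup { zᵀ M z : ‖z‖₂ = 1 }`, the largest eigenvalue of a symmetric matrix. -/
noncomputable def maxQuadForm {ι : Type*} [Fintype ι] (M : Matrix ι ι ℝ) : ℝ :=
  sSup {r : ℝ | ∃ z : ι → ℝ, ∑ i, z i ^ 2 = 1 ∧ r = z ⬝ᵥ M.mulVec z}

/-- The value `Λ(f)` of the sum-of-squares relaxation of a form `f` of degree `2k` on the sphere:
the infimum of `sup_{‖z‖ = 1} zᵀ M z` over all matrix representations `M` of `f`. -/
noncomputable def sosValue {n : ℕ} (k : ℕ) (f : MvPolynomial (Fin n) ℝ) : ℝ :=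
  sInf {r : ℝ | ∃ M : Matrix (Fin k → Fin n) (Fin k → Fin n) ℝ,
    IsMatrixRep k f M ∧ r = maxQuadForm M}

open scoped Classical in
/-- The `4`-clique polynomial of a graph on `[n]`: the sum of `x_{i₁} x_{i₂} x_{i₃} x_{i₄}` over all
(unordered) `4`-cliques `{i₁, i₂, i₃, i₄}`. -/
noncomputable def cliquePoly {n : ℕ} (G : SimpleGraph (Fin n)) : MvPolynomial (Fin n) ℝ :=
  ∑ s ∈ G.cliqueFinset 4, ∏ i ∈ s, X i

/-- The edge probability `p = n^{-1/3}`. -/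
noncomputable def edgeProb (n : ℕ) : unitInterval :=
  ⟨(n : ℝ) ^ (-(1 / 3) : ℝ), Real.rpow_nonneg n.cast_nonneg _, by
    rcases Nat.eq_zero_or_pos n with rfl | h
    · rw [Nat.cast_zero, Real.zero_rpow (by norm_num)]
      exact zero_le_one
    · exact Real.rpow_le_one_of_one_le_of_nonpos (by exact_mod_cast h) (by norm_num)⟩

/-!
Write `a = n ^ (1 / 3)`, so that `p = 1 / a`. With high probability three vertices have `O(log n)`
common neighbours, two vertices have `O(a log n)`, and the number of edges between vertex sets `S`
and `T` is `O(p |S| |T| + (|S| + |T|) log n)`.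

For the norm, round the coordinates of a unit vector up to powers of `1 / 2`. The three heaviest
vertices of a clique form a triangle, which has `O(log n)` extensions, so it is enough to count
triangles between level sets. The level set of the value `2 ^ (-h)` has `O(4 ^ h)` vertices, and the
edge counts then bound the contribution of each of the `O(log n) ^ 3` triples of levels.

For the lower bound on `Λ`, a linear functional that is non-negative on squares of quadratic forms
bounds `Λ(f)` from below by the ratio of its values at `f` and at `‖x‖ ^ 4`. Split off four disjoint
vertex classes and replace edge indicators by their deviations from `p`. The functional with weight
`∏ (1_e - p)` at `∂ᵢ∂ⱼ∂ₖ∂ₗ`, one vertex in each class, has value about `n ^ 4 p ^ 6 = a ^ 6` at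
`f_G`, by a second moment computation. On squares it can be negative, but only up to a multiple
`√a` (up to logarithms) of a diagonal form weighted by `|1_e - p|`. Indeed the Gram matrix
controlling it is, given the edges among the first three classes, a sum of independent
contributions of the vertices of the fourth; their mean and size are `O(a)` up to logarithms, and
matrix Chernoff applies. Adding that diagonal form restores non-negativity and costs
`√a * a ^ 5` at `‖x‖ ^ 4`, since `G` has about `a ^ 5` edges. The ratio is `√a = n ^ (1 / 6)`.
-/

section RandomSubset

variable {ι : Type*} [DecidableEq ι]

/-- The expectation of `f ω`, where `ω` is the random subset of `E` that contains every element
independently with probability `p`. As a finite sum it needs no measurability, and its value on `f`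
depends only on the subsets of `E`. -/
noncomputable def bernoulliExp (E : Finset ι) (p : unitInterval) (f : Finset ι → ℝ) : ℝ :=
  ∑ ω ∈ E.powerset, (p : ℝ) ^ ω.card * (1 - p) ^ (E \ ω).card * f ω

open scoped Classical in
/-- The probability of the event `S`, given as a predicate on the random subset `ω` of `E` that
contains every element independently with probability `p`. -/
noncomputable def bernoulliProb (E : Finset ι) (p : unitInterval) (S : Finset ι → Prop) : ℝ :=
  bernoulliExp E p fun ω => if S ω then 1 else 0

/-- `F ω` does not depend on whether `e` belongs to `ω`. This encodes independence of `F` from the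
event `e ∈ ω`. -/
def Ignores (e : ι) {β : Type*} (F : Finset ι → β) : Prop :=
  ∀ ω, F (insert e ω) = F ω

lemma Ignores.erase {e : ι} {β : Type*} {F : Finset ι → β} (h : Ignores e F) (ω : Finset ι) :
    F (ω.erase e) = F ω := by
  rw [← h (ω.erase e), ← h ω]
  by_cases he : e ∈ ω
  · rw [Finset.insert_erase he, Finset.insert_eq_of_mem he]
  · rw [Finset.erase_eq_of_notMem he]

variable {E : Finset ι} {p : unitInterval}

lemma bernoulliExp_congr {f g : Finset ι → ℝ} (h : ∀ ω ⊆ E, f ω = g ω) :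
    bernoulliExp E p f = bernoulliExp E p g :=
  Finset.sum_congr rfl fun ω hω => by rw [h ω (Finset.mem_powerset.1 hω)]

lemma bernoulliExp_add (f g : Finset ι → ℝ) :
    bernoulliExp E p (fun ω => f ω + g ω) = bernoulliExp E p f + bernoulliExp E p g := by
  simp [bernoulliExp, mul_add, Finset.sum_add_distrib]

lemma bernoulliExp_const_mul (c : ℝ) (f : Finset ι → ℝ) :
    bernoulliExp E p (fun ω => c * f ω) = c * bernoulliExp E p f := by
  simp only [bernoulliExp, Finset.mul_sum]
  exact Finset.sum_congr rfl fun ω _ => by ring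

lemma bernoulliExp_sum {α : Type*} (s : Finset α) (f : α → Finset ι → ℝ) :
    bernoulliExp E p (fun ω => ∑ a ∈ s, f a ω) = ∑ a ∈ s, bernoulliExp E p (f a) := by
  simp only [bernoulliExp, Finset.mul_sum]
  exact Finset.sum_comm

lemma bernoulliExp_const (c : ℝ) : bernoulliExp E p (fun _ => c) = c := by
  have htotal : ∑ ω ∈ E.powerset, (p : ℝ) ^ ω.card * (1 - p) ^ (E \ ω).card = 1 := by
    have hbinom := Finset.sum_pow_mul_eq_add_pow (p : ℝ) (1 - p) E
    simp only [add_sub_cancel, one_pow] at hbinom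
    refine Eq.trans (Finset.sum_congr rfl fun ω hω => ?_) hbinom
    rw [Finset.card_sdiff_of_subset (Finset.mem_powerset.1 hω)]
  rw [bernoulliExp, ← Finset.sum_mul, htotal, one_mul]

lemma bernoulliExp_mono {f g : Finset ι → ℝ} (h : ∀ ω ⊆ E, f ω ≤ g ω) :
    bernoulliExp E p f ≤ bernoulliExp E p g :=
  Finset.sum_le_sum fun ω hω => mul_le_mul_of_nonneg_left (h ω (Finset.mem_powerset.1 hω))
    (mul_nonneg (pow_nonneg p.2.1 _) (pow_nonneg (sub_nonneg.2 p.2.2) _))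

lemma bernoulliExp_nonneg {f : Finset ι → ℝ} (h : ∀ ω ⊆ E, 0 ≤ f ω) : 0 ≤ bernoulliExp E p f := by
  simpa only [bernoulliExp_const] using bernoulliExp_mono (p := p) h

lemma bernoulliExp_resample {e : ι} (he : e ∈ E) (f : Finset ι → ℝ) :
    bernoulliExp E p f
      = bernoulliExp E p fun ω => p * f (insert e ω) + (1 - p) * f (ω.erase e) := by
  obtain ⟨E', he', rfl⟩ : ∃ E', e ∉ E' ∧ E = insert e E' :=
    ⟨E.erase e, Finset.notMem_erase e E, (Finset.insert_erase he).symm⟩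
  simp only [bernoulliExp, Finset.sum_powerset_insert he', ← Finset.sum_add_distrib]
  refine Finset.sum_congr rfl fun ω hω => ?_
  have hω' : e ∉ ω := fun h => he' (Finset.mem_powerset.1 hω h)
  have hcard : (insert e E' \ ω).card = (E' \ ω).card + 1 := by
    rw [Finset.insert_sdiff_of_notMem _ hω', Finset.card_insert_of_notMem (by simp [he'])]
  have hsdiff : insert e E' \ insert e ω = E' \ ω := by
    rw [Finset.insert_sdiff_insert, Finset.sdiff_insert_of_notMem he']
  rw [hcard, hsdiff, Finset.card_insert_of_notMem hω', Finset.insert_idem,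
    Finset.erase_insert hω', Finset.erase_eq_of_notMem hω']
  ring

lemma bernoulliExp_mul_of_ignores {e : ι} (he : e ∈ E) {F : Finset ι → ℝ} (hF : Ignores e F)
    (φ : Prop → ℝ) :
    bernoulliExp E p (fun ω => F ω * φ (e ∈ ω))
      = (p * φ True + (1 - p) * φ False) * bernoulliExp E p F := by
  rw [bernoulliExp_resample he, ← bernoulliExp_const_mul]
  refine bernoulliExp_congr fun ω _ => ?_
  rw [hF, hF.erase]
  simp only [Finset.mem_insert_self, Finset.notMem_erase]
  ring

lemma bernoulliExp_subset {F : Finset ι} (hF : F ⊆ E) :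
    bernoulliExp E p (fun ω => if F ⊆ ω then 1 else 0) = (p : ℝ) ^ F.card := by
  classical
  induction F using Finset.induction_on with
  | empty => simp [bernoulliExp_const]
  | insert e F he ih =>
    have hignores : Ignores e (fun ω : Finset ι => if F ⊆ ω then (1 : ℝ) else 0) := by
      intro ω
      simp only [Finset.subset_insert_iff_of_notMem he]
    have hmul := bernoulliExp_mul_of_ignores (p := p) (hF (Finset.mem_insert_self e F)) hignores
      (fun P => if P then 1 else 0)
    rw [ih ((Finset.subset_insert e F).trans hF)] at hmul
    simp only [if_true, if_false, mul_one, mul_zero, add_zero] at hmul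
    rw [Finset.card_insert_of_notMem he, pow_succ', ← hmul]
    refine bernoulliExp_congr fun ω _ => ?_
    by_cases h : e ∈ ω <;> simp [Finset.insert_subset_iff, h]

lemma bernoulliProb_le_exp_div {S : Finset ι → Prop} {f : Finset ι → ℝ} {a : ℝ}
    (ha : 0 < a) (hf : ∀ ω ⊆ E, 0 ≤ f ω) (h : ∀ ω ⊆ E, S ω → a ≤ f ω) :
    bernoulliProb E p S ≤ bernoulliExp E p f / a := by
  classical
  rw [div_eq_inv_mul, ← bernoulliExp_const_mul]
  refine bernoulliExp_mono fun ω hω => ?_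
  rw [← div_eq_inv_mul]
  split_ifs with hS
  · exact (one_le_div ha).2 (h ω hω hS)
  · exact div_nonneg (hf ω hω) ha.le

lemma bernoulliProb_mono {S T : Finset ι → Prop} (h : ∀ ω ⊆ E, S ω → T ω) :
    bernoulliProb E p S ≤ bernoulliProb E p T := by
  classical
  refine bernoulliExp_mono fun ω hω => ?_
  by_cases hS : S ω
  · simp [hS, h ω hω hS]
  · rw [if_neg hS]
    split_ifs <;> norm_num

lemma bernoulliProb_exists_le {α : Type*} (s : Finset α) (S : α → Finset ι → Prop) :
    bernoulliProb E p (fun ω => ∃ a ∈ s, S a ω) ≤ ∑ a ∈ s, bernoulliProb E p (S a) := by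
  classical
  simp only [bernoulliProb, ← bernoulliExp_sum]
  refine bernoulliExp_mono fun ω _ => ?_
  have hnonneg : ∀ a ∈ s, (0 : ℝ) ≤ if S a ω then 1 else 0 := fun a _ => by
    split_ifs <;> norm_num
  split_ifs with h
  · obtain ⟨a, ha, haS⟩ := h
    simpa [haS] using Finset.single_le_sum hnonneg ha
  · exact Finset.sum_nonneg hnonneg

lemma bernoulliProb_or_le (S T : Finset ι → Prop) :
    bernoulliProb E p (fun ω => S ω ∨ T ω) ≤ bernoulliProb E p S + bernoulliProb E p T := by
  classical
  simp only [bernoulliProb, ← bernoulliExp_add]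
  refine bernoulliExp_mono fun ω _ => ?_
  by_cases hS : S ω <;> by_cases hT : T ω <;> simp [hS, hT]

lemma bernoulliProb_not (S : Finset ι → Prop) :
    bernoulliProb E p (fun ω => ¬ S ω) = 1 - bernoulliProb E p S := by
  classical
  rw [eq_sub_iff_add_eq', bernoulliProb, bernoulliProb, ← bernoulliExp_add]
  refine Eq.trans (bernoulliExp_congr fun ω _ => ?_) (bernoulliExp_const 1)
  by_cases h : S ω <;> simp [h]

lemma exists_of_one_lt_bernoulliProb_add {S T : Finset ι → Prop}
    (h : 1 < bernoulliProb E p S + bernoulliProb E p T) : ∃ ω ⊆ E, S ω ∧ T ω := by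
  by_contra! hdisj
  have hle : bernoulliProb E p S ≤ bernoulliProb E p fun ω => ¬ T ω := bernoulliProb_mono hdisj
  rw [bernoulliProb_not] at hle
  linarith

open scoped Classical in
lemma two_pow_card_filter_subset_eq_sum {α : Type*} (K : Finset α) (F : α → Finset ι)
    (ω : Finset ι) :
    (2 : ℝ) ^ (K.filter fun a => F a ⊆ ω).card
      = ∑ J ∈ K.powerset, if J.biUnion F ⊆ ω then 1 else 0 := by
  have hpowerset : K.powerset.filter (fun J => J.biUnion F ⊆ ω)
      = (K.filter fun a => F a ⊆ ω).powerset := by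
    ext J
    simp only [Finset.mem_filter, Finset.mem_powerset, Finset.biUnion_subset,
      Finset.subset_iff (s₁ := J)]
    exact forall₂_and.symm
  rw [← Finset.sum_filter, Finset.sum_const, nsmul_one, hpowerset, Finset.card_powerset]
  norm_cast

open scoped Classical in
lemma bernoulliExp_two_pow_card {α : Type*} {K : Finset α} {F : α → Finset ι} {r : ℕ}
    (hF : ∀ a ∈ K, F a ⊆ E) (hr : ∀ a ∈ K, (F a).card = r)
    (hd : (K : Set α).PairwiseDisjoint F) :
    bernoulliExp E p (fun ω => 2 ^ (K.filter fun a => F a ⊆ ω).card)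
      = (1 + (p : ℝ) ^ r) ^ K.card := by
  simp only [two_pow_card_filter_subset_eq_sum]
  rw [bernoulliExp_sum]
  have hterm : ∀ J ∈ K.powerset, bernoulliExp E p (fun ω => if J.biUnion F ⊆ ω then 1 else 0)
      = ((p : ℝ) ^ r) ^ J.card * 1 ^ (K.card - J.card) := by
    intro J hJ
    have hJ := Finset.mem_powerset.1 hJ
    rw [bernoulliExp_subset (Finset.biUnion_subset.2 fun a ha => hF a (hJ ha)),
      Finset.card_biUnion fun a ha b hb hab => hd (hJ ha) (hJ hb) hab,
      Finset.sum_congr rfl fun a ha => hr a (hJ ha)]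
    simp [pow_mul, mul_comm]
  rw [Finset.sum_congr rfl hterm, Finset.sum_pow_mul_eq_add_pow, add_comm]

open scoped Classical in
-- Markov's inequality for `2 ^ N`, where `N` is the number of members of the family inside `ω`.
lemma bernoulliProb_card_lt {α : Type*} {K : Finset α} {F : α → Finset ι} {r : ℕ}
    (hF : ∀ a ∈ K, F a ⊆ E) (hr : ∀ a ∈ K, (F a).card = r)
    (hd : (K : Set α).PairwiseDisjoint F) {t : ℝ} (ht : 0 ≤ t) :
    bernoulliProb E p
        (fun ω => 2 * (K.card * (p : ℝ) ^ r) + 10 * t < (K.filter fun a => F a ⊆ ω).card)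
      ≤ Real.exp (-(6 * t)) := by
  set μ : ℝ := K.card * (p : ℝ) ^ r with hμ_def
  have hpr : 0 ≤ (p : ℝ) ^ r := pow_nonneg p.2.1 r
  have hμ : 0 ≤ μ := by positivity
  have hlarge : ∀ ω ⊆ E, 2 * μ + 10 * t < (K.filter fun a => F a ⊆ ω).card →
      Real.exp (μ + 6 * t) ≤ 2 ^ (K.filter fun a => F a ⊆ ω).card := by
    intro ω _ h
    rw [← Real.exp_log (x := (2 : ℝ) ^ _) (by positivity), Real.log_pow]
    refine Real.exp_le_exp.2 ?_
    nlinarith [Real.log_two_gt_d9, Nat.cast_nonneg (α := ℝ) (K.filter fun a => F a ⊆ ω).card]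
  have hmoment : (1 + (p : ℝ) ^ r) ^ K.card ≤ Real.exp μ := by
    rw [hμ_def, Real.exp_nat_mul, add_comm]
    exact pow_le_pow_left₀ (by positivity) (Real.add_one_le_exp _) _
  calc _ ≤ (1 + (p : ℝ) ^ r) ^ K.card / Real.exp (μ + 6 * t) := by
        rw [← bernoulliExp_two_pow_card hF hr hd]
        exact bernoulliProb_le_exp_div (Real.exp_pos _) (fun ω _ => by positivity) hlarge
    _ ≤ Real.exp μ / Real.exp (μ + 6 * t) := by gcongr
    _ = Real.exp (-(6 * t)) := by rw [← Real.exp_sub]; ring_nf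

end RandomSubset

section RandomGraph

variable {V : Type*} [Fintype V] [DecidableEq V]

/-- The possible edges of a graph on `V`, the ground set of the random edge set. -/
abbrev allEdges (V : Type*) [Fintype V] [DecidableEq V] : Finset (Sym2 V) :=
  (⊤ : SimpleGraph V).edgeFinset

/-- The graph with edge set `ω`; elements of the diagonal in `ω` are ignored. -/
def edgeGraph (ω : Finset (Sym2 V)) : SimpleGraph V :=
  SimpleGraph.fromEdgeSet (ω : Set (Sym2 V))

lemma mem_allEdges {i j : V} : s(i, j) ∈ allEdges V ↔ i ≠ j := by
  simp

lemma edgeGraph_adj {ω : Finset (Sym2 V)} (hω : ω ⊆ allEdges V) {i j : V} :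
    (edgeGraph ω).Adj i j ↔ s(i, j) ∈ ω := by
  simp only [edgeGraph, SimpleGraph.fromEdgeSet_adj, Finset.mem_coe, and_iff_left_iff_imp]
  exact fun h => mem_allEdges.1 (hω h)

lemma edgeGraph_edgeSet {ω : Finset (Sym2 V)} (hω : ω ⊆ allEdges V) :
    (edgeGraph ω).edgeSet = ω := by
  ext e
  induction e with
  | _ i j => simp [SimpleGraph.mem_edgeSet, edgeGraph_adj hω]

lemma sum_simpleGraph_eq_sum_edgeGraph (f : SimpleGraph V → ℝ) :
    ∑ G, f G = ∑ ω ∈ (allEdges V).powerset, f (edgeGraph ω) := by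
  classical
  symm
  refine Finset.sum_bij (fun ω _ => edgeGraph ω) (fun _ _ => Finset.mem_univ _) ?_ ?_
    fun _ _ => rfl
  · intro ω₁ h₁ ω₂ h₂ heq
    rw [← Finset.coe_inj, ← edgeGraph_edgeSet (Finset.mem_powerset.1 h₁), heq,
      edgeGraph_edgeSet (Finset.mem_powerset.1 h₂)]
  · intro G _
    refine ⟨G.edgeFinset, Finset.mem_powerset.2 (SimpleGraph.edgeFinset_mono le_top), ?_⟩
    simp [edgeGraph]

lemma binomialRandom_real_eq_sum_singleton (p : unitInterval) (S : Set (SimpleGraph V))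
    [DecidablePred (· ∈ S)] :
    (SimpleGraph.binomialRandom V p).real S
      = ∑ G, (SimpleGraph.binomialRandom V p).real {G} * if G ∈ S then 1 else 0 := by
  classical
  have : MeasurableSingletonClass (SimpleGraph V) := ⟨fun G => by
    rw [← SimpleGraph.measurableEmbedding_edgeSet.measurableSet_image, Set.image_singleton]
    exact MeasurableSet.singleton _⟩
  have h := MeasureTheory.sum_measureReal_singleton
    (μ := SimpleGraph.binomialRandom V p) (Finset.univ.filter fun G => G ∈ S)
  simp only [Finset.coe_filter, Finset.mem_univ, true_and, Set.ofPred_mem_eq] at h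
  simp only [← h, Finset.sum_filter, mul_ite, mul_one, mul_zero]

lemma binomialRandom_real_eq_bernoulliProb (p : unitInterval) (S : Set (SimpleGraph V)) :
    (SimpleGraph.binomialRandom V p).real S
      = bernoulliProb (allEdges V) p fun ω => edgeGraph ω ∈ S := by
  classical
  rw [binomialRandom_real_eq_sum_singleton, sum_simpleGraph_eq_sum_edgeGraph, bernoulliProb,
    bernoulliExp]
  refine Finset.sum_congr rfl fun ω hω => ?_
  have hω := Finset.mem_powerset.1 hω
  congr 1
  rw [MeasureTheory.Measure.real, SimpleGraph.binomialRandom_singleton, edgeGraph_edgeSet hω,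
    Set.ncard_coe_finset, Finset.card_sdiff_of_subset hω,
    SimpleGraph.card_edgeFinset_top_eq_card_choose_two, Nat.card_eq_fintype_card]
  simp [ENNReal.toReal_mul, unitInterval.toNNReal]
  rfl

end RandomGraph

section TracePower

open Matrix
open scoped MatrixOrder

variable {m : Type*} [Fintype m]

lemma mul_pow_add_mul_pow_le {x y : ℝ} (hx : 0 ≤ x) (hy : 0 ≤ y) (a b : ℕ) :
    x ^ a * y ^ b + y ^ a * x ^ b ≤ x ^ (a + b) + y ^ (a + b) := by
  have h : 0 ≤ (x ^ a - y ^ a) * (x ^ b - y ^ b) := by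
    rcases le_total x y with h | h
    · exact mul_nonneg_of_nonpos_of_nonpos (sub_nonpos.2 (pow_le_pow_left₀ hx h a))
        (sub_nonpos.2 (pow_le_pow_left₀ hx h b))
    · exact mul_nonneg (sub_nonneg.2 (pow_le_pow_left₀ hy h a))
        (sub_nonneg.2 (pow_le_pow_left₀ hy h b))
  rw [pow_add, pow_add]
  linarith

lemma sum_mul_pow_mul_pow_le {w : m → m → ℝ} (hw : ∀ x y, 0 ≤ w x y) (hsymm : ∀ x y, w x y = w y x)
    {d : m → ℝ} (hd : ∀ x, 0 ≤ d x) (a b : ℕ) :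
    ∑ x, ∑ y, w x y * (d x ^ a * d y ^ b) ≤ ∑ x, ∑ y, w x y * d x ^ (a + b) := by
  have hswap : ∀ g : m → m → ℝ, ∑ x, ∑ y, w x y * g x y = ∑ x, ∑ y, w x y * g y x := fun g => by
    rw [Finset.sum_comm]
    exact Finset.sum_congr rfl fun x _ => Finset.sum_congr rfl fun y _ => by rw [hsymm]
  have hadd : ∑ x, ∑ y, w x y * (d x ^ a * d y ^ b) + ∑ x, ∑ y, w x y * (d y ^ a * d x ^ b)
      ≤ ∑ x, ∑ y, w x y * d x ^ (a + b) + ∑ x, ∑ y, w x y * d y ^ (a + b) := by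
    simp only [← Finset.sum_add_distrib, ← mul_add]
    exact Finset.sum_le_sum fun x _ => Finset.sum_le_sum fun y _ =>
      mul_le_mul_of_nonneg_left (mul_pow_add_mul_pow_le (hd x) (hd y) a b) (hw x y)
  have hleft := hswap fun x y => d x ^ a * d y ^ b
  have hright := hswap fun x _ => d x ^ (a + b)
  linarith

lemma transpose_conj_le_conj {A B : Matrix m m ℝ} (h : A ≤ B) (U : Matrix m m ℝ) :
    Uᵀ * A * U ≤ Uᵀ * B * U := by
  simpa only [star_eq_conjTranspose, conjTranspose_eq_transpose_of_trivial]
    using star_left_conjugate_le_conjugate h U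

lemma trace_mul_nonneg {A B : Matrix m m ℝ} (hA : 0 ≤ A) (hB : 0 ≤ B) : 0 ≤ (A * B).trace := by
  classical
  obtain ⟨C, rfl⟩ := CStarAlgebra.nonneg_iff_eq_star_mul_self.1 hB
  rw [← Matrix.mul_assoc, trace_mul_comm, ← Matrix.mul_assoc]
  exact (nonneg_iff_posSemidef.1 (star_right_conjugate_nonneg hA C)).trace_nonneg

variable [DecidableEq m]

lemma exists_orthogonal_diagonalization {N : Matrix m m ℝ} (hN : N.IsHermitian) :
    ∃ (U : Matrix m m ℝ) (d : m → ℝ), Uᵀ * U = 1 ∧ U * Uᵀ = 1 ∧ N = U * diagonal d * Uᵀ := by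
  refine ⟨hN.eigenvectorUnitary, hN.eigenvalues, ?_, ?_, ?_⟩
  · have := Unitary.coe_star_mul_self hN.eigenvectorUnitary
    rwa [star_eq_conjTranspose, conjTranspose_eq_transpose_of_trivial] at this
  · have := Unitary.coe_mul_star_self hN.eigenvectorUnitary
    rwa [Unitary.coe_star, star_eq_conjTranspose, conjTranspose_eq_transpose_of_trivial] at this
  · have := hN.spectral_theorem
    rwa [Unitary.conjStarAlgAut_apply, star_eq_conjTranspose,
      conjTranspose_eq_transpose_of_trivial] at this

lemma orthogonal_conj_pow {U : Matrix m m ℝ} (hU : Uᵀ * U = 1) (hU' : U * Uᵀ = 1)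
    (D : Matrix m m ℝ) (k : ℕ) : (U * D * Uᵀ) ^ k = U * D ^ k * Uᵀ :=
  Units.conj_pow ⟨U, Uᵀ, hU', hU⟩ D k

lemma le_of_smul_one_le_conj_diagonal {U : Matrix m m ℝ} (hU : Uᵀ * U = 1) {d : m → ℝ} {r : ℝ}
    (h : r • 1 ≤ U * diagonal d * Uᵀ) (x : m) : r ≤ d x := by
  have hconj := transpose_conj_le_conj h U
  have hcancel : Uᵀ * (U * diagonal d * Uᵀ) * U = diagonal d := by
    calc _ = (Uᵀ * U) * diagonal d * (Uᵀ * U) := by simp only [Matrix.mul_assoc]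
      _ = _ := by rw [hU, Matrix.one_mul, Matrix.mul_one]
  rw [hcancel, mul_smul_comm, smul_mul_assoc, mul_one, hU, Matrix.le_iff] at hconj
  simpa using hconj.diag_nonneg (i := x)

lemma mul_self_le_smul {Z : Matrix m m ℝ} {R : ℝ} (hZ : 0 ≤ Z) (hZR : Z ≤ R • 1) :
    Z * Z ≤ R • Z := by
  obtain ⟨S, hS, hSZ⟩ : ∃ S : Matrix m m ℝ, star S = S ∧ S * S = Z :=
    ⟨CFC.sqrt Z, (CFC.sqrt_nonneg Z).isSelfAdjoint, CFC.sqrt_mul_sqrt_self Z hZ⟩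
  have h := star_left_conjugate_le_conjugate hZR S
  rw [hS, mul_smul_comm, smul_mul_assoc, mul_one, hSZ] at h
  convert h using 1
  rw [← hSZ]
  simp only [Matrix.mul_assoc]

lemma trace_mul_diagonal_pow_mul_diagonal_pow_le {d : m → ℝ} {Z : Matrix m m ℝ} {r R : ℝ}
    (hr : 0 < r) (hR : 0 ≤ R) (hd : ∀ x, r ≤ d x) (hZ : 0 ≤ Z) (hZR : Z ≤ R • 1) (a b : ℕ) :
    (Z * diagonal d ^ a * (Z * diagonal d ^ b)).trace
      ≤ R / r * (Z * diagonal d ^ (a + b + 1)).trace := by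
  have hd0 : ∀ x, 0 ≤ d x := fun x => hr.le.trans (hd x)
  have hZp := nonneg_iff_posSemidef.1 hZ
  have hsymm : ∀ x y, Z x y = Z y x := fun x y => by simpa using (hZp.1.apply x y).symm
  have hrow : ∀ x, ∑ y, Z x y ^ 2 ≤ R * Z x x := by
    intro x
    have h := (mul_self_le_smul hZ hZR : (R • Z - Z * Z).PosSemidef).diag_nonneg (i := x)
    rw [Matrix.sub_apply, Matrix.smul_apply, smul_eq_mul, mul_apply, sub_nonneg] at h
    exact le_of_eq_of_le (Finset.sum_congr rfl fun y _ => by rw [hsymm y x, sq]) h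
  have hleft : (Z * diagonal d ^ a * (Z * diagonal d ^ b)).trace
      = ∑ x, ∑ y, Z x y ^ 2 * (d x ^ b * d y ^ a) := by
    simp only [diagonal_pow, trace, diag_apply, mul_apply (N := Z * _), mul_diagonal, Pi.pow_apply]
    exact Finset.sum_congr rfl fun x _ => Finset.sum_congr rfl fun y _ => by
      rw [hsymm y x]; ring
  have hright : (Z * diagonal d ^ (a + b + 1)).trace = ∑ x, Z x x * d x ^ (a + b + 1) := by
    simp only [diagonal_pow, trace, diag_apply, mul_diagonal, Pi.pow_apply]
  rw [hleft, hright, Finset.mul_sum]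
  refine (sum_mul_pow_mul_pow_le (fun _ _ => sq_nonneg _) (fun x y => by rw [hsymm]) hd0
    b a).trans (Finset.sum_le_sum fun x _ => ?_)
  have hpow := pow_nonneg (hd0 x) (a + b)
  rw [← Finset.sum_mul, add_comm b a]
  calc (∑ y, Z x y ^ 2) * d x ^ (a + b) ≤ R * Z x x * d x ^ (a + b) := by
        gcongr
        exact hrow x
    _ = R / r * (Z x x * (d x ^ (a + b) * r)) := by field_simp
    _ ≤ R / r * (Z x x * d x ^ (a + b + 1)) := by
        rw [pow_succ]
        have := hd x
        have := hZp.diag_nonneg (i := x)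
        gcongr

lemma trace_mul_pow_mul_pow_le {N Z : Matrix m m ℝ} {r R : ℝ} (hr : 0 < r) (hR : 0 ≤ R)
    (hN : r • 1 ≤ N) (hZ : 0 ≤ Z) (hZR : Z ≤ R • 1) (a b : ℕ) :
    (Z * N ^ a * (Z * N ^ b)).trace ≤ R / r * (Z * N ^ (a + b + 1)).trace := by
  have hN0 : 0 ≤ N := (smul_nonneg hr.le zero_le_one).trans hN
  obtain ⟨U, d, hU, hU', rfl⟩ := exists_orthogonal_diagonalization (nonneg_iff_posSemidef.1 hN0).1
  have hZ' : 0 ≤ Uᵀ * Z * U := by simpa using transpose_conj_le_conj hZ U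
  have hZR' : Uᵀ * Z * U ≤ R • 1 := by
    have h := transpose_conj_le_conj hZR U
    rwa [mul_smul_comm, smul_mul_assoc, mul_one, hU] at h
  have htrace : ∀ A B : Matrix m m ℝ, (A * (U * B * Uᵀ)).trace = (Uᵀ * A * U * B).trace :=
    fun A B => by
      rw [← Matrix.mul_assoc, trace_mul_comm]
      simp only [Matrix.mul_assoc]
  convert trace_mul_diagonal_pow_mul_diagonal_pow_le hr hR
    (le_of_smul_one_le_conj_diagonal hU hN) hZ' hZR' a b using 1
  · rw [orthogonal_conj_pow hU hU', orthogonal_conj_pow hU hU', ← Matrix.mul_assoc, htrace]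
    simp only [Matrix.mul_assoc]
  · rw [orthogonal_conj_pow hU hU', htrace]

section Derivative

attribute [local instance] Matrix.linftyOpNormedRing Matrix.linftyOpNormedAlgebra

lemma hasDerivAt_trace_mul_pow (A M Z : Matrix m m ℝ) (k : ℕ) (s : ℝ) :
    HasDerivAt (fun s : ℝ => (A * (M + s • Z) ^ k).trace)
      (∑ i ∈ Finset.range k, (A * ((M + s • Z) ^ (k - 1 - i) * Z * (M + s • Z) ^ i)).trace) s := by
  have hline : HasDerivAt (fun s : ℝ => M + s • Z) Z s := by
    have h := ((hasDerivAt_id s).smul_const Z).const_add M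
    rwa [one_smul] at h
  have htrace :=
    (LinearMap.toContinuousLinearMap (traceLinearMap m ℝ ℝ)).hasFDerivAt.comp_hasDerivAt s
      ((hline.fun_pow' k).const_mul A)
  rw [← trace_sum, ← Finset.mul_sum]
  exact htrace

end Derivative

lemma hasDerivAt_trace_pow (M Z : Matrix m m ℝ) (k : ℕ) (s : ℝ) :
    HasDerivAt (fun s : ℝ => ((M + s • Z) ^ k).trace)
      (k * (Z * (M + s • Z) ^ (k - 1)).trace) s := by
  have h := hasDerivAt_trace_mul_pow 1 M Z k s
  simp only [one_mul] at h
  convert h using 1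
  rw [← nsmul_eq_mul, ← Finset.card_range k, ← Finset.sum_const, Finset.card_range]
  refine Finset.sum_congr rfl fun i hi => ?_
  rw [trace_mul_comm (_ * Z), ← Matrix.mul_assoc, ← pow_add, trace_mul_comm Z,
    show i + (k - 1 - i) = k - 1 by grind]

lemma le_exp_mul_of_hasDerivAt_le {h h' : ℝ → ℝ} {c : ℝ} (hder : ∀ s, HasDerivAt h (h' s) s)
    (hle : ∀ s, 0 ≤ s → h' s ≤ c * h s) {s : ℝ} (hs : 0 ≤ s) : h s ≤ Real.exp (c * s) * h 0 := by
  have hprod : ∀ s, HasDerivAt (fun s => h s * Real.exp (-(c * s))) _ s := fun s =>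
    (hder s).mul (((hasDerivAt_id s).const_mul c).neg.exp)
  have hanti : AntitoneOn (fun s => h s * Real.exp (-(c * s))) (Set.Ici 0) := by
    refine antitoneOn_of_deriv_nonpos (convex_Ici 0)
      (fun s _ => (hprod s).continuousAt.continuousWithinAt)
      (fun s _ => (hprod s).differentiableAt.differentiableWithinAt) fun s hs => ?_
    rw [interior_Ici] at hs
    rw [(hprod s).deriv]
    have hexp := Real.exp_pos (-(c * s))
    simp only [id, Pi.neg_apply]
    nlinarith [hle s (le_of_lt hs)]
  have h0 := hanti (Set.mem_Ici.2 le_rfl) (Set.mem_Ici.2 hs) hs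
  simp only [mul_zero, neg_zero, Real.exp_zero, mul_one, Real.exp_neg] at h0
  rwa [← div_eq_mul_inv, div_le_iff₀ (Real.exp_pos _), mul_comm] at h0

-- The derivative in `s` is a sum of `k` traces, each bounded by `trace_mul_pow_mul_pow_le`, so the
-- trace grows at most exponentially with rate `k R / r`.
lemma trace_mul_add_smul_pow_le {M Z : Matrix m m ℝ} {r R : ℝ} (hr : 0 < r) (hR : 0 ≤ R)
    (hM : r • 1 ≤ M) (hZ : 0 ≤ Z) (hZR : Z ≤ R • 1) (k : ℕ) {s : ℝ} (hs : 0 ≤ s) :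
    (Z * (M + s • Z) ^ k).trace ≤ Real.exp (k * (R / r) * s) * (Z * M ^ k).trace := by
  have h := le_exp_mul_of_hasDerivAt_le (c := k * (R / r))
    (fun s => hasDerivAt_trace_mul_pow Z M Z k s) (fun s hs => ?_) hs
  · simpa only [zero_smul, add_zero] using h
  have hMs : r • 1 ≤ M + s • Z := hM.trans (le_add_of_nonneg_right (smul_nonneg hs hZ))
  calc _ ≤ ∑ _i ∈ Finset.range k, R / r * (Z * (M + s • Z) ^ k).trace := by
        refine Finset.sum_le_sum fun i _ => ?_
        have := trace_mul_pow_mul_pow_le hr hR hMs hZ hZR (k - 1 - i) i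
        rw [show k - 1 - i + i + 1 = k by grind] at this
        simpa only [Matrix.mul_assoc] using this
    _ = k * (R / r) * (Z * (M + s • Z) ^ k).trace := by simp; ring

lemma trace_add_pow_le {M Z : Matrix m m ℝ} {r R : ℝ} (hr : 0 < r) (hR : 0 ≤ R) {q : ℕ}
    (hq : q * R ≤ r) (hM : r • 1 ≤ M) (hZ : 0 ≤ Z) (hZR : Z ≤ R • 1) :
    ((M + Z) ^ q).trace ≤ (M ^ q).trace + 3 * q * (Z * M ^ (q - 1)).trace := by
  have hM0 : 0 ≤ M := (smul_nonneg hr.le zero_le_one).trans hM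
  have htrace_nonneg : 0 ≤ (Z * M ^ (q - 1)).trace := trace_mul_nonneg hZ
    (nonneg_iff_posSemidef.2 ((nonneg_iff_posSemidef.1 hM0).pow (q - 1)))
  have hrate : ((q - 1 : ℕ) : ℝ) * (R / r) ≤ 1 := by
    have hsub : ((q - 1 : ℕ) : ℝ) ≤ q := by exact_mod_cast Nat.sub_le q 1
    calc _ ≤ q * (R / r) := by gcongr
      _ = q * R / r := by ring
      _ ≤ 1 := (div_le_one hr).2 hq
  have hslope : ∀ s ∈ Set.Icc (0 : ℝ) 1,
      (Z * (M + s • Z) ^ (q - 1)).trace ≤ 3 * (Z * M ^ (q - 1)).trace := by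
    intro s hs
    have : 0 ≤ ((q - 1 : ℕ) : ℝ) * (R / r) := by positivity
    have hexp : Real.exp ((q - 1 : ℕ) * (R / r) * s) ≤ 3 :=
      (Real.exp_le_exp.2 (by nlinarith [hs.1, hs.2])).trans Real.exp_one_lt_three.le
    exact (trace_mul_add_smul_pow_le hr hR hM hZ hZR _ hs.1).trans
      (mul_le_mul_of_nonneg_right hexp htrace_nonneg)
  have hderiv := hasDerivAt_trace_pow M Z q
  have hmvt := (convex_Icc (0 : ℝ) 1).image_sub_le_mul_sub_of_deriv_le
    (f := fun s : ℝ => ((M + s • Z) ^ q).trace) (C := q * (3 * (Z * M ^ (q - 1)).trace))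
    (fun s _ => (hderiv s).continuousAt.continuousWithinAt)
    (fun s _ => (hderiv s).differentiableAt.differentiableWithinAt)
    (fun s hs => by
      rw [(hderiv s).deriv]
      exact mul_le_mul_of_nonneg_left (hslope s (interior_subset hs)) q.cast_nonneg)
    0 (Set.left_mem_Icc.2 zero_le_one) 1 (Set.right_mem_Icc.2 zero_le_one) zero_le_one
  simp only [one_smul, zero_smul, add_zero, sub_zero, mul_one] at hmvt
  linarith

lemma le_smul_one_of_trace_pow_le {N : Matrix m m ℝ} (hN : 0 ≤ N) {B : ℝ} (hB : 0 ≤ B)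
    {q : ℕ} (hq : q ≠ 0) (h : (N ^ q).trace ≤ B ^ q) : N ≤ B • 1 := by
  obtain ⟨U, d, hU, hU', rfl⟩ := exists_orthogonal_diagonalization (nonneg_iff_posSemidef.1 hN).1
  have hd0 : ∀ x, 0 ≤ d x := le_of_smul_one_le_conj_diagonal hU (by simpa using hN)
  have htrace : ((U * diagonal d * Uᵀ) ^ q).trace = ∑ x, d x ^ q := by
    rw [orthogonal_conj_pow hU hU', trace_mul_comm, ← Matrix.mul_assoc, hU, Matrix.one_mul,
      diagonal_pow, trace_diagonal]
    rfl
  have hd : ∀ x, d x ≤ B := fun x => le_of_pow_le_pow_left₀ hq hB <|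
    (Finset.single_le_sum (f := fun x => d x ^ q) (fun y _ => pow_nonneg (hd0 y) q)
      (Finset.mem_univ x)).trans (htrace ▸ h)
  have hdiag : diagonal d ≤ B • (1 : Matrix m m ℝ) := by
    rw [smul_one_eq_diagonal, Matrix.le_iff, diagonal_sub]
    exact posSemidef_diagonal_iff.2 fun x => sub_nonneg.2 (hd x)
  have hconj := transpose_conj_le_conj hdiag Uᵀ
  rwa [transpose_transpose, mul_smul_comm, smul_mul_assoc, mul_one, hU'] at hconj

end TracePower

section MatrixChernoff

open Matrix
open scoped MatrixOrder

variable {ι : Type*} [DecidableEq ι] {E : Finset ι} {p : unitInterval}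
variable {m : Type*} [Fintype m] [DecidableEq m]

lemma trace_pow_pred_le {M : Matrix m m ℝ} {r : ℝ} (hr : 0 < r) (hM : r • 1 ≤ M) {q : ℕ}
    (hq : q ≠ 0) : (M ^ (q - 1)).trace ≤ r⁻¹ * (M ^ q).trace := by
  have hM0 : 0 ≤ M := (smul_nonneg hr.le zero_le_one).trans hM
  have h := trace_mul_nonneg (sub_nonneg.2 hM)
    (nonneg_iff_posSemidef.2 ((nonneg_iff_posSemidef.1 hM0).pow (q - 1)))
  rw [sub_mul, trace_sub, ← pow_succ', Nat.sub_add_cancel (Nat.pos_of_ne_zero hq),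
    smul_mul_assoc, one_mul, trace_smul, smul_eq_mul, sub_nonneg] at h
  rwa [← div_eq_inv_mul, le_div_iff₀' hr]

lemma bernoulliExp_trace_add_pow_le {M Z : Finset ι → Matrix m m ℝ} {r R μ : ℝ} (hr : 0 < r)
    (hR : 0 ≤ R) (hμ : 0 ≤ μ) {q : ℕ} (hq0 : q ≠ 0) (hq : q * R ≤ r) (hM : ∀ ω, r • 1 ≤ M ω)
    (hZ : ∀ ω, 0 ≤ Z ω) (hZR : ∀ ω, Z ω ≤ R • 1)
    (hmean : bernoulliExp E p (fun ω => (Z ω * M ω ^ (q - 1)).trace)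
      ≤ μ * bernoulliExp E p (fun ω => (M ω ^ (q - 1)).trace)) :
    bernoulliExp E p (fun ω => ((M ω + Z ω) ^ q).trace)
      ≤ (1 + 3 * q * μ / r) * bernoulliExp E p (fun ω => (M ω ^ q).trace) := by
  have hstep : bernoulliExp E p (fun ω => ((M ω + Z ω) ^ q).trace)
      ≤ bernoulliExp E p (fun ω => (M ω ^ q).trace)
        + 3 * q * bernoulliExp E p (fun ω => (Z ω * M ω ^ (q - 1)).trace) := by
    rw [← bernoulliExp_const_mul, ← bernoulliExp_add]
    exact bernoulliExp_mono fun ω _ => trace_add_pow_le hr hR hq (hM ω) (hZ ω) (hZR ω)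
  have hpred : bernoulliExp E p (fun ω => (M ω ^ (q - 1)).trace)
      ≤ r⁻¹ * bernoulliExp E p (fun ω => (M ω ^ q).trace) := by
    rw [← bernoulliExp_const_mul]
    exact bernoulliExp_mono fun ω _ => trace_pow_pred_le hr (hM ω) hq0
  calc _ ≤ _ := hstep
    _ ≤ bernoulliExp E p (fun ω => (M ω ^ q).trace)
        + 3 * q * (μ * (r⁻¹ * bernoulliExp E p (fun ω => (M ω ^ q).trace))) := by
        gcongr
        exact hmean.trans (mul_le_mul_of_nonneg_left hpred hμ)
    _ = _ := by ring

-- A matrix Chernoff bound for moments: adding the summands one at a time, each step multiplies the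
-- moment by at most `1 + 3 q μ / r`.
lemma bernoulliExp_trace_sum_pow_le {α : Type*} {L : Finset α}
    {Z : α → Finset ι → Matrix m m ℝ} {r R μ : ℝ} (hr : 0 < r) (hR : 0 ≤ R) (hμ : 0 ≤ μ) {q : ℕ}
    (hq0 : q ≠ 0) (hq : q * R ≤ r) (hZ : ∀ l ω, 0 ≤ Z l ω) (hZR : ∀ l ω, Z l ω ≤ R • 1)
    (hmean : ∀ J ⊆ L, ∀ l ∈ L, l ∉ J →
      bernoulliExp E p (fun ω => (Z l ω * (r • 1 + ∑ a ∈ J, Z a ω) ^ (q - 1)).trace)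
        ≤ μ * bernoulliExp E p (fun ω => ((r • 1 + ∑ a ∈ J, Z a ω) ^ (q - 1)).trace)) :
    bernoulliExp E p (fun ω => ((r • 1 + ∑ a ∈ L, Z a ω) ^ q).trace)
      ≤ (1 + 3 * q * μ / r) ^ L.card * (Fintype.card m * r ^ q) := by
  classical
  suffices H : ∀ J ⊆ L, bernoulliExp E p (fun ω => ((r • 1 + ∑ a ∈ J, Z a ω) ^ q).trace)
      ≤ (1 + 3 * q * μ / r) ^ J.card * (Fintype.card m * r ^ q) from H L subset_rfl
  intro J
  induction J using Finset.induction_on with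
  | empty =>
    intro _
    simp [smul_pow, bernoulliExp_const, mul_comm]
  | insert l J hl ih =>
    intro hJ
    have hJL : J ⊆ L := (Finset.subset_insert l J).trans hJ
    have hM : ∀ ω, r • (1 : Matrix m m ℝ) ≤ r • 1 + ∑ a ∈ J, Z a ω := fun ω =>
      le_add_of_nonneg_right (Finset.sum_nonneg fun a _ => hZ a ω)
    have hstep := bernoulliExp_trace_add_pow_le hr hR hμ hq0 hq hM (hZ l) (hZR l)
      (hmean J hJL l (hJ (Finset.mem_insert_self l J)) hl)
    simp only [Finset.sum_insert hl, add_comm (Z l _), ← add_assoc]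
    rw [Finset.card_insert_of_notMem hl, pow_succ', mul_assoc]
    exact hstep.trans (mul_le_mul_of_nonneg_left (ih hJL) (by positivity))

lemma one_add_mul_div_pow_le_exp {μ R : ℝ} (hμ : 0 ≤ μ) (hR : 0 < R) {q N : ℕ} (hq : q ≠ 0)
    (hN : N * μ ≤ R) : (1 + 3 * q * μ / (q * R)) ^ N ≤ Real.exp 3 := by
  have hcancel : 3 * q * μ / (q * R) = 3 * μ / R := by field_simp
  have hexponent : N * (3 * μ / R) ≤ 3 := by
    rw [← mul_div_assoc, div_le_iff₀ hR]
    linarith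
  calc _ ≤ Real.exp (3 * μ / R) ^ N := by
        rw [hcancel, add_comm]
        exact pow_le_pow_left₀ (by positivity) (Real.add_one_le_exp _) _
    _ = Real.exp (N * (3 * μ / R)) := (Real.exp_nat_mul _ _).symm
    _ ≤ Real.exp 3 := Real.exp_le_exp.2 hexponent

lemma exp_natCast_le_three_pow (k : ℕ) : Real.exp k ≤ 3 ^ k := by
  rw [← Real.exp_one_pow]
  exact pow_le_pow_left₀ (Real.exp_pos 1).le Real.exp_one_lt_three.le k

lemma bernoulliProb_not_sum_le_smul_one_le {α : Type*} {L : Finset α}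
    {Z : α → Finset ι → Matrix m m ℝ} {R μ : ℝ} (hR : 0 < R) (hμ : 0 ≤ μ) {q : ℕ} (hq : q ≠ 0)
    (hLμ : L.card * μ ≤ R) (hZ : ∀ l ω, 0 ≤ Z l ω) (hZR : ∀ l ω, Z l ω ≤ R • 1)
    (hmean : ∀ J ⊆ L, ∀ l ∈ L, l ∉ J →
      bernoulliExp E p (fun ω => (Z l ω * ((q * R) • 1 + ∑ a ∈ J, Z a ω) ^ (q - 1)).trace)
        ≤ μ * bernoulliExp E p (fun ω => (((q * R) • 1 + ∑ a ∈ J, Z a ω) ^ (q - 1)).trace)) :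
    bernoulliProb E p (fun ω => ¬ ∑ l ∈ L, Z l ω ≤ (3 * (q * R)) • 1)
      ≤ Real.exp 3 * Fintype.card m * Real.exp (-q) := by
  have hr : 0 < q * R := mul_pos (by exact_mod_cast Nat.pos_of_ne_zero hq) hR
  have hr_nonneg : (0 : Matrix m m ℝ) ≤ (q * R) • 1 := smul_nonneg hr.le zero_le_one
  have hN : ∀ ω, 0 ≤ (q * R) • 1 + ∑ l ∈ L, Z l ω := fun ω =>
    add_nonneg hr_nonneg (Finset.sum_nonneg fun l _ => hZ l ω)
  have hlarge : ∀ ω ⊆ E, ¬ ∑ l ∈ L, Z l ω ≤ (3 * (q * R)) • 1 →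
      (3 * (q * R)) ^ q ≤ (((q * R) • 1 + ∑ l ∈ L, Z l ω) ^ q).trace := by
    intro ω _ h
    contrapose! h
    exact (le_add_of_nonneg_left hr_nonneg).trans
      (le_smul_one_of_trace_pow_le (hN ω) (by positivity) hq h.le)
  have hexp : 1 ≤ 3 ^ q * Real.exp (-q) := by
    rw [Real.exp_neg, ← div_eq_mul_inv, one_le_div (Real.exp_pos _)]
    exact exp_natCast_le_three_pow q
  refine (bernoulliProb_le_exp_div (by positivity) (fun ω _ => ((nonneg_iff_posSemidef.1
    (hN ω)).pow q).trace_nonneg) hlarge).trans ((div_le_iff₀ (by positivity)).2 ?_)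
  calc _ ≤ _ := bernoulliExp_trace_sum_pow_le hr hR.le hμ hq le_rfl hZ hZR hmean
    _ ≤ Real.exp 3 * (Fintype.card m * (q * R) ^ q * 1) := by
        rw [mul_one]
        gcongr
        exact one_add_mul_div_pow_le_exp hμ hR hq hLμ
    _ ≤ Real.exp 3 * (Fintype.card m * (q * R) ^ q * (3 ^ q * Real.exp (-q))) := by gcongr
    _ = _ := by ring

end MatrixChernoff

section CliqueMatrix

open Matrix
open scoped MatrixOrder

variable {V : Type*}

/-- All weighted codegrees from `V₁ × V₂` into `V₃` are at most `D`. -/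
def CodegLE (c : V → V → ℝ) (V₁ V₂ V₃ : Finset V) (D : ℝ) : Prop :=
  ∀ i ∈ V₁, ∀ j ∈ V₂, ∑ k ∈ V₃, c i k ^ 2 * c j k ^ 2 ≤ D

lemma codegLE_congr {c c' : V → V → ℝ} {V₁ V₂ V₃ : Finset V} {l : V} (h₁ : l ∉ V₁)
    (h₂ : l ∉ V₂) (h₃ : l ∉ V₃) (hc : ∀ u w, u ≠ l → w ≠ l → c u w = c' u w) (D : ℝ) :
    CodegLE c V₁ V₂ V₃ D ↔ CodegLE c' V₁ V₂ V₃ D := by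
  refine forall₂_congr fun i hi => forall₂_congr fun j hj => ?_
  rw [Finset.sum_congr rfl fun k hk => by
    rw [hc i k (ne_of_mem_of_not_mem hi h₁) (ne_of_mem_of_not_mem hk h₃),
      hc j k (ne_of_mem_of_not_mem hj h₂) (ne_of_mem_of_not_mem hk h₃)]]

variable [DecidableEq V]

/-- The centred indicator of the edge `{i, j}`. -/
def edgeDev (p : ℝ) (ω : Finset (Sym2 V)) (i j : V) : ℝ :=
  (if s(i, j) ∈ ω then 1 else 0) - p

lemma edgeDev_comm (p : ℝ) (ω : Finset (Sym2 V)) (i j : V) : edgeDev p ω i j = edgeDev p ω j i := by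
  rw [edgeDev, edgeDev, Sym2.eq_swap]

lemma edgeDev_insert_of_ne (p : ℝ) (ω : Finset (Sym2 V)) (a : V) {l u w : V} (hu : u ≠ l)
    (hw : w ≠ l) : edgeDev p (insert s(a, l) ω) u w = edgeDev p ω u w := by
  have hne : s(u, w) ≠ s(a, l) := by
    rw [Ne, Sym2.eq_iff]
    tauto
  simp [edgeDev, hne]

lemma edgeDev_insert_of_ne_left (p : ℝ) (ω : Finset (Sym2 V)) {a l u : V} (hu : u ≠ a) :
    edgeDev p (insert s(a, l) ω) u l = edgeDev p ω u l := by
  have hne : s(u, l) ≠ s(a, l) := by rwa [Ne, Sym2.congr_left]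
  simp [edgeDev, hne]

lemma abs_edgeDev_le_one (p : unitInterval) (ω : Finset (Sym2 V)) (i j : V) :
    |edgeDev p ω i j| ≤ 1 := by
  have h0 := p.2.1
  have h1 := p.2.2
  unfold edgeDev
  split_ifs <;> rw [abs_le] <;> constructor <;> linarith

section EdgeMoments

variable [Fintype V] {p : unitInterval} {a l : V} {F : Finset (Sym2 V) → ℝ}

lemma bernoulliExp_mul_edgeDev (hal : a ≠ l) (hF : Ignores s(a, l) F) (ψ : ℝ → ℝ) :
    bernoulliExp (allEdges V) p (fun ω => F ω * ψ (edgeDev p ω a l))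
      = (p * ψ (1 - p) + (1 - p) * ψ (-p)) * bernoulliExp (allEdges V) p F := by
  classical
  have h := bernoulliExp_mul_of_ignores (p := p) (mem_allEdges.2 hal) hF
    (fun P => ψ ((if P then 1 else 0) - p))
  simp only [if_true, if_false, zero_sub] at h
  rw [← h]
  refine bernoulliExp_congr fun ω _ => ?_
  unfold edgeDev
  congr

lemma bernoulliExp_mul_edgeDev_eq_zero (hal : a ≠ l) (hF : Ignores s(a, l) F) :
    bernoulliExp (allEdges V) p (fun ω => F ω * edgeDev p ω a l) = 0 := by
  rw [bernoulliExp_mul_edgeDev hal hF fun t => t]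
  ring

lemma bernoulliExp_mul_edgeDev_sq_le (hal : a ≠ l) (hF : Ignores s(a, l) F) (hF0 : ∀ ω, 0 ≤ F ω) :
    bernoulliExp (allEdges V) p (fun ω => F ω * edgeDev p ω a l ^ 2)
      ≤ p * bernoulliExp (allEdges V) p F := by
  rw [bernoulliExp_mul_edgeDev hal hF fun t => t ^ 2]
  exact mul_le_mul_of_nonneg_right (by nlinarith [p.2.1])
    (bernoulliExp_nonneg fun ω _ => hF0 ω)

lemma bernoulliExp_mul_abs_edgeDev_le (hal : a ≠ l) (hF : Ignores s(a, l) F)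
    (hF0 : ∀ ω, 0 ≤ F ω) :
    bernoulliExp (allEdges V) p (fun ω => F ω * |edgeDev p ω a l|)
      ≤ 2 * p * bernoulliExp (allEdges V) p F := by
  have h0 := p.2.1
  have h1 := p.2.2
  rw [bernoulliExp_mul_edgeDev hal hF fun t => |t|, abs_neg, abs_of_nonneg h0,
    abs_of_nonneg (sub_nonneg.2 h1)]
  exact mul_le_mul_of_nonneg_right (by nlinarith) (bernoulliExp_nonneg fun ω _ => hF0 ω)

end EdgeMoments

/-- The vector indexed by pairs `(i, j) ∈ V₁ × V₂` that multiplies the weights `c` of the four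
edges between `{i, j}` and `{k, l}` with the square root of the weight of `{i, j}`. -/
noncomputable def pairVec (c : V → V → ℝ) (V₁ V₂ : Finset V) (k l : V) : V × V → ℝ := fun x =>
  if x ∈ V₁ ×ˢ V₂ then √|c x.1 x.2| * (c x.1 k * c x.2 k * (c x.1 l * c x.2 l)) else 0

/-- The contribution of the vertex `l` to the Gram matrix of the vectors `pairVec`, weighted by
`|c k l|`. -/
noncomputable def vertexGram (c : V → V → ℝ) (V₁ V₂ V₃ : Finset V) (l : V) :
    Matrix (V × V) (V × V) ℝ :=
  ∑ k ∈ V₃, |c k l| • vecMulVec (pairVec c V₁ V₂ k l) (pairVec c V₁ V₂ k l)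

open scoped Classical in
/-- `vertexGram`, replaced by `0` unless its eigenvalues are at most `R` and the codegrees are at
most `D`. The truncation makes it a bounded summand for the matrix Chernoff bound. -/
noncomputable def truncGram (c : V → V → ℝ) (V₁ V₂ V₃ : Finset V) (D R : ℝ) (l : V) :
    Matrix (V × V) (V × V) ℝ :=
  if CodegLE c V₁ V₂ V₃ D ∧ vertexGram c V₁ V₂ V₃ l ≤ R • 1 then vertexGram c V₁ V₂ V₃ l else 0

section Congruence

variable {c c' : V → V → ℝ} {V₁ V₂ V₃ : Finset V} {l : V}

lemma vertexGram_congr (h₁ : l ∉ V₁) (h₂ : l ∉ V₂) (h₃ : l ∉ V₃)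
    (hc : ∀ u w, u ≠ l → w ≠ l → c u w = c' u w) {l' : V} (hl : l' ≠ l) :
    vertexGram c V₁ V₂ V₃ l' = vertexGram c' V₁ V₂ V₃ l' := by
  refine Finset.sum_congr rfl fun k hk => ?_
  have hkl := ne_of_mem_of_not_mem hk h₃
  have hvec : pairVec c V₁ V₂ k l' = pairVec c' V₁ V₂ k l' := by
    funext x
    unfold pairVec
    split_ifs with hx
    · have hx₁ := ne_of_mem_of_not_mem (Finset.mem_product.1 hx).1 h₁
      have hx₂ := ne_of_mem_of_not_mem (Finset.mem_product.1 hx).2 h₂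
      rw [hc _ _ hx₁ hx₂, hc _ _ hx₁ hkl, hc _ _ hx₂ hkl, hc _ _ hx₁ hl, hc _ _ hx₂ hl]
    · rfl
  rw [hvec, hc _ _ hkl hl]

lemma truncGram_congr (h₁ : l ∉ V₁) (h₂ : l ∉ V₂) (h₃ : l ∉ V₃)
    (hc : ∀ u w, u ≠ l → w ≠ l → c u w = c' u w) {l' : V} (hl : l' ≠ l) (D R : ℝ) :
    truncGram c V₁ V₂ V₃ D R l' = truncGram c' V₁ V₂ V₃ D R l' := by
  unfold truncGram
  rw [vertexGram_congr h₁ h₂ h₃ hc hl, codegLE_congr h₁ h₂ h₃ hc D]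

end Congruence

section Positivity

variable [Finite V]

lemma vertexGram_nonneg (c : V → V → ℝ) (V₁ V₂ V₃ : Finset V) (l : V) :
    0 ≤ vertexGram c V₁ V₂ V₃ l := by
  cases nonempty_fintype V
  exact Finset.sum_nonneg fun k _ => smul_nonneg (abs_nonneg _) <| nonneg_iff_posSemidef.2 <| by
    simpa only [star_trivial] using posSemidef_vecMulVec_self_star (pairVec c V₁ V₂ k l)

lemma truncGram_nonneg (c : V → V → ℝ) (V₁ V₂ V₃ : Finset V) (D R : ℝ) (l : V) :
    0 ≤ truncGram c V₁ V₂ V₃ D R l := by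
  unfold truncGram
  split_ifs
  · exact vertexGram_nonneg ..
  · exact le_rfl

lemma truncGram_le (c : V → V → ℝ) (V₁ V₂ V₃ : Finset V) (D : ℝ) {R : ℝ} (hR : 0 ≤ R) (l : V) :
    truncGram c V₁ V₂ V₃ D R l ≤ R • 1 := by
  unfold truncGram
  split_ifs with h
  · exact h.2
  · cases nonempty_fintype V
    exact smul_nonneg hR zero_le_one

end Positivity

variable [Fintype V]

section MeanGram

variable {p : unitInterval} {V₁ V₂ V₃ : Finset V} {l : V}

-- One of the edges `{i, l}` and `{j, l}` occurs exactly once, and its deviation has mean zero.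
lemma bernoulliExp_pairVec_mul_pairVec_eq_zero (h12 : Disjoint V₁ V₂) (h13 : Disjoint V₁ V₃)
    (h23 : Disjoint V₂ V₃) (h₁ : l ∉ V₁) (h₂ : l ∉ V₂) (h₃ : l ∉ V₃) {k : V} (hk : k ∈ V₃)
    {x y : V × V} (hxy : x ≠ y) {F : Finset (Sym2 V) → ℝ} (hF : ∀ a, Ignores s(a, l) F) :
    bernoulliExp (allEdges V) p (fun ω => |edgeDev p ω k l| *
      (pairVec (edgeDev p ω) V₁ V₂ k l x * pairVec (edgeDev p ω) V₁ V₂ k l y) * F ω) = 0 := by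
  by_cases hx : x ∈ V₁ ×ˢ V₂
  swap
  · simp [pairVec, hx, bernoulliExp_const]
  by_cases hy : y ∈ V₁ ×ˢ V₂
  swap
  · simp [pairVec, hy, bernoulliExp_const]
  simp only [pairVec, hx, hy, if_true]
  obtain ⟨i, j⟩ := x
  obtain ⟨i', j'⟩ := y
  obtain ⟨hi, hj⟩ := Finset.mem_product.1 hx
  obtain ⟨hi', hj'⟩ := Finset.mem_product.1 hy
  dsimp only at hi hj hi' hj' ⊢
  have hil := ne_of_mem_of_not_mem hi h₁
  have hjl := ne_of_mem_of_not_mem hj h₂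
  have hil' := ne_of_mem_of_not_mem hi' h₁
  have hjl' := ne_of_mem_of_not_mem hj' h₂
  have hkl := ne_of_mem_of_not_mem hk h₃
  set W : Finset (Sym2 V) → ℝ := fun ω => √|edgeDev p ω i j| * √|edgeDev p ω i' j'| *
    (edgeDev p ω i k * edgeDev p ω j k * edgeDev p ω i' k * edgeDev p ω j' k) * F ω with hW
  have hWi : ∀ a, Ignores s(a, l) W := fun a ω => by
    simp only [hW, hF a ω, edgeDev_insert_of_ne p ω a, hil, hjl, hil', hjl', hkl, ne_eq,
      not_false_eq_true]
  by_cases hii : i' = i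
  · have hij := h12.forall_ne_finset hi hj
    have hij' := h12.forall_ne_finset hi' hj
    have hjj : j' ≠ j := fun h => hxy (by rw [hii, h])
    have hkj := (h23.forall_ne_finset hj hk).symm
    rw [← bernoulliExp_mul_edgeDev_eq_zero (p := p) (F := fun ω => W ω * (edgeDev p ω i l *
      edgeDev p ω i' l * edgeDev p ω j' l * |edgeDev p ω k l|)) hjl fun ω => by
        simp only [hWi j ω, edgeDev_insert_of_ne_left p ω hij, edgeDev_insert_of_ne_left p ω hij',
          edgeDev_insert_of_ne_left p ω hjj, edgeDev_insert_of_ne_left p ω hkj]]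
    exact bernoulliExp_congr fun ω _ => by ring
  · have hji := (h12.forall_ne_finset hi hj).symm
    have hji' := (h12.forall_ne_finset hi hj').symm
    have hki := (h13.forall_ne_finset hi hk).symm
    rw [← bernoulliExp_mul_edgeDev_eq_zero (p := p) (F := fun ω => W ω * (edgeDev p ω j l *
      edgeDev p ω i' l * edgeDev p ω j' l * |edgeDev p ω k l|)) hil fun ω => by
        simp only [hWi i ω, edgeDev_insert_of_ne_left p ω hji, edgeDev_insert_of_ne_left p ω hji',
          edgeDev_insert_of_ne_left p ω hii, edgeDev_insert_of_ne_left p ω hki]]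
    exact bernoulliExp_congr fun ω _ => by ring

lemma bernoulliExp_pairVec_mul_self_le {i j k : V} (hij : i ≠ j) (hik : i ≠ k) (hjk : j ≠ k)
    (hil : i ≠ l) (hjl : j ≠ l) (hkl : k ≠ l) (hi : i ∈ V₁) (hj : j ∈ V₂)
    {F : Finset (Sym2 V) → ℝ} (hF : ∀ a, Ignores s(a, l) F) (hF0 : ∀ ω, 0 ≤ F ω) :
    bernoulliExp (allEdges V) p (fun ω => |edgeDev p ω k l| *
        (pairVec (edgeDev p ω) V₁ V₂ k l (i, j) * pairVec (edgeDev p ω) V₁ V₂ k l (i, j)) * F ω)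
      ≤ 2 * p ^ 3 * bernoulliExp (allEdges V) p
          (fun ω => edgeDev p ω i k ^ 2 * edgeDev p ω j k ^ 2 * F ω) := by
  have hp := p.2.1
  set W : Finset (Sym2 V) → ℝ := fun ω =>
    edgeDev p ω i k ^ 2 * edgeDev p ω j k ^ 2 * F ω with hW
  have hW0 : ∀ ω, 0 ≤ W ω := fun ω => mul_nonneg (by positivity) (hF0 ω)
  have hWi : ∀ a, Ignores s(a, l) W := fun a ω => by
    simp only [hW, hF a ω, edgeDev_insert_of_ne p ω a hil hkl, edgeDev_insert_of_ne p ω a hjl hkl]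
  have hWj : Ignores s(j, l) fun ω => W ω * edgeDev p ω i l ^ 2 := fun ω => by
    simp only [hWi j ω, edgeDev_insert_of_ne_left p ω hij]
  have hWk : Ignores s(k, l) fun ω => W ω * edgeDev p ω i l ^ 2 * edgeDev p ω j l ^ 2 := fun ω => by
    simp only [hWi k ω, edgeDev_insert_of_ne_left p ω hik, edgeDev_insert_of_ne_left p ω hjk]
  have hWil0 : ∀ ω, 0 ≤ W ω * edgeDev p ω i l ^ 2 := fun ω => mul_nonneg (hW0 ω) (sq_nonneg _)
  have hWijl0 : ∀ ω, 0 ≤ W ω * edgeDev p ω i l ^ 2 * edgeDev p ω j l ^ 2 := fun ω =>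
    mul_nonneg (hWil0 ω) (sq_nonneg _)
  calc _ ≤ bernoulliExp (allEdges V) p (fun ω =>
        W ω * edgeDev p ω i l ^ 2 * edgeDev p ω j l ^ 2 * |edgeDev p ω k l|) := by
        refine bernoulliExp_mono fun ω _ => ?_
        have hsqrt := Real.mul_self_sqrt (abs_nonneg (edgeDev p ω i j))
        simp only [pairVec, Finset.mk_mem_product hi hj, if_true]
        calc _ = √|edgeDev p ω i j| * √|edgeDev p ω i j| * (W ω * edgeDev p ω i l ^ 2
                * edgeDev p ω j l ^ 2 * |edgeDev p ω k l|) := by rw [hW]; ring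
          _ ≤ _ := by
            rw [hsqrt]
            exact mul_le_of_le_one_left (mul_nonneg (hWijl0 ω) (abs_nonneg _))
              (abs_edgeDev_le_one p ω i j)
    _ ≤ 2 * p * bernoulliExp (allEdges V) p (fun ω =>
        W ω * edgeDev p ω i l ^ 2 * edgeDev p ω j l ^ 2) :=
        bernoulliExp_mul_abs_edgeDev_le hkl hWk hWijl0
    _ ≤ 2 * p * (p * bernoulliExp (allEdges V) p (fun ω => W ω * edgeDev p ω i l ^ 2)) := by
        gcongr
        exact bernoulliExp_mul_edgeDev_sq_le hjl hWj hWil0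
    _ ≤ 2 * p * (p * (p * bernoulliExp (allEdges V) p W)) := by
        gcongr
        exact bernoulliExp_mul_edgeDev_sq_le hil (hWi i) hW0
    _ = _ := by ring

lemma trace_vertexGram_mul (c : V → V → ℝ) (V₁ V₂ V₃ : Finset V) (l : V)
    (F : Matrix (V × V) (V × V) ℝ) :
    (vertexGram c V₁ V₂ V₃ l * F).trace = ∑ x, ∑ k ∈ V₃, ∑ y,
      |c k l| * (pairVec c V₁ V₂ k l x * pairVec c V₁ V₂ k l y) * F y x := by
  simp only [vertexGram, trace, diag_apply, mul_apply, Matrix.sum_apply, Matrix.smul_apply,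
    vecMulVec_apply, smul_eq_mul, Finset.sum_mul]

lemma bernoulliExp_trace_vertexGram_mul_le (h12 : Disjoint V₁ V₂) (h13 : Disjoint V₁ V₃)
    (h23 : Disjoint V₂ V₃) (h₁ : l ∉ V₁) (h₂ : l ∉ V₂) (h₃ : l ∉ V₃)
    {F : Finset (Sym2 V) → Matrix (V × V) (V × V) ℝ} (hF : ∀ ω, 0 ≤ F ω)
    (hFi : ∀ a, Ignores s(a, l) F) :
    bernoulliExp (allEdges V) p (fun ω => (vertexGram (edgeDev p ω) V₁ V₂ V₃ l * F ω).trace)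
      ≤ 2 * p ^ 3 * bernoulliExp (allEdges V) p (fun ω => ∑ x ∈ V₁ ×ˢ V₂,
          (∑ k ∈ V₃, edgeDev p ω x.1 k ^ 2 * edgeDev p ω x.2 k ^ 2) * F ω x x) := by
  have hentry : ∀ x y a, Ignores s(a, l) fun ω => F ω x y := fun x y a ω => by simp only [hFi a ω]
  have hoff : ∀ x, ∀ k ∈ V₃, bernoulliExp (allEdges V) p (fun ω => ∑ y, |edgeDev p ω k l| *
      (pairVec (edgeDev p ω) V₁ V₂ k l x * pairVec (edgeDev p ω) V₁ V₂ k l y) * F ω y x)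
      = bernoulliExp (allEdges V) p (fun ω => |edgeDev p ω k l| *
      (pairVec (edgeDev p ω) V₁ V₂ k l x * pairVec (edgeDev p ω) V₁ V₂ k l x) * F ω x x) := by
    intro x k hk
    rw [bernoulliExp_sum]
    exact Finset.sum_eq_single x (fun y _ hyx => bernoulliExp_pairVec_mul_pairVec_eq_zero h12 h13
      h23 h₁ h₂ h₃ hk hyx.symm (hentry y x)) (by simp)
  simp only [trace_vertexGram_mul, Finset.sum_mul, bernoulliExp_sum, Finset.mul_sum]
  rw [← Finset.sum_subset (Finset.subset_univ (V₁ ×ˢ V₂)) fun x _ hx => by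
    simp [pairVec, hx, bernoulliExp_const]]
  refine Finset.sum_le_sum fun x hx => Finset.sum_le_sum fun k hk => ?_
  obtain ⟨hi, hj⟩ := Finset.mem_product.1 hx
  rw [← bernoulliExp_sum, hoff x k hk]
  exact bernoulliExp_pairVec_mul_self_le (h12.forall_ne_finset hi hj) (h13.forall_ne_finset hi hk)
    (h23.forall_ne_finset hj hk) (ne_of_mem_of_not_mem hi h₁) (ne_of_mem_of_not_mem hj h₂)
    (ne_of_mem_of_not_mem hk h₃) hi hj (hentry x x)
    fun ω => (nonneg_iff_posSemidef.1 (hF ω)).diag_nonneg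

open scoped Classical in
lemma bernoulliExp_trace_truncGram_mul_le (h12 : Disjoint V₁ V₂) (h13 : Disjoint V₁ V₃)
    (h23 : Disjoint V₂ V₃) (h₁ : l ∉ V₁) (h₂ : l ∉ V₂) (h₃ : l ∉ V₃) {D : ℝ} (hD : 0 ≤ D) (R : ℝ)
    {F : Finset (Sym2 V) → Matrix (V × V) (V × V) ℝ} (hF : ∀ ω, 0 ≤ F ω)
    (hFi : ∀ a, Ignores s(a, l) F) :
    bernoulliExp (allEdges V) p (fun ω => (truncGram (edgeDev p ω) V₁ V₂ V₃ D R l * F ω).trace)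
      ≤ 2 * p ^ 3 * D * bernoulliExp (allEdges V) p (fun ω => (F ω).trace) := by
  have hp := p.2.1
  set G : Finset (Sym2 V) → Matrix (V × V) (V × V) ℝ := fun ω =>
    if CodegLE (edgeDev p ω) V₁ V₂ V₃ D then F ω else 0 with hG
  have hG0 : ∀ ω, 0 ≤ G ω := fun ω => by
    simp only [hG]
    split_ifs <;> [exact hF ω; exact le_rfl]
  have hGi : ∀ a, Ignores s(a, l) G := fun a ω => by
    simp only [hG, hFi a ω,
      codegLE_congr h₁ h₂ h₃ (fun _ _ hu hw => edgeDev_insert_of_ne p ω a hu hw) D]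
  have hdiag : ∀ ω x, 0 ≤ F ω x x := fun ω x => (nonneg_iff_posSemidef.1 (hF ω)).diag_nonneg
  calc _ ≤ bernoulliExp (allEdges V) p
        (fun ω => (vertexGram (edgeDev p ω) V₁ V₂ V₃ l * G ω).trace) := by
        refine bernoulliExp_mono fun ω _ => ?_
        unfold truncGram
        split_ifs with h
        · simp [hG, h.1]
        · simpa using trace_mul_nonneg (vertexGram_nonneg ..) (hG0 ω)
    _ ≤ _ := bernoulliExp_trace_vertexGram_mul_le h12 h13 h23 h₁ h₂ h₃ hG0 hGi
    _ ≤ 2 * p ^ 3 * bernoulliExp (allEdges V) p (fun ω => D * (F ω).trace) := by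
        gcongr
        refine bernoulliExp_mono fun ω _ => ?_
        have htrace : 0 ≤ (F ω).trace := Finset.sum_nonneg fun x _ => hdiag ω x
        simp only [hG]
        split_ifs with h
        · rw [trace, Finset.mul_sum]
          exact (Finset.sum_le_sum fun x hx => mul_le_mul_of_nonneg_right
            (h _ (Finset.mem_product.1 hx).1 _ (Finset.mem_product.1 hx).2) (hdiag ω x)).trans
            (Finset.sum_le_univ_sum_of_nonneg fun x => mul_nonneg hD (hdiag ω x))
        · simpa using mul_nonneg hD htrace
    _ = _ := by rw [bernoulliExp_const_mul]; ring

lemma bernoulliProb_not_sum_truncGram_le {V₄ : Finset V} (h12 : Disjoint V₁ V₂)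
    (h13 : Disjoint V₁ V₃) (h23 : Disjoint V₂ V₃) (h14 : Disjoint V₁ V₄) (h24 : Disjoint V₂ V₄)
    (h34 : Disjoint V₃ V₄) {D R : ℝ} (hD : 0 ≤ D) (hR : 0 < R)
    (hDR : Fintype.card V * (2 * (p : ℝ) ^ 3 * D) ≤ R) {q : ℕ} (hq : q ≠ 0) :
    bernoulliProb (allEdges V) p (fun ω => ¬ ∑ l ∈ V₄, truncGram (edgeDev p ω) V₁ V₂ V₃ D R l
        ≤ (3 * (q * R)) • 1)
      ≤ Real.exp 3 * Fintype.card V ^ 2 * Real.exp (-q) := by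
  have hp := p.2.1
  have hcard : (V₄.card : ℝ) ≤ Fintype.card V := by exact_mod_cast Finset.card_le_univ V₄
  rw [sq, ← Nat.cast_mul, ← Fintype.card_prod]
  refine bernoulliProb_not_sum_le_smul_one_le (μ := 2 * p ^ 3 * D) hR (by positivity) hq
    (le_trans (by gcongr) hDR) (fun l ω => truncGram_nonneg ..)
    (fun l ω => truncGram_le _ _ _ _ _ hR.le _) fun J _ l hl hlJ => ?_
  have hl₁ := Finset.disjoint_right.1 h14 hl
  have hl₂ := Finset.disjoint_right.1 h24 hl
  have hl₃ := Finset.disjoint_right.1 h34 hl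
  refine bernoulliExp_trace_truncGram_mul_le h12 h13 h23 hl₁ hl₂ hl₃ hD R (fun ω => ?_)
    fun a ω => ?_
  · exact nonneg_iff_posSemidef.2 ((nonneg_iff_posSemidef.1 (add_nonneg
      (smul_nonneg (by positivity) zero_le_one)
      (Finset.sum_nonneg fun a _ => truncGram_nonneg ..))).pow _)
  · rw [Finset.sum_congr rfl fun b hb => truncGram_congr hl₁ hl₂ hl₃
      (fun _ _ hu hw => edgeDev_insert_of_ne p ω a hu hw) (ne_of_mem_of_not_mem hb hlJ) D R]

end MeanGram

end CliqueMatrix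

section CliqueForm

open Matrix
open scoped MatrixOrder

lemma le_smul_one_iff {m : Type*} [Fintype m] [DecidableEq m] {N : Matrix m m ℝ}
    (hN : N.IsHermitian) {B : ℝ} : N ≤ B • 1 ↔ ∀ z, z ⬝ᵥ N *ᵥ z ≤ B * (z ⬝ᵥ z) := by
  have hsub : (B • 1 - N).IsHermitian := (isHermitian_one.smul (IsSelfAdjoint.all _)).sub hN
  rw [Matrix.le_iff, posSemidef_iff_dotProduct_mulVec, and_iff_right hsub]
  simp only [star_trivial, sub_mulVec, dotProduct_sub, smul_mulVec, one_mulVec, dotProduct_smul,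
    smul_eq_mul, sub_nonneg]

lemma neg_le_mul_mul_of_pos {t : ℝ} (ht : 0 < t) (c w b : ℝ) :
    -(t / 2 * (|c| * w ^ 2)) - 1 / (2 * t) * (|c| * b ^ 2) ≤ c * (w * b) := by
  have hamgm : |w * b| ≤ t / 2 * w ^ 2 + 1 / (2 * t) * b ^ 2 := by
    have hsq : 0 ≤ (t * |w| - |b|) ^ 2 / (2 * t) := by positivity
    have hexpand : (t * |w| - |b|) ^ 2 / (2 * t)
        = t / 2 * |w| ^ 2 + 1 / (2 * t) * |b| ^ 2 - |w| * |b| := by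
      field_simp
      ring
    rw [hexpand, sq_abs, sq_abs] at hsq
    rw [abs_mul]
    linarith
  have hmul := mul_le_mul_of_nonneg_left hamgm (abs_nonneg c)
  have hneg := neg_abs_le (c * (w * b))
  rw [abs_mul] at hneg
  linarith

variable {V : Type*} {c : V → V → ℝ} {V₁ V₂ V₃ V₄ : Finset V}

/-- The transpose of the matrix of the clique form, applied to `u`. -/
def cliqueTranspose (c : V → V → ℝ) (V₁ V₂ : Finset V) (u : V → V → ℝ) (k l : V) : ℝ :=
  ∑ i ∈ V₁, ∑ j ∈ V₂, c i j * u i j * (c i k * c j k * (c i l * c j l))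

lemma sum_clique_form_eq (u w : V → V → ℝ) :
    ∑ i ∈ V₁, ∑ j ∈ V₂, ∑ k ∈ V₃, ∑ l ∈ V₄,
        c i j * c k l * (c i k * c i l * (c j k * c j l)) * (u i j * w k l)
      = ∑ k ∈ V₃, ∑ l ∈ V₄, c k l * (w k l * cliqueTranspose c V₁ V₂ u k l) := by
  have hcomm := Finset.sum_comm (s := V₁ ×ˢ V₂) (t := V₃ ×ˢ V₄) (f := fun x y =>
    c x.1 x.2 * c y.1 y.2 * (c x.1 y.1 * c x.1 y.2 * (c x.2 y.1 * c x.2 y.2))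
      * (u x.1 x.2 * w y.1 y.2))
  simp only [Finset.sum_product] at hcomm
  simp only [hcomm, cliqueTranspose, Finset.mul_sum]
  exact Finset.sum_congr rfl fun _ _ => Finset.sum_congr rfl fun _ _ =>
    Finset.sum_congr rfl fun _ _ => Finset.sum_congr rfl fun _ _ => by ring

variable [DecidableEq V]

section QuadraticForm

variable [Fintype V]

lemma sum_pairVec_mul (c : V → V → ℝ) (V₁ V₂ : Finset V) (k l : V) (z : V × V → ℝ) :
    ∑ x, pairVec c V₁ V₂ k l x * z x
      = ∑ x ∈ V₁ ×ˢ V₂, √|c x.1 x.2| * (c x.1 k * c x.2 k * (c x.1 l * c x.2 l)) * z x := by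
  simp only [pairVec, ite_mul, zero_mul, Finset.sum_ite_mem, Finset.univ_inter]

lemma dotProduct_vertexGram (c : V → V → ℝ) (V₁ V₂ V₃ : Finset V) (l : V) (z : V × V → ℝ) :
    z ⬝ᵥ vertexGram c V₁ V₂ V₃ l *ᵥ z
      = ∑ k ∈ V₃, |c k l| * (∑ x, pairVec c V₁ V₂ k l x * z x) ^ 2 := by
  rw [vertexGram, sum_mulVec, dotProduct_sum]
  refine Finset.sum_congr rfl fun k _ => ?_
  rw [smul_mulVec, dotProduct_smul, vecMulVec_mulVec, dotProduct_smul, smul_eq_mul,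
    MulOpposite.smul_eq_mul_unop, MulOpposite.unop_op, dotProduct_comm z, ← sq]
  rfl

lemma sq_sum_pairVec_mul_le (c : V → V → ℝ) (V₁ V₂ : Finset V) (k l : V) (z : V × V → ℝ) :
    (∑ x, pairVec c V₁ V₂ k l x * z x) ^ 2
      ≤ (∑ x ∈ V₁ ×ˢ V₂, |c x.1 x.2| * (|c x.1 k| * |c x.2 k| * (|c x.1 l| * |c x.2 l|)))
        * ∑ x ∈ V₁ ×ˢ V₂, |c x.1 k| * |c x.2 k| * (|c x.1 l| * |c x.2 l|) * z x ^ 2 := by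
  rw [sum_pairVec_mul]
  refine Finset.sum_sq_le_sum_mul_sum_of_sq_le_mul _ (fun x _ => by positivity)
    (fun x _ => by positivity) fun x _ => le_of_eq ?_
  have hsq : ∀ t : ℝ, t ^ 2 = |t| * |t| := fun t => (abs_mul_abs_self t).symm ▸ sq t
  rw [mul_pow, mul_pow, Real.sq_sqrt (abs_nonneg _), hsq (_ * _)]
  simp only [abs_mul]
  ring

end QuadraticForm

variable [Finite V]

-- Schur test.
lemma vertexGram_le_smul_one {l : V} (hc : ∀ i, |c i l| ≤ 1) {R₁ R₂ : ℝ} (hR₁ : 0 ≤ R₁)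
    (hR₂ : 0 ≤ R₂)
    (h₁ : ∀ k ∈ V₃, ∑ i ∈ V₁, ∑ j ∈ V₂, |c i j| * (|c i k| * |c j k| * (|c i l| * |c j l|)) ≤ R₁)
    (h₂ : ∀ i ∈ V₁, ∀ j ∈ V₂, ∑ k ∈ V₃, |c k l| * (|c i k| * |c j k|) ≤ R₂) :
    vertexGram c V₁ V₂ V₃ l ≤ (R₁ * R₂) • 1 := by
  cases nonempty_fintype V
  rw [le_smul_one_iff (nonneg_iff_posSemidef.1 (vertexGram_nonneg ..)).1]
  intro z
  set h : V → V × V → ℝ := fun k x => |c x.1 k| * |c x.2 k| * (|c x.1 l| * |c x.2 l|)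
  have hcol : ∀ x ∈ V₁ ×ˢ V₂, ∑ k ∈ V₃, |c k l| * h k x ≤ R₂ := fun x hx => by
    refine le_trans (Finset.sum_le_sum fun k _ => ?_)
      (h₂ _ (Finset.mem_product.1 hx).1 _ (Finset.mem_product.1 hx).2)
    exact mul_le_mul_of_nonneg_left (mul_le_of_le_one_right (by positivity)
      (mul_le_one₀ (hc x.1) (abs_nonneg _) (hc x.2))) (abs_nonneg _)
  calc z ⬝ᵥ vertexGram c V₁ V₂ V₃ l *ᵥ z
      ≤ ∑ k ∈ V₃, |c k l| * (R₁ * ∑ x ∈ V₁ ×ˢ V₂, h k x * z x ^ 2) := by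
        rw [dotProduct_vertexGram]
        refine Finset.sum_le_sum fun k hk => ?_
        gcongr
        refine (sq_sum_pairVec_mul_le c V₁ V₂ k l z).trans ?_
        gcongr
        rw [Finset.sum_product]
        exact h₁ k hk
    _ = R₁ * ∑ x ∈ V₁ ×ˢ V₂, (∑ k ∈ V₃, |c k l| * h k x) * z x ^ 2 := by
        simp only [Finset.mul_sum, Finset.sum_mul]
        rw [Finset.sum_comm]
        exact Finset.sum_congr rfl fun x _ => Finset.sum_congr rfl fun k _ => by ring
    _ ≤ R₁ * ∑ x ∈ V₁ ×ˢ V₂, R₂ * z x ^ 2 := by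
        gcongr with x hx
        exact hcol x hx
    _ = R₁ * R₂ * ∑ x ∈ V₁ ×ˢ V₂, z x ^ 2 := by rw [← Finset.mul_sum, mul_assoc]
    _ ≤ R₁ * R₂ * (z ⬝ᵥ z) := by
        gcongr
        simp only [dotProduct, ← sq]
        exact Finset.sum_le_univ_sum_of_nonneg fun x => sq_nonneg _

-- The Gram matrix is evaluated at `(i, j) ↦ c i j / √|c i j| * u i j`, so that the weight `c i j`
-- splits evenly between `pairVec` and the test vector.
lemma sum_abs_mul_cliqueTranspose_sq_le {B : ℝ} (hB : ∑ l ∈ V₄, vertexGram c V₁ V₂ V₃ l ≤ B • 1)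
    (u : V → V → ℝ) :
    ∑ k ∈ V₃, ∑ l ∈ V₄, |c k l| * cliqueTranspose c V₁ V₂ u k l ^ 2
      ≤ B * ∑ i ∈ V₁, ∑ j ∈ V₂, |c i j| * u i j ^ 2 := by
  cases nonempty_fintype V
  have hsqrt : ∀ x : ℝ, √|x| * (x / √|x|) = x := fun x => by
    rcases eq_or_ne x 0 with rfl | hx
    · simp
    · exact mul_div_cancel₀ x (Real.sqrt_pos.2 (abs_pos.2 hx)).ne'
  have hdiv_sq : ∀ x : ℝ, (x / √|x|) ^ 2 = |x| := fun x => by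
    rw [div_pow, Real.sq_sqrt (abs_nonneg x), ← sq_abs, sq, mul_self_div_self]
  set z : V × V → ℝ := fun x =>
    if x ∈ V₁ ×ˢ V₂ then c x.1 x.2 / √|c x.1 x.2| * u x.1 x.2 else 0 with hz
  have htest : ∀ k l, ∑ x, pairVec c V₁ V₂ k l x * z x = cliqueTranspose c V₁ V₂ u k l := by
    intro k l
    rw [sum_pairVec_mul, cliqueTranspose, ← Finset.sum_product' (f := fun i j =>
      c i j * u i j * (c i k * c j k * (c i l * c j l)))]
    refine Finset.sum_congr rfl fun x hx => ?_
    simp only [hz, hx, if_true]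
    linear_combination (u x.1 x.2 * (c x.1 k * c x.2 k * (c x.1 l * c x.2 l))) * hsqrt (c x.1 x.2)
  have hnorm : z ⬝ᵥ z = ∑ i ∈ V₁, ∑ j ∈ V₂, |c i j| * u i j ^ 2 := by
    rw [← Finset.sum_product' (f := fun i j => |c i j| * u i j ^ 2)]
    simp only [dotProduct, hz, ← sq, ite_pow, mul_pow, hdiv_sq, ne_eq, OfNat.ofNat_ne_zero,
      not_false_eq_true, zero_pow, Finset.sum_ite_mem, Finset.univ_inter]
  have hherm : (∑ l ∈ V₄, vertexGram c V₁ V₂ V₃ l).IsHermitian :=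
    (nonneg_iff_posSemidef.1 (Finset.sum_nonneg fun l _ => vertexGram_nonneg c V₁ V₂ V₃ l)).1
  have h := (le_smul_one_iff hherm).1 hB z
  rw [sum_mulVec, dotProduct_sum, hnorm] at h
  simp only [dotProduct_vertexGram, htest] at h
  rwa [Finset.sum_comm]

lemma neg_le_sum_clique_form {t : ℝ} (ht : 0 < t)
    (hB : ∑ l ∈ V₄, vertexGram c V₁ V₂ V₃ l ≤ (t ^ 2) • 1) (u w : V → V → ℝ) :
    -(t / 2 * (∑ i ∈ V₁, ∑ j ∈ V₂, |c i j| * u i j ^ 2 + ∑ k ∈ V₃, ∑ l ∈ V₄, |c k l| * w k l ^ 2))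
      ≤ ∑ i ∈ V₁, ∑ j ∈ V₂, ∑ k ∈ V₃, ∑ l ∈ V₄,
        c i j * c k l * (c i k * c i l * (c j k * c j l)) * (u i j * w k l) := by
  set S := ∑ i ∈ V₁, ∑ j ∈ V₂, |c i j| * u i j ^ 2
  set T := ∑ k ∈ V₃, ∑ l ∈ V₄, |c k l| * w k l ^ 2
  have hquad := sum_abs_mul_cliqueTranspose_sq_le hB u
  calc -(t / 2 * (S + T)) = -(t / 2 * T) - 1 / (2 * t) * (t ^ 2 * S) := by field_simp; ring
    _ ≤ -(t / 2 * T) - 1 / (2 * t) * ∑ k ∈ V₃, ∑ l ∈ V₄,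
          |c k l| * cliqueTranspose c V₁ V₂ u k l ^ 2 := by gcongr
    _ = ∑ k ∈ V₃, ∑ l ∈ V₄, (-(t / 2 * (|c k l| * w k l ^ 2))
          - 1 / (2 * t) * (|c k l| * cliqueTranspose c V₁ V₂ u k l ^ 2)) := by
        simp only [T, Finset.sum_sub_distrib, Finset.sum_neg_distrib, ← Finset.mul_sum]
    _ ≤ _ := by
        rw [sum_clique_form_eq]
        exact Finset.sum_le_sum fun k _ => Finset.sum_le_sum fun l _ =>
          neg_le_mul_mul_of_pos ht (c k l) (w k l) _

end CliqueForm

section Typical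

variable {V : Type*}

lemma sum_pow_card_le_exp [Fintype V] {y : ℝ} (hy : 0 ≤ y) :
    ∑ S : Finset V, y ^ S.card ≤ Real.exp (Fintype.card V * y) := by
  have h := Finset.sum_pow_mul_eq_add_pow y 1 (Finset.univ : Finset V)
  simp only [one_pow, mul_one, Finset.card_univ, Finset.powerset_univ] at h
  rw [h, Real.exp_nat_mul]
  exact pow_le_pow_left₀ (by positivity) (Real.add_one_le_exp y) _

lemma sum_exp_neg_card_add_card_le [Fintype V] {ℓ : ℝ}
    (hℓ : (Fintype.card V : ℝ) * Real.exp (-(6 * ℓ)) ≤ 1) :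
    ∑ x : Finset V × Finset V, Real.exp (-(6 * (ℓ * (x.1.card + x.2.card + 1))))
      ≤ 9 * Real.exp (-(6 * ℓ)) := by
  set y := Real.exp (-(6 * ℓ)) with hy
  have hy0 : 0 ≤ y := (Real.exp_pos _).le
  have hterm : ∀ x : Finset V × Finset V,
      Real.exp (-(6 * (ℓ * (x.1.card + x.2.card + 1)))) = y * (y ^ x.1.card * y ^ x.2.card) := by
    intro x
    rw [hy, ← Real.exp_nat_mul, ← Real.exp_nat_mul, ← Real.exp_add, ← Real.exp_add]
    ring_nf
  have hsum : ∑ S : Finset V, y ^ S.card ≤ 3 := by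
    have := Real.exp_le_exp.2 hℓ
    linarith [sum_pow_card_le_exp (V := V) hy0, Real.exp_one_lt_d9]
  have hsum0 : 0 ≤ ∑ S : Finset V, y ^ S.card := Finset.sum_nonneg fun S _ => by positivity
  simp only [hterm]
  rw [← Finset.mul_sum, Fintype.sum_prod_type]
  simp only [← Finset.mul_sum, ← Finset.sum_mul]
  calc y * ((∑ S : Finset V, y ^ S.card) * ∑ S : Finset V, y ^ S.card)
      ≤ y * (3 * 3) := by gcongr
    _ = 9 * y := by ring

variable [DecidableEq V]

/-- The indicator of the edge `{i, j}`. -/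
def edgeInd (ω : Finset (Sym2 V)) (i j : V) : ℝ :=
  if s(i, j) ∈ ω then 1 else 0

lemma edgeInd_nonneg (ω : Finset (Sym2 V)) (i j : V) : 0 ≤ edgeInd ω i j := by
  unfold edgeInd
  split_ifs <;> norm_num

lemma edgeInd_le_one (ω : Finset (Sym2 V)) (i j : V) : edgeInd ω i j ≤ 1 := by
  unfold edgeInd
  split_ifs <;> norm_num

lemma edgeInd_comm (ω : Finset (Sym2 V)) (i j : V) : edgeInd ω i j = edgeInd ω j i := by
  rw [edgeInd, edgeInd, Sym2.eq_swap]

lemma edgeInd_mul_self (ω : Finset (Sym2 V)) (i j : V) :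
    edgeInd ω i j * edgeInd ω i j = edgeInd ω i j := by
  unfold edgeInd
  split_ifs <;> norm_num

lemma sum_edgeInd_le_two_mul_card (ω : Finset (Sym2 V)) (S T : Finset V) :
    ∑ i ∈ S, ∑ j ∈ T, edgeInd ω i j
      ≤ 2 * (((S ×ˢ T).image fun x => s(x.1, x.2)).filter (· ∈ ω)).card := by
  rw [← Finset.sum_product']
  simp only [edgeInd]
  rw [Finset.sum_boole, Finset.filter_image]
  have hfiber : ∀ e : Sym2 V, (((S ×ˢ T).filter fun x => s(x.1, x.2) ∈ ω).filter
      fun x => s(x.1, x.2) = e).card ≤ 2 := by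
    intro e
    induction e with
    | _ a b =>
      refine (Finset.card_le_card (t := {(a, b), (b, a)}) fun x hx => ?_).trans Finset.card_le_two
      simpa only [Finset.mem_insert, Finset.mem_singleton, Prod.ext_iff] using
        Sym2.eq_iff.1 (Finset.mem_filter.1 hx).2
  exact_mod_cast Finset.card_le_mul_card_image _ 2 fun e _ => hfiber e

lemma abs_edgeDev_le (p : unitInterval) (ω : Finset (Sym2 V)) (i j : V) :
    |edgeDev p ω i j| ≤ edgeInd ω i j + p := by
  have hp := p.2.1
  unfold edgeDev edgeInd
  rw [abs_le]
  split_ifs <;> constructor <;> linarith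

variable [Fintype V]

lemma edgeInd_self {ω : Finset (Sym2 V)} (hω : ω ⊆ allEdges V) (i : V) : edgeInd ω i i = 0 :=
  if_neg fun h => mem_allEdges.1 (hω h) rfl

/-- Common neighbourhoods of at most three vertices and edge counts between two vertex sets are not
much larger than expected at edge probability `p`; the slack `ℓ` is logarithmic. -/
structure Typical (ω : Finset (Sym2 V)) (p ℓ : ℝ) : Prop where
  nbr : ∀ i j l, ∑ k, edgeInd ω i k * edgeInd ω j k * edgeInd ω l k
    ≤ 2 * (Fintype.card V * p ^ ({i, j, l} : Finset V).card) + 10 * ℓ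
  edges : ∀ S T : Finset V, ∑ i ∈ S, ∑ j ∈ T, edgeInd ω i j
    ≤ 2 * (2 * (S.card * T.card * p) + 10 * (ℓ * (S.card + T.card + 1)))

variable {p : unitInterval} {ℓ : ℝ}

lemma bernoulliProb_card_common_nbr_lt (hℓ : 0 ≤ ℓ) (T : Finset V) :
    bernoulliProb (allEdges V) p (fun ω => 2 * (Fintype.card V * (p : ℝ) ^ T.card) + 10 * ℓ
      < (Tᶜ.filter fun k => T.image (fun a => s(a, k)) ⊆ ω).card) ≤ Real.exp (-(6 * ℓ)) := by
  have hstar : ∀ k ∈ Tᶜ, T.image (fun a => s(a, k)) ⊆ allEdges V := fun k hk =>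
    Finset.image_subset_iff.2 fun a ha =>
      mem_allEdges.2 (ne_of_mem_of_not_mem ha (Finset.mem_compl.1 hk))
  have hcard : ∀ k ∈ Tᶜ, (T.image fun a => s(a, k)).card = T.card := fun k _ =>
    Finset.card_image_of_injective _ fun a b hab => Sym2.congr_left.1 hab
  have hdisj : ((Tᶜ : Finset V) : Set V).PairwiseDisjoint fun k => T.image fun a => s(a, k) := by
    intro k hk k' _ hkk
    refine Finset.disjoint_left.2 fun e he he' => ?_
    obtain ⟨a, -, rfl⟩ := Finset.mem_image.1 he
    obtain ⟨b, hb, hab⟩ := Finset.mem_image.1 he'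
    rcases Sym2.eq_iff.1 hab with ⟨_, h⟩ | ⟨h, _⟩
    · exact hkk h.symm
    · exact Finset.mem_compl.1 (Finset.mem_coe.1 hk) (h ▸ hb)
  refine (bernoulliProb_mono fun ω _ hlt => ?_).trans (bernoulliProb_card_lt hstar hcard hdisj hℓ)
  have hp := p.2.1
  have hmean : 2 * (Tᶜ.card * (p : ℝ) ^ T.card) ≤ 2 * (Fintype.card V * (p : ℝ) ^ T.card) := by
    gcongr
    exact Finset.card_le_univ _
  convert (add_le_add_left hmean (10 * ℓ)).trans_lt hlt

lemma sum_edgeInd_mul_le_card {ω : Finset (Sym2 V)} (hω : ω ⊆ allEdges V) (i j l : V) :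
    ∑ k, edgeInd ω i k * edgeInd ω j k * edgeInd ω l k
      ≤ ((({i, j, l} : Finset V)ᶜ).filter fun k =>
          ({i, j, l} : Finset V).image (fun a => s(a, k)) ⊆ ω).card := by
  have hzero : ∀ k, k ∉ ({i, j, l} : Finset V)ᶜ →
      edgeInd ω i k * edgeInd ω j k * edgeInd ω l k = 0 := by
    intro k hk
    have hk : k = i ∨ k = j ∨ k = l := by simpa using Finset.notMem_compl.1 hk
    rcases hk with rfl | rfl | rfl <;> simp [edgeInd_self hω]
  rw [← Finset.sum_boole, ← Finset.sum_subset (Finset.subset_univ _) fun k _ hk => hzero k hk]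
  refine Finset.sum_le_sum fun k _ => le_of_eq ?_
  simp only [edgeInd, Finset.image_insert, Finset.image_singleton, Finset.insert_subset_iff,
    Finset.singleton_subset_iff, ite_and]
  split_ifs <;> norm_num

lemma bernoulliProb_nbr_le (hℓ : 0 ≤ ℓ) (i j l : V) :
    bernoulliProb (allEdges V) p (fun ω =>
      2 * (Fintype.card V * (p : ℝ) ^ ({i, j, l} : Finset V).card) + 10 * ℓ
        < ∑ k, edgeInd ω i k * edgeInd ω j k * edgeInd ω l k) ≤ Real.exp (-(6 * ℓ)) :=
  (bernoulliProb_mono fun _ hω hlt => hlt.trans_le (sum_edgeInd_mul_le_card hω i j l)).trans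
    (bernoulliProb_card_common_nbr_lt hℓ _)

lemma bernoulliProb_edges_le (hℓ : 0 ≤ ℓ) (S T : Finset V) :
    bernoulliProb (allEdges V) p (fun ω =>
      2 * (2 * (S.card * T.card * (p : ℝ)) + 10 * (ℓ * (S.card + T.card + 1)))
        < ∑ i ∈ S, ∑ j ∈ T, edgeInd ω i j)
      ≤ Real.exp (-(6 * (ℓ * (S.card + T.card + 1)))) := by
  set K : Finset (Sym2 V) := (S ×ˢ T).image (fun x => s(x.1, x.2)) ∩ allEdges V with hK
  have hcard : K.card ≤ S.card * T.card := by
    rw [← Finset.card_product]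
    exact (Finset.card_le_card Finset.inter_subset_left).trans Finset.card_image_le
  have htail := bernoulliProb_card_lt (E := allEdges V) (p := p) (K := K) (F := fun e => {e})
    (fun e he => Finset.singleton_subset_iff.2 (Finset.mem_inter.1 he).2)
    (fun e _ => Finset.card_singleton e)
    (fun e _ e' _ hne => by simpa [Function.onFun] using hne)
    (t := ℓ * (S.card + T.card + 1)) (by positivity)
  refine le_trans (bernoulliProb_mono fun ω hω hlt => ?_) htail
  have hpairs : ((S ×ˢ T).image fun x => s(x.1, x.2)).filter (· ∈ ω)
      = K.filter fun e => {e} ⊆ ω := by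
    ext e
    simp only [hK, Finset.mem_filter, Finset.mem_inter, Finset.singleton_subset_iff]
    exact ⟨fun h => ⟨⟨h.1, hω h.2⟩, h.2⟩, fun h => ⟨h.1.1, h.2⟩⟩
  have hcount := sum_edgeInd_le_two_mul_card ω S T
  rw [hpairs] at hcount
  have hmean : K.card * (p : ℝ) ≤ S.card * T.card * p :=
    mul_le_mul_of_nonneg_right (by exact_mod_cast hcard) p.2.1
  rw [pow_one]
  linarith

lemma bernoulliProb_not_typical_le (hV : 2 ≤ Fintype.card V) :
    bernoulliProb (allEdges V) p (fun ω => ¬ Typical ω p (Real.log (Fintype.card V)))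
      ≤ 10 / (Fintype.card V : ℝ) ^ 3 := by
  have hn : (2 : ℝ) ≤ Fintype.card V := by exact_mod_cast hV
  set n := (Fintype.card V : ℝ)
  set ℓ := Real.log n
  have hℓ : 0 ≤ ℓ := Real.log_natCast_nonneg _
  have hexp : Real.exp (-(6 * ℓ)) = (n ^ 6)⁻¹ := by
    rw [Real.exp_neg, ← Real.exp_log (by positivity : 0 < n ^ 6), Real.log_pow, Nat.cast_ofNat]
  have hnbr : bernoulliProb (allEdges V) p (fun ω => ∃ x ∈ (Finset.univ : Finset (V × V × V)),
      2 * (n * (p : ℝ) ^ ({x.1, x.2.1, x.2.2} : Finset V).card) + 10 * ℓ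
      < ∑ k, edgeInd ω x.1 k * edgeInd ω x.2.1 k * edgeInd ω x.2.2 k) ≤ 1 / n ^ 3 := by
    refine (bernoulliProb_exists_le _ _).trans
      ((Finset.sum_le_sum fun x _ => bernoulliProb_nbr_le hℓ x.1 x.2.1 x.2.2).trans_eq ?_)
    rw [Finset.sum_const, hexp, Finset.card_univ, Fintype.card_prod, Fintype.card_prod,
      nsmul_eq_mul, Nat.cast_mul, Nat.cast_mul]
    field_simp
    rfl
  have hedges : bernoulliProb (allEdges V) p (fun ω =>
      ∃ x ∈ (Finset.univ : Finset (Finset V × Finset V)),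
      2 * (2 * (x.1.card * x.2.card * (p : ℝ)) + 10 * (ℓ * (x.1.card + x.2.card + 1)))
        < ∑ i ∈ x.1, ∑ j ∈ x.2, edgeInd ω i j) ≤ 9 / n ^ 3 := by
    refine (bernoulliProb_exists_le _ _).trans
      ((Finset.sum_le_sum fun x _ => bernoulliProb_edges_le hℓ x.1 x.2).trans
      ((sum_exp_neg_card_add_card_le ?_).trans ?_))
    · rw [hexp, ← div_eq_mul_inv, div_le_one (by positivity)]
      exact le_self_pow₀ (by linarith) (by norm_num)
    · rw [hexp, ← div_eq_mul_inv]
      gcongr <;> [linarith; norm_num]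
  refine (bernoulliProb_mono fun ω _ h => ?_).trans
    ((bernoulliProb_or_le _ _).trans ((add_le_add hnbr hedges).trans_eq (by ring)))
  by_contra! hcon
  exact h ⟨fun i j l => hcon.1 (i, j, l) (Finset.mem_univ _),
    fun S T => hcon.2 (S, T) (Finset.mem_univ _)⟩

end Typical

section TypicalConsequences

variable {V : Type*} [Fintype V]

lemma card_mul_pow_three {p a : ℝ} (hn : (Fintype.card V : ℝ) = a ^ 3) (hp : p * a = 1) :
    Fintype.card V * p ^ 3 = 1 := by
  rw [hn, ← mul_pow, mul_comm, hp, one_pow]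

lemma card_mul_sq {p a : ℝ} (hn : (Fintype.card V : ℝ) = a ^ 3) (hp : p * a = 1) :
    Fintype.card V * p ^ 2 = a := by
  rw [hn]
  linear_combination a * (p * a + 1) * hp

variable [DecidableEq V] {ω : Finset (Sym2 V)}

section Degrees

variable {p a ℓ : ℝ}

lemma Typical.deg_le (h : Typical ω p ℓ) (hn : (Fintype.card V : ℝ) = a ^ 3) (hp : p * a = 1)
    (ha : 1 ≤ a) (hℓ : 1 ≤ ℓ) (i : V) : ∑ k, edgeInd ω i k ≤ 12 * ℓ * a ^ 2 := by
  have hnbr := h.nbr i i i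
  simp only [edgeInd_mul_self, Finset.pair_eq_singleton, Finset.card_singleton, pow_one] at hnbr
  have hmean : (Fintype.card V : ℝ) * p = a ^ 2 := by
    rw [hn]
    linear_combination a ^ 2 * hp
  rw [hmean] at hnbr
  nlinarith [one_le_pow₀ ha (n := 2)]

lemma Typical.codeg_le (h : Typical ω p ℓ) (hn : (Fintype.card V : ℝ) = a ^ 3) (hp : p * a = 1)
    (ha : 1 ≤ a) (hℓ : 1 ≤ ℓ) {i j : V} (hij : i ≠ j) :
    ∑ k, edgeInd ω i k * edgeInd ω j k ≤ 12 * ℓ * a := by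
  have hnbr := h.nbr i j j
  simp only [mul_assoc, edgeInd_mul_self, Finset.pair_eq_singleton, Finset.card_pair hij,
    card_mul_sq hn hp] at hnbr
  nlinarith

lemma Typical.codeg_three_le (h : Typical ω p ℓ) (hn : (Fintype.card V : ℝ) = a ^ 3)
    (hp : p * a = 1) (hℓ : 1 ≤ ℓ) {i j l : V} (hij : i ≠ j) (hil : i ≠ l) (hjl : j ≠ l) :
    ∑ k, edgeInd ω i k * edgeInd ω j k * edgeInd ω l k ≤ 12 * ℓ := by
  have hnbr := h.nbr i j l
  rw [Finset.card_eq_three.2 ⟨i, j, l, hij, hil, hjl, rfl⟩, card_mul_pow_three hn hp] at hnbr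
  linarith

end Degrees

variable {p : unitInterval} {a ℓ : ℝ}

lemma Typical.sum_abs_mul_abs_le (h : Typical ω p ℓ) (hn : (Fintype.card V : ℝ) = a ^ 3)
    (hp : p * a = 1) (ha : 1 ≤ a) (hℓ : 1 ≤ ℓ) {i j : V} (hij : i ≠ j) (S : Finset V) :
    ∑ k ∈ S, |edgeDev p ω i k| * |edgeDev p ω j k| ≤ 37 * ℓ * a := by
  have hp0 := p.2.1
  have hdev : ∑ k ∈ S, |edgeDev p ω i k| * |edgeDev p ω j k|
      ≤ ∑ k, (edgeInd ω i k + p) * (edgeInd ω j k + p) := by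
    refine (Finset.sum_le_univ_sum_of_nonneg fun k => by positivity).trans
      (Finset.sum_le_sum fun k _ => ?_)
    exact mul_le_mul (abs_edgeDev_le p ω i k) (abs_edgeDev_le p ω j k) (abs_nonneg _)
      (add_nonneg (edgeInd_nonneg ω i k) hp0)
  have hexpand : ∑ k, (edgeInd ω i k + p) * (edgeInd ω j k + p)
      = ∑ k, edgeInd ω i k * edgeInd ω j k + p * ∑ k, edgeInd ω i k + p * ∑ k, edgeInd ω j k
        + Fintype.card V * (p : ℝ) ^ 2 := by
    rw [← nsmul_eq_mul, ← Finset.card_univ, ← Finset.sum_const]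
    simp only [Finset.mul_sum, ← Finset.sum_add_distrib]
    exact Finset.sum_congr rfl fun k _ => by ring
  rw [card_mul_sq hn hp] at hexpand
  have hcodeg := h.codeg_le hn hp ha hℓ hij
  have hdeg : ∀ v, (p : ℝ) * ∑ k, edgeInd ω v k ≤ 12 * ℓ * a := fun v => by
    have hpa : p * (12 * ℓ * a ^ 2) = 12 * ℓ * a := by linear_combination 12 * ℓ * a * hp
    exact hpa ▸ mul_le_mul_of_nonneg_left (h.deg_le hn hp ha hℓ v) hp0
  nlinarith [hdeg i, hdeg j]

lemma Typical.sum_abs_mul_abs_mul_abs_le (h : Typical ω p ℓ) (hn : (Fintype.card V : ℝ) = a ^ 3)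
    (hp : p * a = 1) (ha : 1 ≤ a) (hℓ : 1 ≤ ℓ) {i j l : V} (hij : i ≠ j) (hil : i ≠ l)
    (hjl : j ≠ l) (S : Finset V) :
    ∑ k ∈ S, |edgeDev p ω i k| * |edgeDev p ω j k| * |edgeDev p ω l k| ≤ 85 * ℓ := by
  have hp0 := p.2.1
  have hdev : ∑ k ∈ S, |edgeDev p ω i k| * |edgeDev p ω j k| * |edgeDev p ω l k|
      ≤ ∑ k, (edgeInd ω i k + p) * (edgeInd ω j k + p) * (edgeInd ω l k + p) := by
    refine (Finset.sum_le_univ_sum_of_nonneg fun k => by positivity).trans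
      (Finset.sum_le_sum fun k _ => ?_)
    have hi := add_nonneg (edgeInd_nonneg ω i k) hp0
    have hj := add_nonneg (edgeInd_nonneg ω j k) hp0
    exact mul_le_mul (mul_le_mul (abs_edgeDev_le p ω i k) (abs_edgeDev_le p ω j k) (abs_nonneg _)
      hi) (abs_edgeDev_le p ω l k) (abs_nonneg _) (mul_nonneg hi hj)
  have hexpand : ∑ k, (edgeInd ω i k + p) * (edgeInd ω j k + p) * (edgeInd ω l k + p)
      = ∑ k, edgeInd ω i k * edgeInd ω j k * edgeInd ω l k
        + p * ∑ k, edgeInd ω i k * edgeInd ω j k + p * ∑ k, edgeInd ω i k * edgeInd ω l k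
        + p * ∑ k, edgeInd ω j k * edgeInd ω l k
        + p ^ 2 * ∑ k, edgeInd ω i k + p ^ 2 * ∑ k, edgeInd ω j k + p ^ 2 * ∑ k, edgeInd ω l k
        + Fintype.card V * (p : ℝ) ^ 3 := by
    rw [← nsmul_eq_mul, ← Finset.card_univ, ← Finset.sum_const]
    simp only [Finset.mul_sum, ← Finset.sum_add_distrib]
    exact Finset.sum_congr rfl fun k _ => by ring
  rw [card_mul_pow_three hn hp] at hexpand
  have hthree := h.codeg_three_le hn hp hℓ hij hil hjl
  have hcodeg : ∀ v w, v ≠ w → (p : ℝ) * ∑ k, edgeInd ω v k * edgeInd ω w k ≤ 12 * ℓ :=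
    fun v w hvw => by
      have hpa : p * (12 * ℓ * a) = 12 * ℓ := by linear_combination 12 * ℓ * hp
      exact hpa ▸ mul_le_mul_of_nonneg_left (h.codeg_le hn hp ha hℓ hvw) hp0
  have hdeg : ∀ v, (p : ℝ) ^ 2 * ∑ k, edgeInd ω v k ≤ 12 * ℓ := fun v => by
    have hpa : p ^ 2 * (12 * ℓ * a ^ 2) = 12 * ℓ := by
      linear_combination 12 * ℓ * (p * a + 1) * hp
    exact hpa ▸ mul_le_mul_of_nonneg_left (h.deg_le hn hp ha hℓ v) (sq_nonneg (p : ℝ))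
  linarith [hcodeg i j hij, hcodeg i l hil, hcodeg j l hjl, hdeg i, hdeg j, hdeg l]

lemma Typical.codegLE (h : Typical ω p ℓ) (hn : (Fintype.card V : ℝ) = a ^ 3) (hp : p * a = 1)
    (ha : 1 ≤ a) (hℓ : 1 ≤ ℓ) {V₁ V₂ : Finset V} (h12 : Disjoint V₁ V₂) (V₃ : Finset V) :
    CodegLE (edgeDev p ω) V₁ V₂ V₃ (37 * ℓ * a) := by
  intro i hi j hj
  refine le_trans (Finset.sum_le_sum fun k _ => ?_)
    (h.sum_abs_mul_abs_le hn hp ha hℓ (h12.forall_ne_finset hi hj) V₃)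
  have hsq : ∀ x y, edgeDev p ω x y ^ 2 ≤ |edgeDev p ω x y| := fun x y => by
    rw [← sq_abs]
    exact pow_le_of_le_one (abs_nonneg _) (abs_edgeDev_le_one p ω x y) two_ne_zero
  exact mul_le_mul (hsq i k) (hsq j k) (sq_nonneg _) (abs_nonneg _)

open scoped MatrixOrder in
lemma Typical.vertexGram_le (h : Typical ω p ℓ) (hn : (Fintype.card V : ℝ) = a ^ 3)
    (hp : p * a = 1) (ha : 1 ≤ a) (hℓ : 1 ≤ ℓ) {V₁ V₂ V₃ : Finset V} (h12 : Disjoint V₁ V₂)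
    (h13 : Disjoint V₁ V₃) {l : V} (h₁ : l ∉ V₁) (h₂ : l ∉ V₂) (h₃ : l ∉ V₃) :
    vertexGram (edgeDev p ω) V₁ V₂ V₃ l ≤ (37 * ℓ * a * (85 * ℓ) * (85 * ℓ)) • 1 := by
  refine vertexGram_le_smul_one (fun i => abs_edgeDev_le_one p ω i l) (by positivity)
    (by positivity) (fun k hk => ?_) fun i hi j hj => ?_
  · have hkl := ne_of_mem_of_not_mem hk h₃
    calc _ = ∑ i ∈ V₁, |edgeDev p ω k i| * |edgeDev p ω l i| * ∑ j ∈ V₂,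
          |edgeDev p ω i j| * |edgeDev p ω k j| * |edgeDev p ω l j| := by
          refine Finset.sum_congr rfl fun i _ => ?_
          rw [Finset.mul_sum]
          refine Finset.sum_congr rfl fun j _ => ?_
          rw [edgeDev_comm p ω k i, edgeDev_comm p ω l i, edgeDev_comm p ω k j,
            edgeDev_comm p ω l j]
          ring
      _ ≤ ∑ i ∈ V₁, |edgeDev p ω k i| * |edgeDev p ω l i| * (85 * ℓ) := by
          refine Finset.sum_le_sum fun i hi => mul_le_mul_of_nonneg_left ?_ (by positivity)
          exact h.sum_abs_mul_abs_mul_abs_le hn hp ha hℓ (h13.forall_ne_finset hi hk)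
            (ne_of_mem_of_not_mem hi h₁) hkl V₂
      _ ≤ _ := by
          rw [← Finset.sum_mul]
          exact mul_le_mul_of_nonneg_right (h.sum_abs_mul_abs_le hn hp ha hℓ hkl V₁)
            (by positivity)
  · refine le_trans (le_of_eq (Finset.sum_congr rfl fun k _ => ?_))
      (h.sum_abs_mul_abs_mul_abs_le hn hp ha hℓ (h12.forall_ne_finset hi hj)
        (ne_of_mem_of_not_mem hi h₁) (ne_of_mem_of_not_mem hj h₂) V₃)
    rw [edgeDev_comm p ω l k]
    ring

/-- The product of the six values of `c` on the pairs of `{i, j, k, l}`. -/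
def sixProd (c : V → V → ℝ) (i j k l : V) : ℝ :=
  c i j * c k l * (c i k * c i l * (c j k * c j l))

/-- The signed clique form on `V₁ × V₂ × V₃ × V₄` is bounded below with constant `t`. -/
def CliqueFormBounded (p : ℝ) (ω : Finset (Sym2 V)) (V₁ V₂ V₃ V₄ : Finset V) (t : ℝ) : Prop :=
  ∀ u w : V → V → ℝ,
    -(t / 2 * (∑ i ∈ V₁, ∑ j ∈ V₂, |edgeDev p ω i j| * u i j ^ 2
      + ∑ k ∈ V₃, ∑ l ∈ V₄, |edgeDev p ω k l| * w k l ^ 2))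
    ≤ ∑ i ∈ V₁, ∑ j ∈ V₂, ∑ k ∈ V₃, ∑ l ∈ V₄, sixProd (edgeDev p ω) i j k l * (u i j * w k l)

open scoped MatrixOrder in
-- On a typical graph nothing is truncated.
lemma Typical.cliqueFormBounded (h : Typical ω p ℓ) (hn : (Fintype.card V : ℝ) = a ^ 3)
    (hp : p * a = 1) (ha : 1 ≤ a) (hℓ : 1 ≤ ℓ) {V₁ V₂ V₃ V₄ : Finset V} (h12 : Disjoint V₁ V₂)
    (h13 : Disjoint V₁ V₃) (h14 : Disjoint V₁ V₄) (h24 : Disjoint V₂ V₄) (h34 : Disjoint V₃ V₄)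
    {t : ℝ} (ht : 0 < t) (hB : ∑ l ∈ V₄, truncGram (edgeDev p ω) V₁ V₂ V₃ (37 * ℓ * a)
      (37 * ℓ * a * (85 * ℓ) * (85 * ℓ)) l ≤ (t ^ 2) • 1) :
    CliqueFormBounded p ω V₁ V₂ V₃ V₄ t := by
  refine neg_le_sum_clique_form ht (hB.trans_eq' (Finset.sum_congr rfl fun l hl => ?_))
  rw [truncGram, if_pos ⟨h.codegLE hn hp ha hℓ h12 V₃, h.vertexGram_le hn hp ha hℓ h12 h13
    (Finset.disjoint_right.1 h14 hl) (Finset.disjoint_right.1 h24 hl)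
    (Finset.disjoint_right.1 h34 hl)⟩]

open scoped MatrixOrder in
lemma bernoulliProb_not_cliqueFormBounded_le (hn : (Fintype.card V : ℝ) = a ^ 3) (hp : p * a = 1)
    (ha : 1 ≤ a) (hℓ : 1 ≤ Real.log (Fintype.card V)) {V₁ V₂ V₃ V₄ : Finset V}
    (h12 : Disjoint V₁ V₂) (h13 : Disjoint V₁ V₃) (h23 : Disjoint V₂ V₃) (h14 : Disjoint V₁ V₄)
    (h24 : Disjoint V₂ V₄) (h34 : Disjoint V₃ V₄) :
    bernoulliProb (allEdges V) p (fun ω => Typical ω p (Real.log (Fintype.card V)) ∧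
      ¬ CliqueFormBounded p ω V₁ V₂ V₃ V₄ (3000 * Real.log (Fintype.card V) ^ 2 * √a))
      ≤ 27 / (Fintype.card V : ℝ) ^ 8 := by
  have hn0 : (0 : ℝ) < Fintype.card V := by rw [hn]; positivity
  have hnp3 := card_mul_pow_three hn hp
  set n := (Fintype.card V : ℝ)
  set ℓ := Real.log n
  set q : ℕ := ⌈10 * ℓ⌉₊
  have hq : 10 * ℓ ≤ q := Nat.le_ceil _
  have hq' : (q : ℝ) ≤ 11 * ℓ := by linarith [Nat.ceil_lt_add_one (by positivity : 0 ≤ 10 * ℓ)]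
  have hq0 : q ≠ 0 := (Nat.ceil_pos.2 (by positivity)).ne'
  set R : ℝ := 37 * ℓ * a * (85 * ℓ) * (85 * ℓ) with hR
  have hDR : n * (2 * (p : ℝ) ^ 3 * (37 * ℓ * a)) ≤ R :=
    calc n * (2 * (p : ℝ) ^ 3 * (37 * ℓ * a)) = 37 * ℓ * a * 2 := by
          linear_combination (37 * ℓ * a * 2) * hnp3
      _ ≤ 37 * ℓ * a * (85 * ℓ * (85 * ℓ)) := by gcongr; nlinarith
      _ = R := by rw [hR]; ring
  have hR0 : 0 < R := by positivity
  have hbound : 3 * (q * R) ≤ (3000 * ℓ ^ 2 * √a) ^ 2 :=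
    calc 3 * (q * R) ≤ 3 * (11 * ℓ * R) := by gcongr
      _ = 8821725 * ℓ ^ 4 * a := by rw [hR]; ring
      _ ≤ 9000000 * ℓ ^ 4 * a := by gcongr; norm_num
      _ = (3000 * ℓ ^ 2 * √a) ^ 2 := by rw [mul_pow, Real.sq_sqrt (by linarith)]; ring
  have hexp : Real.exp (-(q : ℝ)) ≤ (n ^ 10)⁻¹ := by
    rw [← Real.exp_log (by positivity : 0 < n ^ 10), ← Real.exp_neg, Real.log_pow]
    exact Real.exp_le_exp.2 (neg_le_neg (by exact_mod_cast hq))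
  calc _ ≤ Real.exp 3 * n ^ 2 * Real.exp (-q) := by
        refine (bernoulliProb_mono fun ω _ hω hle => hω.2 ?_).trans
          (bernoulliProb_not_sum_truncGram_le h12 h13 h23 h14 h24 h34 (by positivity) hR0 hDR hq0)
        exact hω.1.cliqueFormBounded hn hp ha hℓ h12 h13 h14 h24 h34 (by positivity)
          (hle.trans (smul_le_smul_of_nonneg_right hbound zero_le_one))
    _ ≤ 3 ^ 3 * n ^ 2 * (n ^ 10)⁻¹ := by gcongr; exact exp_natCast_le_three_pow 3
    _ = 27 / n ^ 8 := by field_simp; norm_num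

end TypicalConsequences

section PseudoExpectation

variable {σ : Type*}

/-- The constant term of a fourth derivative. -/
noncomputable def polar (i j k l : σ) : MvPolynomial σ ℝ →ₗ[ℝ] ℝ where
  toFun f := constantCoeff (pderiv i (pderiv j (pderiv k (pderiv l f))))
  map_add' f g := by simp
  map_smul' c f := by simp

/-- The constant term of a second derivative. -/
noncomputable def hess (q : MvPolynomial σ ℝ) (i j : σ) : ℝ :=
  constantCoeff (pderiv i (pderiv j q))

lemma constantCoeff_eq_zero_of_isHomogeneous {R : Type*} [CommSemiring R] {q : MvPolynomial σ R}
    {d : ℕ} (hq : q.IsHomogeneous d) (hd : d ≠ 0) : constantCoeff q = 0 := by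
  rw [constantCoeff_eq]
  exact hq.coeff_eq_zero (by simpa using hd.symm)

lemma polar_mul_self {q : MvPolynomial σ ℝ} (hq : q.IsHomogeneous 2) (i j k l : σ) :
    polar i j k l (q * q)
      = 2 * (hess q i j * hess q k l + hess q i k * hess q j l + hess q i l * hess q j k) := by
  have hconst : constantCoeff q = 0 := constantCoeff_eq_zero_of_isHomogeneous hq two_ne_zero
  have hgrad : ∀ i, constantCoeff (pderiv i q) = 0 := fun i =>
    constantCoeff_eq_zero_of_isHomogeneous hq.pderiv one_ne_zero
  simp only [polar, LinearMap.coe_mk, AddHom.coe_mk, hess, pderiv_mul, map_add, map_mul, hconst,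
    hgrad]
  ring

/-- A functional attached to the pair `{i, j}` that is non-negative on squares of quadratic forms
and controls the square of their Hessian entry at `(i, j)`. -/
noncomputable def pairPolar (i j : σ) : MvPolynomial σ ℝ →ₗ[ℝ] ℝ :=
  polar i i j j + (1 / 6 : ℝ) • (polar i i i i + polar j j j j)

lemma pairPolar_mul_self {q : MvPolynomial σ ℝ} (hq : q.IsHomogeneous 2) (i j : σ) :
    pairPolar i j (q * q) = (hess q i i + hess q j j) ^ 2 + 4 * hess q i j ^ 2 := by
  simp only [pairPolar, LinearMap.add_apply, LinearMap.smul_apply, polar_mul_self hq, smul_eq_mul]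
  ring

/-- The sum of the functionals `pairPolar` over `A × B`, weighted by `|c|`. -/
noncomputable def pairSum (c : σ → σ → ℝ) (A B : Finset σ) : MvPolynomial σ ℝ →ₗ[ℝ] ℝ :=
  ∑ i ∈ A, ∑ j ∈ B, |c i j| • pairPolar i j

lemma le_pairSum_mul_self {q : MvPolynomial σ ℝ} (hq : q.IsHomogeneous 2) (c : σ → σ → ℝ)
    (A B : Finset σ) : 4 * ∑ i ∈ A, ∑ j ∈ B, |c i j| * hess q i j ^ 2 ≤ pairSum c A B (q * q) := by
  simp only [pairSum, LinearMap.sum_apply, LinearMap.smul_apply, pairPolar_mul_self hq,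
    smul_eq_mul, Finset.mul_sum]
  refine Finset.sum_le_sum fun i _ => Finset.sum_le_sum fun j _ => ?_
  linarith [mul_nonneg (abs_nonneg (c i j)) (sq_nonneg (hess q i i + hess q j j))]

/-- The unnormalised pseudo-expectation: the signed clique functional on `V₁ × V₂ × V₃ × V₄`,
made non-negative on squares by adding `s` times the pair functionals. -/
noncomputable def pseudoExp (c : σ → σ → ℝ) (V₁ V₂ V₃ V₄ : Finset σ) (s : ℝ) :
    MvPolynomial σ ℝ →ₗ[ℝ] ℝ :=
  ∑ i ∈ V₁, ∑ j ∈ V₂, ∑ k ∈ V₃, ∑ l ∈ V₄, sixProd c i j k l • polar i j k l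
    + s • (pairSum c V₁ V₂ + pairSum c V₃ V₄ + pairSum c V₁ V₃ + pairSum c V₂ V₄
      + pairSum c V₁ V₄ + pairSum c V₂ V₃)

lemma pseudoExp_mul_self {q : MvPolynomial σ ℝ} (hq : q.IsHomogeneous 2) (c : σ → σ → ℝ)
    (V₁ V₂ V₃ V₄ : Finset σ) (s : ℝ) :
    pseudoExp c V₁ V₂ V₃ V₄ s (q * q)
      = 2 * (∑ i ∈ V₁, ∑ j ∈ V₂, ∑ k ∈ V₃, ∑ l ∈ V₄,
            sixProd c i j k l * (hess q i j * hess q k l)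
          + ∑ i ∈ V₁, ∑ j ∈ V₂, ∑ k ∈ V₃, ∑ l ∈ V₄, sixProd c i j k l * (hess q i k * hess q j l)
          + ∑ i ∈ V₁, ∑ j ∈ V₂, ∑ k ∈ V₃, ∑ l ∈ V₄, sixProd c i j k l * (hess q i l * hess q j k))
        + s * (pairSum c V₁ V₂ (q * q) + pairSum c V₃ V₄ (q * q) + pairSum c V₁ V₃ (q * q)
          + pairSum c V₂ V₄ (q * q) + pairSum c V₁ V₄ (q * q) + pairSum c V₂ V₃ (q * q)) := by
  simp only [pseudoExp, LinearMap.add_apply, LinearMap.sum_apply, LinearMap.smul_apply,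
    polar_mul_self hq, smul_eq_mul]
  congr 1
  simp only [← Finset.sum_add_distrib, Finset.mul_sum]
  exact Finset.sum_congr rfl fun i _ => Finset.sum_congr rfl fun j _ =>
    Finset.sum_congr rfl fun k _ => Finset.sum_congr rfl fun l _ => by ring

section Rearrangement

variable {c : σ → σ → ℝ} (hc : ∀ i j, c i j = c j i) (V₁ V₂ V₃ V₄ : Finset σ) (h : σ → σ → ℝ)
include hc

lemma sum_sixProd_swap_middle :
    ∑ i ∈ V₁, ∑ k ∈ V₃, ∑ j ∈ V₂, ∑ l ∈ V₄, sixProd c i k j l * (h i k * h j l)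
      = ∑ i ∈ V₁, ∑ j ∈ V₂, ∑ k ∈ V₃, ∑ l ∈ V₄, sixProd c i j k l * (h i k * h j l) := by
  refine Finset.sum_congr rfl fun i _ => ?_
  rw [Finset.sum_comm]
  refine Finset.sum_congr rfl fun j _ => Finset.sum_congr rfl fun k _ =>
    Finset.sum_congr rfl fun l _ => ?_
  rw [sixProd, sixProd, hc k j]
  ring

lemma sum_sixProd_rotate :
    ∑ i ∈ V₁, ∑ l ∈ V₄, ∑ j ∈ V₂, ∑ k ∈ V₃, sixProd c i l j k * (h i l * h j k)
      = ∑ i ∈ V₁, ∑ j ∈ V₂, ∑ k ∈ V₃, ∑ l ∈ V₄, sixProd c i j k l * (h i l * h j k) := by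
  refine Finset.sum_congr rfl fun i _ => ?_
  rw [Finset.sum_comm]
  refine Finset.sum_congr rfl fun j _ => ?_
  rw [Finset.sum_comm]
  refine Finset.sum_congr rfl fun k _ => Finset.sum_congr rfl fun l _ => ?_
  rw [sixProd, sixProd, hc l j, hc l k]
  ring

end Rearrangement

section Distinct

variable [Fintype σ]

/-- The squared Euclidean norm as a polynomial. -/
noncomputable def normSqPoly (σ : Type*) [Fintype σ] : MvPolynomial σ ℝ := ∑ i, X i ^ 2

lemma normSqPoly_isHomogeneous : (normSqPoly σ).IsHomogeneous 2 :=
  IsHomogeneous.sum _ _ _ fun i _ => isHomogeneous_X_pow i 2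

lemma pderiv_normSqPoly (i : σ) : pderiv i (normSqPoly σ) = 2 * X i := by
  classical
  simp only [normSqPoly, map_sum, pderiv_pow, pderiv_X]
  rw [Finset.sum_eq_single i (fun j _ hj => by simp [Pi.single_eq_of_ne hj]) (by simp)]
  simp

lemma hess_normSqPoly_self (i : σ) : hess (normSqPoly σ) i i = 2 := by
  rw [hess, pderiv_normSqPoly, pderiv_mul]
  simpa using map_ofNat constantCoeff 2

lemma hess_normSqPoly_of_ne {i j : σ} (hij : i ≠ j) : hess (normSqPoly σ) i j = 0 := by
  rw [hess, pderiv_normSqPoly, pderiv_mul]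
  simp [pderiv_X_of_ne hij.symm]

variable {c : σ → σ → ℝ} {W : ℝ}

lemma pairSum_normSqPoly_le {A B : Finset σ} (hAB : Disjoint A B)
    (hW : ∑ i ∈ A, ∑ j ∈ B, |c i j| ≤ W) :
    pairSum c A B (normSqPoly σ * normSqPoly σ) ≤ 16 * W := by
  simp only [pairSum, LinearMap.sum_apply, LinearMap.smul_apply,
    pairPolar_mul_self normSqPoly_isHomogeneous, smul_eq_mul]
  calc _ = 16 * ∑ i ∈ A, ∑ j ∈ B, |c i j| := by
        simp only [Finset.mul_sum]
        refine Finset.sum_congr rfl fun i hi => Finset.sum_congr rfl fun j hj => ?_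
        rw [hess_normSqPoly_self, hess_normSqPoly_self,
          hess_normSqPoly_of_ne (hAB.forall_ne_finset hi hj)]
        ring
    _ ≤ 16 * W := by linarith

lemma pseudoExp_normSqPoly_le {V₁ V₂ V₃ V₄ : Finset σ} {s : ℝ} (hs : 0 ≤ s)
    (h12 : Disjoint V₁ V₂) (h13 : Disjoint V₁ V₃) (h23 : Disjoint V₂ V₃) (h14 : Disjoint V₁ V₄)
    (h24 : Disjoint V₂ V₄) (h34 : Disjoint V₃ V₄)
    (hW : ∀ A B : Finset σ, ∑ i ∈ A, ∑ j ∈ B, |c i j| ≤ W) :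
    pseudoExp c V₁ V₂ V₃ V₄ s (normSqPoly σ * normSqPoly σ) ≤ 96 * s * W := by
  have hcliques : ∑ i ∈ V₁, ∑ j ∈ V₂, ∑ k ∈ V₃, ∑ l ∈ V₄, sixProd c i j k l *
      polar i j k l (normSqPoly σ * normSqPoly σ) = 0 := by
    refine Finset.sum_eq_zero fun i hi => Finset.sum_eq_zero fun j hj => Finset.sum_eq_zero
      fun k hk => Finset.sum_eq_zero fun l hl => ?_
    rw [polar_mul_self normSqPoly_isHomogeneous,
      hess_normSqPoly_of_ne (h12.forall_ne_finset hi hj),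
      hess_normSqPoly_of_ne (h13.forall_ne_finset hi hk),
      hess_normSqPoly_of_ne (h14.forall_ne_finset hi hl)]
    ring
  simp only [pseudoExp, LinearMap.add_apply, LinearMap.sum_apply, LinearMap.smul_apply,
    smul_eq_mul, hcliques, zero_add]
  calc _ ≤ s * (16 * W + 16 * W + 16 * W + 16 * W + 16 * W + 16 * W) := by
        gcongr <;> exact pairSum_normSqPoly_le (by assumption) (hW _ _)
    _ = 96 * s * W := by ring

end Distinct

section Squarefree

variable {R : Type*} [CommSemiring R]

lemma pderiv_prod_X_of_notMem {s : Finset σ} {j : σ} (hj : j ∉ s) :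
    pderiv j (∏ x ∈ s, (X x : MvPolynomial σ R)) = 0 := by
  classical
  induction s using Finset.induction_on with
  | empty => simp
  | insert a s ha ih =>
    rw [Finset.mem_insert, not_or] at hj
    rw [Finset.prod_insert ha, pderiv_mul, ih hj.2, pderiv_X_of_ne (Ne.symm hj.1)]
    simp

variable [DecidableEq σ]

lemma pderiv_prod_X (s : Finset σ) (j : σ) :
    pderiv j (∏ x ∈ s, (X x : MvPolynomial σ R)) = if j ∈ s then ∏ x ∈ s.erase j, X x else 0 := by
  split_ifs with h
  · rw [← Finset.mul_prod_erase s _ h, pderiv_mul,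
      pderiv_prod_X_of_notMem (Finset.notMem_erase j s)]
    simp
  · exact pderiv_prod_X_of_notMem h

lemma polar_prod_X (s : Finset σ) {i j k l : σ} (hij : i ≠ j) (hik : i ≠ k) (hil : i ≠ l)
    (hjk : j ≠ k) (hjl : j ≠ l) (hkl : k ≠ l) :
    polar i j k l (∏ x ∈ s, X x) = if s = {i, j, k, l} then 1 else 0 := by
  have hconst : ∀ t : Finset σ, constantCoeff (∏ x ∈ t, (X x : MvPolynomial σ ℝ))
      = if t = ∅ then 1 else 0 := fun t => by
    split_ifs with ht
    · simp [ht]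
    · obtain ⟨x, hx⟩ := Finset.nonempty_iff_ne_empty.2 ht
      rw [map_prod, Finset.prod_eq_zero hx (constantCoeff_X ℝ x)]
  have hiff : s = {i, j, k, l} ↔ l ∈ s ∧ k ∈ s.erase l ∧ j ∈ (s.erase l).erase k ∧
      i ∈ ((s.erase l).erase k).erase j ∧ (((s.erase l).erase k).erase j).erase i = ∅ := by
    constructor
    · rintro rfl
      have herase : ((((({i, j, k, l} : Finset σ).erase l).erase k).erase j).erase i) = ∅ := by
        ext x
        simp only [Finset.mem_erase, Finset.mem_insert, Finset.mem_singleton, Finset.notMem_empty,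
          iff_false]
        tauto
      exact ⟨by simp, by simp [hkl], by simp [hjk, hjl], by simp [hij, hik, hil], herase⟩
    · rintro ⟨hl, hk, hj, hi, herase⟩
      ext x
      have hx := Finset.ext_iff.1 herase x
      grind
  simp only [polar, LinearMap.coe_mk, AddHom.coe_mk, pderiv_prod_X, apply_ite (pderiv _),
    apply_ite constantCoeff, map_zero, hconst, hiff, ite_and]

end Squarefree

lemma isNClique_four_iff [DecidableEq σ] {G : SimpleGraph σ} {i j k l : σ} :
    G.IsNClique 4 {i, j, k, l} ↔
      G.Adj i j ∧ G.Adj i k ∧ G.Adj i l ∧ G.Adj j k ∧ G.Adj j l ∧ G.Adj k l := by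
  constructor
  · intro h
    have hdistinct : i ≠ j ∧ i ≠ k ∧ i ≠ l ∧ j ≠ k ∧ j ≠ l ∧ k ≠ l := by
      have := h.card_eq
      grind [Finset.card_le_three]
    obtain ⟨hij, hik, hil, hjk, hjl, hkl⟩ := hdistinct
    have hclique := h.isClique
    exact ⟨hclique (by simp) (by simp) hij, hclique (by simp) (by simp) hik,
      hclique (by simp) (by simp) hil, hclique (by simp) (by simp) hjk,
      hclique (by simp) (by simp) hjl, hclique (by simp) (by simp) hkl⟩
  · rintro ⟨hij, hik, hil, hjk, hjl, hkl⟩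
    exact (SimpleGraph.is3Clique_triple_iff.2 ⟨hjk, hjl, hkl⟩).insert (by simp [hij, hik, hil])

end PseudoExpectation

section CliqueFunctional

variable {V : Type*} [DecidableEq V] {p : ℝ} {ω : Finset (Sym2 V)} {V₁ V₂ V₃ V₄ : Finset V}

lemma pseudoExp_mul_self_nonneg {t : ℝ} (ht : 0 ≤ t) (h1 : CliqueFormBounded p ω V₁ V₂ V₃ V₄ t)
    (h2 : CliqueFormBounded p ω V₁ V₃ V₂ V₄ t) (h3 : CliqueFormBounded p ω V₁ V₄ V₂ V₃ t)
    {q : MvPolynomial V ℝ} (hq : q.IsHomogeneous 2) :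
    0 ≤ pseudoExp (edgeDev p ω) V₁ V₂ V₃ V₄ (t / 4) (q * q) := by
  have hbound2 := h2 (hess q) (hess q)
  have hbound3 := h3 (hess q) (hess q)
  rw [sum_sixProd_swap_middle (edgeDev_comm p ω)] at hbound2
  rw [sum_sixProd_rotate (edgeDev_comm p ω)] at hbound3
  have hpair := fun A B =>
    mul_le_mul_of_nonneg_left (le_pairSum_mul_self hq (edgeDev p ω) A B) ht
  rw [pseudoExp_mul_self hq]
  linarith [h1 (hess q) (hess q), hpair V₁ V₂, hpair V₃ V₄, hpair V₁ V₃, hpair V₂ V₄,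
    hpair V₁ V₄, hpair V₂ V₃]

/-- The number of cliques with one vertex in each of four classes. -/
noncomputable def cliqueCount (ω : Finset (Sym2 V)) (V₁ V₂ V₃ V₄ : Finset V) : ℝ :=
  ∑ i ∈ V₁, ∑ j ∈ V₂, ∑ k ∈ V₃, ∑ l ∈ V₄, sixProd (edgeInd ω) i j k l

open scoped Classical in
lemma sixProd_edgeDev_mul_ite [Fintype V] (p : ℝ) (hω : ω ⊆ allEdges V) (i j k l : V) :
    sixProd (edgeDev p ω) i j k l * (if (edgeGraph ω).IsNClique 4 {i, j, k, l} then 1 else 0)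
      = (1 - p) ^ 6 * sixProd (edgeInd ω) i j k l := by
  simp only [isNClique_four_iff, edgeGraph_adj hω]
  split_ifs with h
  · obtain ⟨hij, hik, hil, hjk, hjl, hkl⟩ := h
    simp only [sixProd, edgeDev, edgeInd, hij, hik, hil, hjk, hjl, hkl, if_true]
    ring
  · have hzero : sixProd (edgeInd ω) i j k l = 0 := by
      simp only [sixProd, edgeInd, mul_eq_zero, ite_eq_right_iff, one_ne_zero, imp_false]
      tauto
    rw [hzero, mul_zero, mul_zero]

end CliqueFunctional

section CliquePoly

variable {n : ℕ}

lemma pderiv_pderiv_cliquePoly (G : SimpleGraph (Fin n)) (j : Fin n) :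
    pderiv j (pderiv j (cliquePoly G)) = 0 := by
  simp only [cliquePoly, map_sum]
  refine Finset.sum_eq_zero fun s _ => ?_
  rw [pderiv_prod_X]
  split_ifs
  · exact pderiv_prod_X_of_notMem (Finset.notMem_erase j s)
  · exact map_zero _

lemma pairSum_cliquePoly (G : SimpleGraph (Fin n)) (c : Fin n → Fin n → ℝ)
    (A B : Finset (Fin n)) : pairSum c A B (cliquePoly G) = 0 := by
  simp only [pairSum, LinearMap.sum_apply, LinearMap.smul_apply]
  refine Finset.sum_eq_zero fun i _ => Finset.sum_eq_zero fun j _ => ?_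
  simp [pairPolar, polar, pderiv_pderiv_cliquePoly]

open scoped Classical in
lemma polar_cliquePoly (G : SimpleGraph (Fin n)) {i j k l : Fin n} (hij : i ≠ j) (hik : i ≠ k)
    (hil : i ≠ l) (hjk : j ≠ k) (hjl : j ≠ l) (hkl : k ≠ l) :
    polar i j k l (cliquePoly G) = if G.IsNClique 4 {i, j, k, l} then 1 else 0 := by
  simp only [cliquePoly, map_sum, polar_prod_X _ hij hik hil hjk hjl hkl, Finset.sum_ite_eq',
    SimpleGraph.mem_cliqueFinset_iff]

lemma pseudoExp_cliquePoly (p : ℝ) {ω : Finset (Sym2 (Fin n))} (hω : ω ⊆ allEdges (Fin n))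
    {V₁ V₂ V₃ V₄ : Finset (Fin n)} (h12 : Disjoint V₁ V₂) (h13 : Disjoint V₁ V₃)
    (h23 : Disjoint V₂ V₃) (h14 : Disjoint V₁ V₄) (h24 : Disjoint V₂ V₄) (h34 : Disjoint V₃ V₄)
    (s : ℝ) :
    pseudoExp (edgeDev p ω) V₁ V₂ V₃ V₄ s (cliquePoly (edgeGraph ω))
      = (1 - p) ^ 6 * cliqueCount ω V₁ V₂ V₃ V₄ := by
  simp only [pseudoExp, LinearMap.add_apply, LinearMap.sum_apply, LinearMap.smul_apply,
    pairSum_cliquePoly, add_zero, smul_eq_mul, mul_zero, cliqueCount, Finset.mul_sum]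
  refine Finset.sum_congr rfl fun i hi => Finset.sum_congr rfl fun j hj => Finset.sum_congr rfl
    fun k hk => Finset.sum_congr rfl fun l hl => ?_
  rw [polar_cliquePoly _ (h12.forall_ne_finset hi hj) (h13.forall_ne_finset hi hk)
    (h14.forall_ne_finset hi hl) (h23.forall_ne_finset hj hk) (h24.forall_ne_finset hj hl)
    (h34.forall_ne_finset hk hl), ← sixProd_edgeDev_mul_ite p hω]

end CliquePoly

section SosDuality

open Matrix
open scoped MatrixOrder

section MaxQuadForm

variable {ι : Type*} [Fintype ι]

lemma bddAbove_quadForm_sphere (M : Matrix ι ι ℝ) :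
    BddAbove {r : ℝ | ∃ z : ι → ℝ, ∑ i, z i ^ 2 = 1 ∧ r = z ⬝ᵥ M *ᵥ z} := by
  refine ⟨∑ i, ∑ j, |M i j|, ?_⟩
  rintro r ⟨z, hz, rfl⟩
  have hcoord : ∀ i, |z i| ≤ 1 := fun i => by
    rw [← sq_le_one_iff_abs_le_one, ← hz]
    exact Finset.single_le_sum (f := fun i => z i ^ 2) (fun j _ => sq_nonneg _) (Finset.mem_univ i)
  simp only [dotProduct, mulVec, Finset.mul_sum]
  refine Finset.sum_le_sum fun i _ => Finset.sum_le_sum fun j _ => (le_abs_self _).trans ?_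
  calc |z i * (M i j * z j)| = |z i| * (|M i j| * |z j|) := by rw [abs_mul, abs_mul]
    _ ≤ 1 * (|M i j| * 1) := by
        gcongr
        · exact hcoord i
        · exact hcoord j
    _ = |M i j| := by ring

lemma dotProduct_mulVec_le_maxQuadForm (M : Matrix ι ι ℝ) (z : ι → ℝ) :
    z ⬝ᵥ M *ᵥ z ≤ maxQuadForm M * (z ⬝ᵥ z) := by
  rcases eq_or_ne z 0 with rfl | hz
  · simp
  have hpos : 0 < z ⬝ᵥ z :=
    (dotProduct_star_self_nonneg z).lt_of_ne' (dotProduct_self_eq_zero.not.2 hz)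
  set N := √(z ⬝ᵥ z)
  have hN : 0 < N := Real.sqrt_pos.2 hpos
  have hNsq : N ^ 2 = z ⬝ᵥ z := Real.sq_sqrt hpos.le
  have hunit : ∑ i, (N⁻¹ • z) i ^ 2 = 1 := by
    simp only [Pi.smul_apply, smul_eq_mul, mul_pow, ← Finset.mul_sum, inv_pow, hNsq]
    rw [dotProduct, Finset.sum_congr rfl fun i _ => (sq (z i)).symm] at hpos ⊢
    exact inv_mul_cancel₀ hpos.ne'
  have hle := le_csSup (bddAbove_quadForm_sphere M) ⟨N⁻¹ • z, hunit, rfl⟩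
  rw [mulVec_smul, smul_dotProduct, dotProduct_smul, smul_smul, ← sq, smul_eq_mul, inv_pow, hNsq,
    inv_mul_le_iff₀ hpos, mul_comm] at hle
  exact hle

lemma posSemidef_maxQuadForm_smul_one_sub [DecidableEq ι] {M : Matrix ι ι ℝ} (hM : M.IsSymm) :
    (maxQuadForm M • 1 - M).PosSemidef := by
  rw [posSemidef_iff_dotProduct_mulVec]
  refine ⟨(isHermitian_one.smul (IsSelfAdjoint.all _)).sub ?_, fun z => ?_⟩
  · rwa [IsHermitian, conjTranspose_eq_transpose_of_trivial]
  · rw [star_trivial, sub_mulVec, dotProduct_sub, smul_mulVec, one_mulVec, dotProduct_smul,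
      smul_eq_mul, sub_nonneg]
    exact dotProduct_mulVec_le_maxQuadForm M z

end MaxQuadForm

lemma normSqPoly_pow (σ : Type*) [Fintype σ] (k : ℕ) :
    normSqPoly σ ^ k = ∑ I : Fin k → σ, (∏ j, X (I j)) * ∏ j, X (I j) := by
  simp only [normSqPoly, Fintype.sum_pow, ← Finset.prod_mul_distrib, sq]

variable {n k : ℕ}

/-- The form `w ⬝ x^{⊗ k}` with coefficient vector `w`. -/
noncomputable def tensorForm (w : (Fin k → Fin n) → ℝ) : MvPolynomial (Fin n) ℝ :=
  ∑ I, C (w I) * ∏ j, X (I j)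

lemma isHomogeneous_prod_X (I : Fin k → Fin n) :
    (∏ j, (X (I j) : MvPolynomial (Fin n) ℝ)).IsHomogeneous k := by
  simpa using IsHomogeneous.prod Finset.univ (fun j => (X (I j) : MvPolynomial (Fin n) ℝ))
    (fun _ => 1) fun j _ => isHomogeneous_X ℝ (I j)

lemma isHomogeneous_tensorForm (w : (Fin k → Fin n) → ℝ) : (tensorForm w).IsHomogeneous k :=
  IsHomogeneous.sum _ _ _ fun I _ => (isHomogeneous_prod_X I).C_mul _

lemma eval_tensorForm (w : (Fin k → Fin n) → ℝ) (x : Fin n → ℝ) :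
    eval x (tensorForm w) = w ⬝ᵥ tensorPow k x := by
  simp only [tensorForm, map_sum, map_mul, eval_C, map_prod, eval_X, dotProduct, tensorPow]

lemma eval_normSqPoly_pow (k : ℕ) (x : Fin n → ℝ) :
    eval x (normSqPoly (Fin n) ^ k) = tensorPow k x ⬝ᵥ tensorPow k x := by
  simp only [normSqPoly_pow, map_sum, map_mul, map_prod, eval_X, dotProduct, tensorPow]

lemma IsMatrixRep.exists_sum_tensorForm_mul_self {f : MvPolynomial (Fin n) ℝ}
    {M : Matrix (Fin k → Fin n) (Fin k → Fin n) ℝ} (hM : IsMatrixRep k f M) :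
    ∃ B : Matrix (Fin k → Fin n) (Fin k → Fin n) ℝ,
      ∑ r, tensorForm (B r) * tensorForm (B r) = maxQuadForm M • normSqPoly (Fin n) ^ k - f := by
  obtain ⟨B, hB⟩ : ∃ B, maxQuadForm M • 1 - M = Bᴴ * B :=
    CStarAlgebra.nonneg_iff_eq_star_mul_self.1 (posSemidef_maxQuadForm_smul_one_sub hM.1).nonneg
  refine ⟨B, MvPolynomial.funext fun x => ?_⟩
  set y := tensorPow k x with hy
  calc eval x (∑ r, tensorForm (B r) * tensorForm (B r)) = (B *ᵥ y) ⬝ᵥ (B *ᵥ y) := by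
        simp only [map_sum, map_mul, eval_tensorForm, ← hy]
        rfl
    _ = y ⬝ᵥ (maxQuadForm M • 1 - M) *ᵥ y := by
        rw [hB, conjTranspose_eq_transpose_of_trivial, ← mulVec_mulVec, dotProduct_mulVec,
          dotProduct_mulVec, vecMul_transpose, ← dotProduct_mulVec]
    _ = eval x (maxQuadForm M • normSqPoly (Fin n) ^ k - f) := by
        rw [sub_mulVec, dotProduct_sub, hM.2, smul_mulVec, one_mulVec, dotProduct_smul, map_sub,
          smul_eval, eval_normSqPoly_pow, smul_eq_mul]

section WeakDuality

variable {f : MvPolynomial (Fin n) ℝ} (L : MvPolynomial (Fin n) ℝ →ₗ[ℝ] ℝ)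
  (hL : ∀ q : MvPolynomial (Fin n) ℝ, q.IsHomogeneous k → 0 ≤ L (q * q))
include hL

lemma IsMatrixRep.le_maxQuadForm_mul {M : Matrix (Fin k → Fin n) (Fin k → Fin n) ℝ}
    (hM : IsMatrixRep k f M) : L f ≤ maxQuadForm M * L (normSqPoly (Fin n) ^ k) := by
  obtain ⟨B, hB⟩ := hM.exists_sum_tensorForm_mul_self
  have hnonneg : 0 ≤ L (∑ r, tensorForm (B r) * tensorForm (B r)) := by
    rw [map_sum]
    exact Finset.sum_nonneg fun r _ => hL _ (isHomogeneous_tensorForm (B r))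
  rwa [hB, map_sub, map_smul, smul_eq_mul, sub_nonneg] at hnonneg

lemma le_sosValue (hf : ∃ M, IsMatrixRep k f M) {b T : ℝ} (hb : 0 < b) (hT : 0 < T)
    (hLT : L (normSqPoly (Fin n) ^ k) ≤ T) (hLf : b * T ≤ L f) : b ≤ sosValue k f := by
  obtain ⟨M₀, hM₀⟩ := hf
  refine le_csInf ⟨_, M₀, hM₀, rfl⟩ ?_
  rintro r ⟨M, hM, rfl⟩
  have hnorm : 0 ≤ L (normSqPoly (Fin n) ^ k) := by
    rw [normSqPoly_pow, map_sum]
    exact Finset.sum_nonneg fun I _ => hL _ (isHomogeneous_prod_X I)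
  have hle := hLf.trans (hM.le_maxQuadForm_mul L hL)
  have hpos : 0 < maxQuadForm M := pos_of_mul_pos_left ((mul_pos hb hT).trans_le hle) hnorm
  exact le_of_mul_le_mul_right (hle.trans (mul_le_mul_of_nonneg_left hLT hpos.le)) hT

end WeakDuality

lemma IsMatrixRep.add {f g : MvPolynomial (Fin n) ℝ}
    {M N : Matrix (Fin k → Fin n) (Fin k → Fin n) ℝ} (hM : IsMatrixRep k f M)
    (hN : IsMatrixRep k g N) : IsMatrixRep k (f + g) (M + N) := by
  refine ⟨hM.1.add hN.1, fun x => ?_⟩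
  rw [add_mulVec, dotProduct_add, hM.2, hN.2, map_add]

lemma isMatrixRep_prod_X_mul_prod_X (I J : Fin k → Fin n) :
    IsMatrixRep k ((∏ a, X (I a)) * ∏ a, X (J a))
      ((1 / 2 : ℝ) • (Matrix.single I J 1 + Matrix.single J I 1)) := by
  refine ⟨?_, fun x => ?_⟩
  · rw [IsSymm, transpose_smul, transpose_add, transpose_single, transpose_single, add_comm]
  · have hsingle : ∀ A B : Fin k → Fin n, tensorPow k x ⬝ᵥ Matrix.single A B 1 *ᵥ tensorPow k x
        = tensorPow k x A * tensorPow k x B := fun A B => by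
      simp [dotProduct, mulVec, Matrix.single_apply, ite_and]
    rw [smul_mulVec, dotProduct_smul, add_mulVec, dotProduct_add, hsingle, hsingle]
    simp only [tensorPow, smul_eq_mul, map_mul, map_prod, eval_X]
    ring

lemma exists_isMatrixRep_cliquePoly (G : SimpleGraph (Fin n)) :
    ∃ M, IsMatrixRep 2 (cliquePoly G) M := by
  classical
  refine Finset.sum_induction _ (fun f => ∃ M, IsMatrixRep 2 f M)
    (fun f g ⟨M, hM⟩ ⟨N, hN⟩ => ⟨M + N, hM.add hN⟩) ⟨0, isSymm_zero, fun x => by simp⟩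
    fun s hs => ?_
  let e := (s.equivFinOfCardEq (SimpleGraph.mem_cliqueFinset_iff.1 hs).card_eq).symm
  have hprod : ∏ i ∈ s, (X i : MvPolynomial (Fin n) ℝ)
      = (∏ a, X (![(e 0 : Fin n), e 1] a)) * ∏ a, X (![(e 2 : Fin n), e 3] a) := by
    rw [← Finset.prod_coe_sort, ← e.prod_comp, Fin.prod_univ_four]
    simp [Fin.prod_univ_two, mul_assoc]
  exact ⟨_, hprod ▸ isMatrixRep_prod_X_mul_prod_X _ _⟩

end SosDuality

section SecondMoment

variable {V : Type*}

/-- The pairs of positions in a `4`-tuple. -/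
def posPairs : Finset (Fin 4 × Fin 4) := Finset.univ.filter fun x => x.1 < x.2

lemma eq_and_eq_of_tuple_edge_eq {U : Fin 4 → Finset V}
    (hU : Pairwise fun a b => Disjoint (U a) (U b)) {v v' : Fin 4 → V} (hv : ∀ a, v a ∈ U a)
    (hv' : ∀ a, v' a ∈ U a) {x y : Fin 4 × Fin 4}
    (hx : x ∈ posPairs) (hy : y ∈ posPairs) (h : s(v x.1, v x.2) = s(v' y.1, v' y.2)) :
    x = y ∧ v x.1 = v' x.1 ∧ v x.2 = v' x.2 := by
  have hpos : ∀ {a b}, v a = v' b → a = b := fun {a b} hab => by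
    by_contra hne
    exact (hU hne).forall_ne_finset (hv a) (hv' b) hab
  have hx := (Finset.mem_filter.1 hx).2
  have hy := (Finset.mem_filter.1 hy).2
  rcases Sym2.eq_iff.1 h with ⟨h1, h2⟩ | ⟨h1, h2⟩
  · have hxy : x = y := Prod.ext (hpos h1) (hpos h2)
    exact ⟨hxy, hxy ▸ h1, hxy ▸ h2⟩
  · rw [hpos h1, hpos h2] at hx
    exact absurd hx hy.not_gt

variable [DecidableEq V]

/-- The six edges spanned by a `4`-tuple of vertices. -/
def tupleEdges (v : Fin 4 → V) : Finset (Sym2 V) :=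
  posPairs.image fun x => s(v x.1, v x.2)

/-- The positions where two tuples agree. -/
def agree (v v' : Fin 4 → V) : Finset (Fin 4) := Finset.univ.filter fun a => v a = v' a

lemma cliqueCount_eq_sum_piFinset (ω : Finset (Sym2 V)) (U : Fin 4 → Finset V) :
    cliqueCount ω (U 0) (U 1) (U 2) (U 3)
      = ∑ v ∈ Fintype.piFinset U, if tupleEdges v ⊆ ω then 1 else 0 := by
  have hclique : ∀ v : Fin 4 → V, (if tupleEdges v ⊆ ω then (1 : ℝ) else 0)
      = sixProd (edgeInd ω) (v 0) (v 1) (v 2) (v 3) := fun v => by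
    have hpairs : posPairs = {(0, 1), (2, 3), (0, 2), (0, 3), (1, 2), (1, 3)} := by decide
    simp only [tupleEdges, hpairs, Finset.image_insert, Finset.image_singleton,
      Finset.insert_subset_iff, Finset.singleton_subset_iff, sixProd, edgeInd, ite_and, mul_ite,
      mul_one, mul_zero]
    split_ifs <;> rfl
  simp only [hclique, cliqueCount]
  rw [← Finset.sum_product', ← Finset.sum_product', ← Finset.sum_product']
  symm
  refine Finset.sum_nbij' (fun v : Fin 4 → V => (((v 0, v 1), v 2), v 3))
    (fun x => ![x.1.1.1, x.1.1.2, x.1.2, x.2]) (fun v hv => ?_) (fun x hx => ?_)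
    (fun v _ => ?_) (fun x _ => by simp) fun _ _ => rfl
  · simp [Fintype.mem_piFinset.1 hv]
  · simp only [Finset.mem_product] at hx
    rw [Fintype.mem_piFinset, Fin.forall_fin_succ, Fin.forall_fin_succ, Fin.forall_fin_two]
    simpa using ⟨hx.1.1.1, hx.1.1.2, hx.1.2, hx.2⟩
  · ext a
    fin_cases a <;> rfl

lemma card_agree_superset {U : Fin 4 → Finset V} {m : ℕ} (hm : ∀ a, (U a).card = m)
    {v : Fin 4 → V} (hv : ∀ a, v a ∈ U a) (B : Finset (Fin 4)) :
    ((Fintype.piFinset U).filter fun v' => B ⊆ agree v v').card = m ^ (4 - B.card) := by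
  have hpi : (Fintype.piFinset U).filter (fun v' => B ⊆ agree v v')
      = Fintype.piFinset fun a => if a ∈ B then {v a} else U a := by
    ext v'
    simp only [Finset.mem_filter, Fintype.mem_piFinset, Finset.subset_iff, agree,
      Finset.mem_univ, true_and]
    grind
  have hcard : ∀ a, (if a ∈ B then {v a} else U a : Finset V).card = if a ∈ B then 1 else m :=
    fun a => by split_ifs <;> simp [hm]
  rw [hpi, Fintype.card_piFinset]
  simp only [hcard, Finset.prod_ite, Finset.prod_const_one, one_mul, Finset.prod_const]
  rw [Finset.filter_notMem_eq_sdiff, Finset.card_univ_sdiff, Fintype.card_fin]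

lemma sum_agree_superset {U : Fin 4 → Finset V} {m : ℕ} (hm : ∀ a, (U a).card = m)
    {v : Fin 4 → V} (hv : ∀ a, v a ∈ U a) (p : ℝ) :
    ∑ v' ∈ Fintype.piFinset U, (p ^ 12 + ∑ B with 2 ≤ B.card,
        (if B ⊆ agree v v' then 1 else 0) * p ^ (12 - B.card.choose 2))
      = m ^ 4 * p ^ 12 + (6 * (m ^ 2 * p ^ 11) + 4 * (m * p ^ 9) + p ^ 6) := by
  rw [Finset.sum_add_distrib, Finset.sum_const, Finset.sum_comm]
  simp only [← Finset.sum_mul, Finset.sum_boole, card_agree_superset hm hv]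
  have hsize := Finset.sum_powerset_apply_card (fun c => if 2 ≤ c then
    (m : ℝ) ^ (4 - c) * p ^ (12 - c.choose 2) else 0)
    (x := (Finset.univ : Finset (Fin 4)))
  rw [Finset.powerset_univ, ← Finset.sum_filter] at hsize
  push_cast
  rw [hsize, Finset.card_univ, Fintype.card_fin]
  simp [Finset.sum_range_succ, Nat.choose, hm]

section Tuples

variable {U : Fin 4 → Finset V} (hU : Pairwise fun a b => Disjoint (U a) (U b))
  {v v' : Fin 4 → V} (hv : ∀ a, v a ∈ U a)
include hU hv

lemma card_tupleEdges : (tupleEdges v).card = 6 := by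
  rw [tupleEdges, Finset.card_image_of_injOn fun x hx y hy h =>
    (eq_and_eq_of_tuple_edge_eq hU hv hv hx hy h).1]
  decide

lemma card_tupleEdges_inter_le (hv' : ∀ a, v' a ∈ U a) :
    (tupleEdges v ∩ tupleEdges v').card ≤ (agree v v').card.choose 2 := by
  have hsub : tupleEdges v ∩ tupleEdges v' ⊆
      (posPairs.filter fun x => x.1 ∈ agree v v' ∧ x.2 ∈ agree v v').image
        fun x => s(v x.1, v x.2) := by
    intro e he
    obtain ⟨hev, hev'⟩ := Finset.mem_inter.1 he
    obtain ⟨x, hx, rfl⟩ := Finset.mem_image.1 hev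
    obtain ⟨y, hy, hxy⟩ := Finset.mem_image.1 hev'
    have hagree := (eq_and_eq_of_tuple_edge_eq hU hv hv' hx hy hxy.symm).2
    exact Finset.mem_image_of_mem _ (Finset.mem_filter.2 ⟨hx, by simpa [agree] using hagree⟩)
  have hpairs : ∀ A : Finset (Fin 4), (posPairs.filter fun x => x.1 ∈ A ∧ x.2 ∈ A).card
      ≤ A.card.choose 2 := by decide
  exact (Finset.card_le_card hsub).trans (Finset.card_image_le.trans (hpairs _))

lemma le_card_tupleEdges_union (hv' : ∀ a, v' a ∈ U a) :
    12 - (agree v v').card.choose 2 ≤ (tupleEdges v ∪ tupleEdges v').card := by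
  have hunion := Finset.card_union_add_card_inter (tupleEdges v) (tupleEdges v')
  rw [card_tupleEdges hU hv, card_tupleEdges hU hv'] at hunion
  have hinter := card_tupleEdges_inter_le hU hv hv'
  omega

lemma pow_card_tupleEdges_union_le (p : unitInterval) (hv' : ∀ a, v' a ∈ U a) :
    (p : ℝ) ^ (tupleEdges v ∪ tupleEdges v').card ≤ (p : ℝ) ^ 12 + ∑ B with 2 ≤ B.card,
      (if B ⊆ agree v v' then 1 else 0) * (p : ℝ) ^ (12 - B.card.choose 2) := by
  have hp := p.2.1
  have hterm : ∀ B : Finset (Fin 4), 0 ≤ (if B ⊆ agree v v' then (1 : ℝ) else 0)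
      * (p : ℝ) ^ (12 - B.card.choose 2) := fun B => by
    split_ifs <;> positivity
  refine (pow_le_pow_of_le_one hp p.2.2 (le_card_tupleEdges_union hU hv hv')).trans ?_
  rcases le_or_gt 2 (agree v v').card with hcard | hcard
  · refine le_add_of_nonneg_of_le (by positivity) ?_
    simpa using Finset.single_le_sum (fun B _ => hterm B)
      (Finset.mem_filter.2 ⟨Finset.mem_univ (agree v v'), hcard⟩)
  · rw [Nat.choose_eq_zero_of_lt hcard]
    exact le_add_of_nonneg_right (Finset.sum_nonneg fun B _ => hterm B)

variable [Fintype V]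

lemma tupleEdges_subset : tupleEdges v ⊆ allEdges V := by
  intro e he
  obtain ⟨x, hx, rfl⟩ := Finset.mem_image.1 he
  exact mem_allEdges.2 ((hU (Finset.mem_filter.1 hx).2.ne).forall_ne_finset (hv x.1) (hv x.2))

lemma bernoulliExp_tupleEdges_mul (p : unitInterval) (hv' : ∀ a, v' a ∈ U a) :
    bernoulliExp (allEdges V) p (fun ω => (if tupleEdges v ⊆ ω then 1 else 0)
      * if tupleEdges v' ⊆ ω then 1 else 0) = (p : ℝ) ^ (tupleEdges v ∪ tupleEdges v').card := by
  rw [← bernoulliExp_subset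
    (Finset.union_subset (tupleEdges_subset hU hv) (tupleEdges_subset hU hv'))]
  simp only [Finset.union_subset_iff, ite_and, ite_mul, one_mul, zero_mul]

end Tuples

section Moments

variable [Fintype V] {U : Fin 4 → Finset V} (hU : Pairwise fun a b => Disjoint (U a) (U b)) {m : ℕ}
  (hm : ∀ a, (U a).card = m) (p : unitInterval)
include hU hm

lemma bernoulliExp_cliqueCount :
    bernoulliExp (allEdges V) p (fun ω => cliqueCount ω (U 0) (U 1) (U 2) (U 3))
      = m ^ 4 * (p : ℝ) ^ 6 := by
  simp only [cliqueCount_eq_sum_piFinset, bernoulliExp_sum]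
  have hterm : ∀ v ∈ Fintype.piFinset U, bernoulliExp (allEdges V) p
      (fun ω => if tupleEdges v ⊆ ω then 1 else 0) = (p : ℝ) ^ 6 := fun v hv => by
    have hv := Fintype.mem_piFinset.1 hv
    rw [← card_tupleEdges hU hv, ← bernoulliExp_subset (tupleEdges_subset hU hv)]
  rw [Finset.sum_congr rfl hterm, Finset.sum_const, Fintype.card_piFinset]
  simp [hm]

-- Pairs of tuples are grouped by the set of positions where they agree.
lemma bernoulliExp_cliqueCount_sq_le :
    bernoulliExp (allEdges V) p (fun ω => cliqueCount ω (U 0) (U 1) (U 2) (U 3) ^ 2)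
      ≤ m ^ 8 * (p : ℝ) ^ 12 + 6 * (m ^ 6 * (p : ℝ) ^ 11) + 4 * (m ^ 5 * (p : ℝ) ^ 9)
        + m ^ 4 * (p : ℝ) ^ 6 := by
  have hcard : (Fintype.piFinset U).card = m ^ 4 := by
    rw [Fintype.card_piFinset]
    simp [hm]
  calc bernoulliExp (allEdges V) p (fun ω => cliqueCount ω (U 0) (U 1) (U 2) (U 3) ^ 2)
      = ∑ v ∈ Fintype.piFinset U, ∑ v' ∈ Fintype.piFinset U,
          (p : ℝ) ^ (tupleEdges v ∪ tupleEdges v').card := by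
        simp only [cliqueCount_eq_sum_piFinset, sq, Finset.sum_mul_sum, bernoulliExp_sum]
        exact Finset.sum_congr rfl fun v hv => Finset.sum_congr rfl fun v' hv' =>
          bernoulliExp_tupleEdges_mul hU (Fintype.mem_piFinset.1 hv) p (Fintype.mem_piFinset.1 hv')
    _ ≤ ∑ v ∈ Fintype.piFinset U, ∑ v' ∈ Fintype.piFinset U, ((p : ℝ) ^ 12
          + ∑ B with 2 ≤ B.card,
            (if B ⊆ agree v v' then 1 else 0) * (p : ℝ) ^ (12 - B.card.choose 2)) :=
        Finset.sum_le_sum fun v hv => Finset.sum_le_sum fun v' hv' =>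
          pow_card_tupleEdges_union_le hU (Fintype.mem_piFinset.1 hv) p (Fintype.mem_piFinset.1 hv')
    _ = m ^ 4 * (m ^ 4 * (p : ℝ) ^ 12
          + (6 * (m ^ 2 * (p : ℝ) ^ 11) + 4 * (m * (p : ℝ) ^ 9) + (p : ℝ) ^ 6)) := by
        rw [Finset.sum_congr rfl fun v hv =>
          sum_agree_superset hm (Fintype.mem_piFinset.1 hv) (p : ℝ), Finset.sum_const, hcard,
          nsmul_eq_mul, Nat.cast_pow]
    _ = _ := by ring

lemma bernoulliExp_cliqueCount_sub_sq_le :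
    bernoulliExp (allEdges V) p
        (fun ω => (cliqueCount ω (U 0) (U 1) (U 2) (U 3) - m ^ 4 * (p : ℝ) ^ 6) ^ 2)
      ≤ 6 * (m ^ 6 * (p : ℝ) ^ 11) + 4 * (m ^ 5 * (p : ℝ) ^ 9) + m ^ 4 * (p : ℝ) ^ 6 := by
  set M : ℝ := m ^ 4 * (p : ℝ) ^ 6 with hM
  have hsq : ∀ x : ℝ, (x - M) ^ 2 = x ^ 2 + -2 * M * x + M ^ 2 := fun x => by ring
  simp only [hsq]
  rw [bernoulliExp_add, bernoulliExp_add, bernoulliExp_const_mul, bernoulliExp_const,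
    bernoulliExp_cliqueCount hU hm, ← hM]
  have hMM : M ^ 2 = m ^ 8 * (p : ℝ) ^ 12 := by rw [hM]; ring
  linarith [bernoulliExp_cliqueCount_sq_le hU hm p, hMM]

variable {p}

lemma bernoulliProb_cliqueCount_lt_le (hp : 0 < (p : ℝ)) (hm0 : 0 < m) :
    bernoulliProb (allEdges V) p
        (fun ω => cliqueCount ω (U 0) (U 1) (U 2) (U 3) < m ^ 4 * (p : ℝ) ^ 6 / 2)
      ≤ 24 / (m ^ 2 * (p : ℝ)) + 16 / (m ^ 3 * (p : ℝ) ^ 3) + 4 / (m ^ 4 * (p : ℝ) ^ 6) := by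
  have : (0 : ℝ) < m := by exact_mod_cast hm0
  set M : ℝ := m ^ 4 * (p : ℝ) ^ 6 with hM
  have hM0 : 0 < M := by positivity
  calc bernoulliProb (allEdges V) p (fun ω => cliqueCount ω (U 0) (U 1) (U 2) (U 3) < M / 2)
      ≤ bernoulliExp (allEdges V) p
          (fun ω => (cliqueCount ω (U 0) (U 1) (U 2) (U 3) - M) ^ 2) / (M ^ 2 / 4) :=
        bernoulliProb_le_exp_div (by positivity) (fun ω _ => sq_nonneg _)
          fun ω _ hω => by nlinarith
    _ ≤ (6 * (m ^ 6 * (p : ℝ) ^ 11) + 4 * (m ^ 5 * (p : ℝ) ^ 9) + M) / (M ^ 2 / 4) := by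
        gcongr
        exact bernoulliExp_cliqueCount_sub_sq_le hU hm p
    _ = _ := by
        rw [hM]
        field_simp
        ring

end Moments

end SecondMoment

section Triangles

variable {V : Type*} [DecidableEq V]

/-- The number of neighbours of `k` in `S`. -/
def degIn (ω : Finset (Sym2 V)) (S : Finset V) (k : V) : ℝ := ∑ i ∈ S, edgeInd ω i k

/-- The number of triangles with one vertex in each of three sets. -/
def triangleCount (ω : Finset (Sym2 V)) (S₁ S₂ S₃ : Finset V) : ℝ :=
  ∑ i ∈ S₁, ∑ j ∈ S₂, ∑ k ∈ S₃, edgeInd ω i j * edgeInd ω i k * edgeInd ω j k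

lemma degIn_nonneg (ω : Finset (Sym2 V)) (S : Finset V) (k : V) : 0 ≤ degIn ω S k :=
  Finset.sum_nonneg fun i _ => edgeInd_nonneg ω i k

lemma degIn_le_card (ω : Finset (Sym2 V)) (S : Finset V) (k : V) : degIn ω S k ≤ S.card := by
  simpa [degIn] using Finset.sum_le_card_nsmul S _ 1 fun i _ => edgeInd_le_one ω i k

lemma card_filter_eq_degIn (ω : Finset (Sym2 V)) (S : Finset V) (k : V) :
    ((S.filter fun i => s(i, k) ∈ ω).card : ℝ) = degIn ω S k := by
  simp only [degIn, edgeInd, Finset.sum_boole]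

variable {ω : Finset (Sym2 V)} {p a ℓ : ℝ}

lemma mul_sum_degIn_mul_degIn_le_of_card_le (hp : p * a = 1) (ha : 0 < a) {S₁ : Finset V}
    (hS₁ : S₁.card ≤ a) (S₂ S₃ : Finset V) :
    p * ∑ k ∈ S₃, degIn ω S₁ k * degIn ω S₂ k ≤ ∑ k ∈ S₃, degIn ω S₂ k := by
  have hp0 : 0 < p := pos_of_mul_pos_left (hp ▸ one_pos) ha.le
  rw [Finset.mul_sum]
  refine Finset.sum_le_sum fun k _ => ?_
  rw [← mul_assoc]
  refine mul_le_of_le_one_left (degIn_nonneg ω S₂ k) ?_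
  exact hp ▸ mul_le_mul_of_nonneg_left ((degIn_le_card ω S₁ k).trans hS₁) hp0.le

variable [Fintype V]

lemma Typical.triangleCount_le_sum_degIn (h : Typical ω p ℓ) (S₁ S₂ S₃ : Finset V) :
    triangleCount ω S₁ S₂ S₃ ≤ 4 * (p * ∑ k ∈ S₃, degIn ω S₁ k * degIn ω S₂ k)
      + 20 * ℓ * (∑ k ∈ S₃, degIn ω S₁ k + ∑ k ∈ S₃, degIn ω S₂ k + S₃.card) := by
  have hnbr : ∀ k, ∑ i ∈ S₁, ∑ j ∈ S₂, edgeInd ω i j * edgeInd ω i k * edgeInd ω j k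
      = ∑ i ∈ S₁ with s(i, k) ∈ ω, ∑ j ∈ S₂ with s(j, k) ∈ ω, edgeInd ω i j := fun k => by
    simp only [Finset.sum_filter]
    refine Finset.sum_congr rfl fun i _ => ?_
    by_cases hik : s(i, k) ∈ ω <;> simp [edgeInd, hik, ← ite_and, and_comm]
  calc triangleCount ω S₁ S₂ S₃
      = ∑ k ∈ S₃, ∑ i ∈ S₁, ∑ j ∈ S₂, edgeInd ω i j * edgeInd ω i k * edgeInd ω j k := by
        rw [triangleCount, Finset.sum_congr rfl fun i _ => Finset.sum_comm, Finset.sum_comm]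
    _ ≤ ∑ k ∈ S₃, 2 * (2 * (degIn ω S₁ k * degIn ω S₂ k * p)
          + 10 * (ℓ * (degIn ω S₁ k + degIn ω S₂ k + 1))) := by
        refine Finset.sum_le_sum fun k _ => ?_
        rw [hnbr, ← card_filter_eq_degIn, ← card_filter_eq_degIn]
        exact h.edges _ _
    _ = _ := by
        rw [Finset.cast_card, ← Finset.sum_add_distrib, ← Finset.sum_add_distrib, Finset.mul_sum,
          Finset.mul_sum, Finset.mul_sum, ← Finset.sum_add_distrib]
        exact Finset.sum_congr rfl fun k _ => by ring

lemma Typical.sum_degIn_le (h : Typical ω p ℓ) (hℓ : 1 ≤ ℓ) {S T : Finset V} {x : ℝ} (hx : 1 ≤ x)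
    (hS : S.card ≤ x) (hT : T.card ≤ x) (hST : S.card * T.card * p ≤ x) :
    ∑ k ∈ T, degIn ω S k ≤ 64 * ℓ * x := by
  calc ∑ k ∈ T, degIn ω S k = ∑ i ∈ S, ∑ k ∈ T, edgeInd ω i k := Finset.sum_comm
    _ ≤ 2 * (2 * (S.card * T.card * p) + 10 * (ℓ * (S.card + T.card + 1))) := h.edges S T
    _ ≤ 2 * (2 * x + 10 * (ℓ * (x + x + x))) := by gcongr
    _ ≤ 64 * ℓ * x := by nlinarith

lemma Typical.triangleCount_le_of_sum_degIn_le (h : Typical ω p ℓ) (hℓ : 1 ≤ ℓ)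
    {S₁ S₂ S₃ : Finset V} {x : ℝ} (hS₃ : S₃.card ≤ x)
    (h₁ : ∑ k ∈ S₃, degIn ω S₁ k ≤ 64 * ℓ * x) (h₂ : ∑ k ∈ S₃, degIn ω S₂ k ≤ 64 * ℓ * x)
    (h₁₂ : p * ∑ k ∈ S₃, degIn ω S₁ k * degIn ω S₂ k ≤ 64 * ℓ * x) :
    triangleCount ω S₁ S₂ S₃ ≤ 3000 * ℓ ^ 2 * x := by
  have hx : 0 ≤ x := (Nat.cast_nonneg _).trans hS₃
  calc triangleCount ω S₁ S₂ S₃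
      ≤ 4 * (64 * ℓ * x) + 20 * ℓ * (64 * ℓ * x + 64 * ℓ * x + ℓ * x) := by
        refine (h.triangleCount_le_sum_degIn S₁ S₂ S₃).trans ?_
        gcongr
        exact hS₃.trans (le_mul_of_one_le_left hx hℓ)
    _ = 256 * ℓ * x + 2580 * ℓ ^ 2 * x := by ring
    _ ≤ 256 * ℓ ^ 2 * x + 2580 * ℓ ^ 2 * x := by
        gcongr
        exact le_self_pow₀ hℓ two_ne_zero
    _ ≤ 3000 * ℓ ^ 2 * x := by nlinarith [mul_nonneg (sq_nonneg ℓ) hx]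

variable (h : Typical ω p ℓ) (hn : (Fintype.card V : ℝ) = a ^ 3) (hp : p * a = 1) (ha : 1 ≤ a)
  (hℓ : 1 ≤ ℓ)
include h hn hp ha hℓ

lemma Typical.sum_degIn_sq_le (S T : Finset V) {s : ℝ} (hs : S.card ≤ s) :
    ∑ k ∈ T, degIn ω S k ^ 2 ≤ 12 * ℓ * s * a * (a + s) := by
  have hpair : ∀ i j, ∑ k, edgeInd ω i k * edgeInd ω j k
      ≤ (if i = j then 12 * ℓ * a ^ 2 else 0) + 12 * ℓ * a := fun i j => by
    split_ifs with hij
    · subst hij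
      simp only [edgeInd_mul_self]
      have hpos : 0 ≤ 12 * ℓ * a := by positivity
      linarith [h.deg_le hn hp ha hℓ i]
    · rw [zero_add]
      exact h.codeg_le hn hp ha hℓ hij
  have hs0 : 0 ≤ s := (Nat.cast_nonneg _).trans hs
  calc ∑ k ∈ T, degIn ω S k ^ 2 ≤ ∑ k, degIn ω S k ^ 2 :=
        Finset.sum_le_univ_sum_of_nonneg fun k => sq_nonneg _
    _ = ∑ i ∈ S, ∑ j ∈ S, ∑ k, edgeInd ω i k * edgeInd ω j k := by
        simp only [degIn, sq, Finset.sum_mul_sum]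
        rw [Finset.sum_comm]
        exact Finset.sum_congr rfl fun i _ => Finset.sum_comm
    _ ≤ ∑ i ∈ S, ∑ j ∈ S, ((if i = j then 12 * ℓ * a ^ 2 else 0) + 12 * ℓ * a) :=
        Finset.sum_le_sum fun i _ => Finset.sum_le_sum fun j _ => hpair i j
    _ = S.card * (12 * ℓ * a ^ 2) + S.card * (S.card * (12 * ℓ * a)) := by
        simp [Finset.sum_add_distrib]
    _ ≤ s * (12 * ℓ * a ^ 2) + s * (s * (12 * ℓ * a)) := by gcongr
    _ = 12 * ℓ * s * a * (a + s) := by ring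

lemma Typical.sum_degIn_mul_degIn_le (S₁ S₂ T : Finset V) {s₁ s₂ t : ℝ} (hs₁ : 0 ≤ s₁)
    (h1 : s₁ ≤ t) (hs₂ : 0 ≤ s₂) (h2 : s₂ ≤ t) (hat : a ≤ t ^ 2) (hS₁ : S₁.card ≤ s₁ ^ 2)
    (hS₂ : S₂.card ≤ s₂ ^ 2) :
    ∑ k ∈ T, degIn ω S₁ k * degIn ω S₂ k ≤ 24 * ℓ * a * (s₁ * s₂ * t ^ 2) := by
  have hsq : ∀ (S : Finset V) (s : ℝ), 0 ≤ s → s ≤ t → (S.card : ℝ) ≤ s ^ 2 →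
      ∑ k ∈ T, degIn ω S k ^ 2 ≤ 24 * ℓ * a * (s ^ 2 * t ^ 2) := fun S s hs hst hS => by
    have hsum : a + s ^ 2 ≤ 2 * t ^ 2 := by linarith [pow_le_pow_left₀ hs hst 2]
    calc ∑ k ∈ T, degIn ω S k ^ 2 ≤ 12 * ℓ * s ^ 2 * a * (a + s ^ 2) :=
          h.sum_degIn_sq_le hn hp ha hℓ S T hS
      _ ≤ 12 * ℓ * s ^ 2 * a * (2 * t ^ 2) := by gcongr
      _ = 24 * ℓ * a * (s ^ 2 * t ^ 2) := by ring
  refine le_of_sq_le_sq ?_ (by positivity)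
  calc (∑ k ∈ T, degIn ω S₁ k * degIn ω S₂ k) ^ 2
      ≤ (∑ k ∈ T, degIn ω S₁ k ^ 2) * ∑ k ∈ T, degIn ω S₂ k ^ 2 :=
        Finset.sum_mul_sq_le_sq_mul_sq T _ _
    _ ≤ (24 * ℓ * a * (s₁ ^ 2 * t ^ 2)) * (24 * ℓ * a * (s₂ ^ 2 * t ^ 2)) :=
        mul_le_mul (hsq S₁ s₁ hs₁ h1 hS₁) (hsq S₂ s₂ hs₂ h2 hS₂)
          (Finset.sum_nonneg fun k _ => sq_nonneg _) (by positivity)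
    _ = (24 * ℓ * a * (s₁ * s₂ * t ^ 2)) ^ 2 := by ring

lemma Typical.triangleCount_le_of_le_mul {S₁ S₂ S₃ : Finset V} {s₁ s₂ s₃ : ℝ} (h1 : 1 ≤ s₁)
    (h12 : s₁ ≤ s₂) (h23 : s₂ ≤ s₃) (hcase : s₂ ≤ a * s₁) (hS₁ : S₁.card ≤ s₁ ^ 2)
    (hS₂ : S₂.card ≤ s₂ ^ 2) (hS₃ : S₃.card ≤ s₃ ^ 2) :
    triangleCount ω S₁ S₂ S₃ ≤ 3000 * ℓ ^ 2 * (s₁ * s₂ * s₃ ^ 2) := by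
  have hp0 : 0 ≤ p := (pos_of_mul_pos_left (hp ▸ one_pos) (zero_le_one.trans ha)).le
  have hs₂ := h1.trans h12
  have h13 := h12.trans h23
  set x := s₁ * s₂ * s₃ ^ 2
  have hs₃x : s₃ ^ 2 ≤ x :=
    le_mul_of_one_le_left (by positivity) (one_le_mul_of_one_le_of_one_le h1 hs₂)
  have hx : 1 ≤ x := (one_le_pow₀ (h1.trans h13)).trans hs₃x
  have hps₂ : p * s₂ ≤ s₁ := by
    calc p * s₂ ≤ p * (a * s₁) := by gcongr
      _ = s₁ := by rw [← mul_assoc, hp, one_mul]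
  have hdeg : ∀ (S : Finset V) (s : ℝ), 0 ≤ s → s ≤ s₂ → (S.card : ℝ) ≤ s ^ 2 →
      ∑ k ∈ S₃, degIn ω S k ≤ 64 * ℓ * x := fun S s hs0 hs hS => by
    refine h.sum_degIn_le hℓ hx (hS.trans ((pow_le_pow_left₀ hs0 (hs.trans h23) 2).trans hs₃x))
      (hS₃.trans hs₃x) ?_
    calc (S.card : ℝ) * S₃.card * p ≤ s₂ ^ 2 * s₃ ^ 2 * p := by
          gcongr
          exact hS.trans (pow_le_pow_left₀ hs0 hs 2)
      _ = p * s₂ * s₂ * s₃ ^ 2 := by ring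
      _ ≤ s₁ * s₂ * s₃ ^ 2 := by gcongr
  have hdeg₁ := hdeg S₁ s₁ (by positivity) h12 hS₁
  have hdeg₂ := hdeg S₂ s₂ (by positivity) le_rfl hS₂
  refine h.triangleCount_le_of_sum_degIn_le hℓ (hS₃.trans hs₃x) hdeg₁ hdeg₂ ?_
  rcases le_total (s₃ ^ 2) a with hs | hs
  · exact (mul_sum_degIn_mul_degIn_le_of_card_le hp (by positivity)
      (hS₁.trans ((pow_le_pow_left₀ (by positivity) h13 2).trans hs)) S₂ S₃).trans hdeg₂
  · calc p * ∑ k ∈ S₃, degIn ω S₁ k * degIn ω S₂ k ≤ p * (24 * ℓ * a * x) := by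
          gcongr
          exact h.sum_degIn_mul_degIn_le hn hp ha hℓ S₁ S₂ S₃ (by positivity) h13
            (by positivity) h23 hs hS₁ hS₂
      _ = 24 * ℓ * x := by linear_combination 24 * ℓ * x * hp
      _ ≤ 64 * ℓ * x := by gcongr; norm_num

variable (hω : ω ⊆ allEdges V)
include hω

lemma Typical.triangleCount_le_card_mul_card (S₁ S₂ S₃ : Finset V) :
    triangleCount ω S₁ S₂ S₃ ≤ S₁.card * S₃.card * (12 * ℓ * a) := by
  have hcodeg : ∀ i k, edgeInd ω i k * ∑ j ∈ S₂, edgeInd ω i j * edgeInd ω k j ≤ 12 * ℓ * a :=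
    fun i k => by
      have hterm : ∀ j, 0 ≤ edgeInd ω i j * edgeInd ω k j := fun j =>
        mul_nonneg (edgeInd_nonneg ω i j) (edgeInd_nonneg ω k j)
      rcases eq_or_ne i k with rfl | hik
      · rw [edgeInd_self hω, zero_mul]
        positivity
      · calc _ ≤ ∑ j ∈ S₂, edgeInd ω i j * edgeInd ω k j :=
              mul_le_of_le_one_left (Finset.sum_nonneg fun j _ => hterm j) (edgeInd_le_one ω i k)
          _ ≤ ∑ j, edgeInd ω i j * edgeInd ω k j := Finset.sum_le_univ_sum_of_nonneg hterm
          _ ≤ 12 * ℓ * a := h.codeg_le hn hp ha hℓ hik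
  calc triangleCount ω S₁ S₂ S₃
      = ∑ i ∈ S₁, ∑ k ∈ S₃, edgeInd ω i k * ∑ j ∈ S₂, edgeInd ω i j * edgeInd ω k j := by
        refine Finset.sum_congr rfl fun i _ => Finset.sum_comm.trans ?_
        simp only [Finset.mul_sum]
        refine Finset.sum_congr rfl fun k _ => Finset.sum_congr rfl fun j _ => ?_
        rw [edgeInd_comm ω j k]
        ring
    _ ≤ ∑ i ∈ S₁, ∑ k ∈ S₃, 12 * ℓ * a :=
        Finset.sum_le_sum fun i _ => Finset.sum_le_sum fun k _ => hcodeg i k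
    _ = S₁.card * S₃.card * (12 * ℓ * a) := by simp [mul_assoc]

lemma Typical.triangleCount_le {S₁ S₂ S₃ : Finset V} {s₁ s₂ s₃ : ℝ} (h1 : 1 ≤ s₁) (h12 : s₁ ≤ s₂)
    (h23 : s₂ ≤ s₃) (hS₁ : S₁.card ≤ s₁ ^ 2) (hS₂ : S₂.card ≤ s₂ ^ 2) (hS₃ : S₃.card ≤ s₃ ^ 2) :
    triangleCount ω S₁ S₂ S₃ ≤ 3000 * ℓ ^ 2 * (s₁ * s₂ * s₃ ^ 2) := by
  rcases le_total s₂ (a * s₁) with hcase | hcase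
  · exact h.triangleCount_le_of_le_mul hn hp ha hℓ h1 h12 h23 hcase hS₁ hS₂ hS₃
  have : 1 ≤ s₂ := h1.trans h12
  have hℓ2 : ℓ ≤ ℓ ^ 2 := le_self_pow₀ hℓ two_ne_zero
  calc triangleCount ω S₁ S₂ S₃ ≤ S₁.card * S₃.card * (12 * ℓ * a) :=
        h.triangleCount_le_card_mul_card hn hp ha hℓ hω S₁ S₂ S₃
    _ ≤ s₁ ^ 2 * s₃ ^ 2 * (12 * ℓ * a) := by gcongr
    _ = 12 * ℓ * (s₁ * (a * s₁) * s₃ ^ 2) := by ring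
    _ ≤ 3000 * ℓ ^ 2 * (s₁ * s₂ * s₃ ^ 2) := by gcongr; norm_num

end Triangles

section SphereNorm

lemma exists_sorted_of_card_eq_four {V : Type*} [DecidableEq V] (lev : V → ℕ) {s : Finset V}
    (hs : s.card = 4) :
    ∃ i j k l, s = {i, j, k, l} ∧ lev i ≤ lev j ∧ lev j ≤ lev k ∧ lev k ≤ lev l := by
  obtain ⟨i, hi, hi_min⟩ := s.exists_min_image lev (Finset.card_pos.1 (by lia))
  have hci := Finset.card_erase_of_mem hi
  obtain ⟨j, hj, hj_min⟩ := (s.erase i).exists_min_image lev (Finset.card_pos.1 (by lia))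
  have hcj := Finset.card_erase_of_mem hj
  obtain ⟨k, hk, hk_min⟩ :=
    ((s.erase i).erase j).exists_min_image lev (Finset.card_pos.1 (by lia))
  have hck := Finset.card_erase_of_mem hk
  obtain ⟨l, hl⟩ := Finset.card_eq_one.1 (show (((s.erase i).erase j).erase k).card = 1 by lia)
  have hl_mem : l ∈ ((s.erase i).erase j).erase k := hl ▸ Finset.mem_singleton_self l
  refine ⟨i, j, k, l, ?_, hi_min j (Finset.mem_of_mem_erase hj),
    hj_min k (Finset.mem_of_mem_erase hk), hk_min l (Finset.mem_of_mem_erase hl_mem)⟩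
  rw [← Finset.insert_erase hi, ← Finset.insert_erase hj, ← Finset.insert_erase hk, hl]

lemma sixProd_edgeInd_nonneg {V : Type*} [DecidableEq V] (ω : Finset (Sym2 V))
    (i j k l : V) : 0 ≤ sixProd (edgeInd ω) i j k l := by
  have hg := edgeInd_nonneg ω
  have := hg i j; have := hg i k; have := hg i l
  have := hg j k; have := hg j l; have := hg k l
  unfold sixProd
  positivity

variable {V : Type*} [Fintype V]

lemma exists_dyadic_levels {x : V → ℝ} (hx : ∑ i, x i ^ 2 = 1) {m : ℕ}
    (hm : Fintype.card V ≤ 4 ^ m) :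
    ∃ lev : V → ℕ, (∀ i, lev i ≤ m) ∧ (∀ i, |x i| ≤ (1 / 2) ^ lev i) ∧
      ∀ h, ((Finset.univ.filter fun i => lev i = h).card : ℝ) ≤ (2 ^ (h + 1)) ^ 2 := by
  have hx1 : ∀ i, |x i| ≤ 1 := fun i => by
    rw [← sq_le_one_iff_abs_le_one, ← hx]
    exact Finset.single_le_sum (f := fun i => x i ^ 2) (fun j _ => sq_nonneg _)
      (Finset.mem_univ i)
  refine ⟨fun i => Nat.findGreatest (fun h => |x i| ≤ (1 / 2) ^ h) m,
    fun i => Nat.findGreatest_le _, fun i => ?_, fun h => ?_⟩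
  · exact Nat.findGreatest_spec (P := fun h => |x i| ≤ (1 / 2) ^ h) (Nat.zero_le m)
      (by simpa using hx1 i)
  set S := Finset.univ.filter fun i => Nat.findGreatest (fun h => |x i| ≤ (1 / 2) ^ h) m = h
  have hpow : ((2 : ℝ) ^ (h + 1)) ^ 2 = 4 ^ (h + 1) := by
    rw [← pow_mul, mul_comm, pow_mul]; norm_num
  rw [hpow]
  rcases lt_or_ge h m with hhm | hmh
  · have hbig : ∀ i ∈ S, ((1 : ℝ) / 4) ^ (h + 1) ≤ x i ^ 2 := by
      intro i hi
      have hgt : ¬ |x i| ≤ (1 / 2) ^ (h + 1) :=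
        Nat.findGreatest_is_greatest (P := fun h => |x i| ≤ (1 / 2) ^ h) (n := m)
          (by rw [(Finset.mem_filter.1 hi).2]; exact Nat.lt_succ_self h) hhm
      rw [← sq_abs, show (1 : ℝ) / 4 = (1 / 2) ^ 2 by norm_num, ← pow_mul, mul_comm, pow_mul]
      exact pow_le_pow_left₀ (by positivity) (not_le.1 hgt).le 2
    have hmass : (S.card : ℝ) * (1 / 4) ^ (h + 1) ≤ 1 := by
      rw [← nsmul_eq_mul]
      exact ((Finset.card_nsmul_le_sum S _ _ hbig).trans
        (Finset.sum_le_univ_sum_of_nonneg fun i => sq_nonneg _)).trans hx.le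
    rwa [one_div, inv_pow, ← div_eq_mul_inv, div_le_one (by positivity)] at hmass
  · exact_mod_cast (Finset.card_le_univ S).trans
      (hm.trans (Nat.pow_le_pow_right (by norm_num) (by lia)))

/-- Triples of vertices with nondecreasing levels. -/
def sortedTriples (lev : V → ℕ) : Finset (V × V × V) :=
  Finset.univ.filter fun q => lev q.1 ≤ lev q.2.1 ∧ lev q.2.1 ≤ lev q.2.2

variable [DecidableEq V] {ω : Finset (Sym2 V)}

lemma prod_eq_and_sixProd_eq_one_of_isNClique (hω : ω ⊆ allEdges V) {i j k l : V}
    (hc : (edgeGraph ω).IsNClique 4 {i, j, k, l}) (w : V → ℝ) :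
    ∏ v ∈ {i, j, k, l}, w v = w i * w j * w k * w l ∧ sixProd (edgeInd ω) i j k l = 1 := by
  obtain ⟨hij, hik, hil, hjk, hjl, hkl⟩ := isNClique_four_iff.1 hc
  constructor
  · rw [Finset.prod_insert (by simp [hij.ne, hik.ne, hil.ne]),
      Finset.prod_insert (by simp [hjk.ne, hjl.ne]), Finset.prod_insert (by simp [hkl.ne]),
      Finset.prod_singleton, mul_assoc, mul_assoc]
  · rw [edgeGraph_adj hω] at hij hik hil hjk hjl hkl
    simp only [sixProd, edgeInd, hij, hik, hil, hjk, hjl, hkl, if_true, mul_one]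

open scoped Classical in
-- Each clique is counted through its ordering by level; the weight of the last vertex is at most
-- the weight of the third.
lemma sum_cliqueFinset_prod_le (hω : ω ⊆ allEdges V) (lev : V → ℕ) :
    ∑ s ∈ (edgeGraph ω).cliqueFinset 4, ∏ i ∈ s, ((1 : ℝ) / 2) ^ lev i
      ≤ ∑ q ∈ sortedTriples lev, (1 / 2) ^ lev q.1 * (1 / 2) ^ lev q.2.1 * ((1 / 2) ^ lev q.2.2) ^ 2
        * ∑ l, sixProd (edgeInd ω) q.1 q.2.1 q.2.2 l := by
  set w : V → ℝ := fun i => (1 / 2) ^ lev i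
  set F : (V × V × V) × V → ℝ := fun q => w q.1.1 * w q.1.2.1 * w q.1.2.2 ^ 2
    * sixProd (edgeInd ω) q.1.1 q.1.2.1 q.1.2.2 q.2
  have hF0 : ∀ q, 0 ≤ F q := fun q => mul_nonneg (by positivity) (sixProd_edgeInd_nonneg _ _ _ _ _)
  have hterm : ∀ s ∈ (edgeGraph ω).cliqueFinset 4, ∏ i ∈ s, w i
      ≤ ∑ q ∈ sortedTriples lev ×ˢ Finset.univ with {q.1.1, q.1.2.1, q.1.2.2, q.2} = s, F q := by
    intro s hs
    have hc := SimpleGraph.mem_cliqueFinset_iff.1 hs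
    obtain ⟨i, j, k, l, rfl, hij, hjk, hkl⟩ := exists_sorted_of_card_eq_four lev hc.card_eq
    obtain ⟨hprod, hsix⟩ := prod_eq_and_sixProd_eq_one_of_isNClique hω hc w
    have hmem : ((i, j, k), l) ∈ (sortedTriples lev ×ˢ Finset.univ).filter
        fun q : (V × V × V) × V => ({q.1.1, q.1.2.1, q.1.2.2, q.2} : Finset V) = {i, j, k, l} := by
      simp [sortedTriples, hij, hjk]
    refine le_trans ?_ (Finset.single_le_sum (fun q _ => hF0 q) hmem)
    have hwl : w l ≤ w k := pow_le_pow_of_le_one (by norm_num) (by norm_num) hkl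
    calc ∏ v ∈ {i, j, k, l}, w v = w i * w j * w k * w l := hprod
      _ ≤ w i * w j * w k * w k := by gcongr
      _ = F ((i, j, k), l) := by simp only [F, hsix]; ring
  calc _ ≤ _ := Finset.sum_le_sum hterm
    _ ≤ ∑ q ∈ sortedTriples lev ×ˢ Finset.univ, F q :=
        Finset.sum_fiberwise_le_sum_of_sum_fiber_nonneg fun s _ =>
          Finset.sum_nonneg fun q _ => hF0 q
    _ = _ := by simp only [Finset.sum_product, Finset.mul_sum, F, w]

variable {p a ℓ : ℝ}

lemma Typical.sum_sixProd_le (h : Typical ω p ℓ) (hω : ω ⊆ allEdges V)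
    (hn : (Fintype.card V : ℝ) = a ^ 3) (hp : p * a = 1) (hℓ : 1 ≤ ℓ) (i j k : V) :
    ∑ l, sixProd (edgeInd ω) i j k l
      ≤ 12 * ℓ * (edgeInd ω i j * edgeInd ω i k * edgeInd ω j k) := by
  have hsum : ∑ l, sixProd (edgeInd ω) i j k l = edgeInd ω i j * edgeInd ω i k * edgeInd ω j k
      * ∑ l, edgeInd ω i l * edgeInd ω j l * edgeInd ω k l := by
    rw [Finset.mul_sum]
    exact Finset.sum_congr rfl fun l _ => by unfold sixProd; ring
  rw [hsum, mul_comm (12 * ℓ)]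
  by_cases hijk : i ≠ j ∧ i ≠ k ∧ j ≠ k
  · have hg := edgeInd_nonneg ω
    exact mul_le_mul_of_nonneg_left (h.codeg_three_le hn hp hℓ hijk.1 hijk.2.1 hijk.2.2)
      (mul_nonneg (mul_nonneg (hg i j) (hg i k)) (hg j k))
  · have htri : edgeInd ω i j * edgeInd ω i k * edgeInd ω j k = 0 := by
      have heq : i = j ∨ i = k ∨ j = k := by tauto
      rcases heq with rfl | rfl | rfl <;> simp [edgeInd_self hω]
    rw [htri, zero_mul, zero_mul]

lemma Typical.sum_level_triangles_le (h : Typical ω p ℓ) (hω : ω ⊆ allEdges V)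
    (hn : (Fintype.card V : ℝ) = a ^ 3) (hp : p * a = 1) (ha : 1 ≤ a) (hℓ : 1 ≤ ℓ)
    {lev : V → ℕ} (hlev : ∀ h, ((Finset.univ.filter fun i => lev i = h).card : ℝ)
      ≤ (2 ^ (h + 1)) ^ 2) (t : ℕ × ℕ × ℕ) :
    ∑ q ∈ sortedTriples lev with (lev q.1, lev q.2.1, lev q.2.2) = t,
      (1 / 2) ^ lev q.1 * (1 / 2) ^ lev q.2.1 * ((1 / 2) ^ lev q.2.2) ^ 2
        * (edgeInd ω q.1 q.2.1 * edgeInd ω q.1 q.2.2 * edgeInd ω q.2.1 q.2.2)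
      ≤ 48000 * ℓ ^ 2 := by
  obtain ⟨r, s, t⟩ := t
  set S : ℕ → Finset V := fun h => Finset.univ.filter fun i => lev i = h
  have hS : ∀ {h i}, i ∈ S h ↔ lev i = h := by simp [S]
  have hg := edgeInd_nonneg ω
  have htri0 : ∀ i j k, 0 ≤ edgeInd ω i j * edgeInd ω i k * edgeInd ω j k := fun i j k =>
    mul_nonneg (mul_nonneg (hg i j) (hg i k)) (hg j k)
  rcases ((sortedTriples lev).filter
    fun q => (lev q.1, lev q.2.1, lev q.2.2) = (r, s, t)).eq_empty_or_nonempty with hempty | hne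
  · rw [hempty, Finset.sum_empty]
    positivity
  obtain ⟨hrs, hst⟩ : r ≤ s ∧ s ≤ t := by
    obtain ⟨q, hq⟩ := hne
    simp only [sortedTriples, Finset.mem_filter, Prod.mk.injEq] at hq
    lia
  have hcancel : ∀ h : ℕ, ((1 : ℝ) / 2) ^ h * 2 ^ (h + 1) = 2 := fun h => by
    rw [pow_succ, ← mul_assoc, ← mul_pow]; norm_num
  calc _ ≤ ∑ q ∈ S r ×ˢ S s ×ˢ S t, (1 / 2) ^ r * (1 / 2) ^ s * ((1 / 2) ^ t) ^ 2
        * (edgeInd ω q.1 q.2.1 * edgeInd ω q.1 q.2.2 * edgeInd ω q.2.1 q.2.2) := by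
        refine (Finset.sum_congr rfl fun q hq => ?_).trans_le
          (Finset.sum_le_sum_of_subset_of_nonneg (fun q hq => ?_) fun q _ _ =>
            mul_nonneg (by positivity) (htri0 _ _ _))
        all_goals
          simp only [Finset.mem_filter, Prod.mk.injEq] at hq
          obtain ⟨-, rfl, rfl, rfl⟩ := hq
        · rfl
        · simp only [Finset.mem_product, hS, and_self]
    _ = (1 / 2) ^ r * (1 / 2) ^ s * ((1 / 2) ^ t) ^ 2 * triangleCount ω (S r) (S s) (S t) := by
        simp only [triangleCount, Finset.sum_product, Finset.mul_sum]
    _ ≤ (1 / 2) ^ r * (1 / 2) ^ s * ((1 / 2) ^ t) ^ 2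
        * (3000 * ℓ ^ 2 * (2 ^ (r + 1) * 2 ^ (s + 1) * (2 ^ (t + 1)) ^ 2)) := by
        gcongr
        exact h.triangleCount_le hn hp ha hℓ hω (one_le_pow₀ one_le_two)
          (pow_le_pow_right₀ one_le_two (Nat.succ_le_succ hrs))
          (pow_le_pow_right₀ one_le_two (Nat.succ_le_succ hst)) (hlev r) (hlev s) (hlev t)
    _ = 3000 * ℓ ^ 2 * (((1 / 2) ^ r * 2 ^ (r + 1)) * ((1 / 2) ^ s * 2 ^ (s + 1))
          * ((1 / 2) ^ t * 2 ^ (t + 1)) ^ 2) := by ring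
    _ = 48000 * ℓ ^ 2 := by rw [hcancel, hcancel, hcancel]; ring

lemma Typical.sum_sortedTriples_le (h : Typical ω p ℓ) (hω : ω ⊆ allEdges V)
    (hn : (Fintype.card V : ℝ) = a ^ 3) (hp : p * a = 1) (ha : 1 ≤ a) (hℓ : 1 ≤ ℓ)
    {lev : V → ℕ} (hlev : ∀ h, ((Finset.univ.filter fun i => lev i = h).card : ℝ)
      ≤ (2 ^ (h + 1)) ^ 2) {m : ℕ} (hm : ∀ i, lev i ≤ m) :
    ∑ q ∈ sortedTriples lev, (1 / 2) ^ lev q.1 * (1 / 2) ^ lev q.2.1 * ((1 / 2) ^ lev q.2.2) ^ 2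
        * (edgeInd ω q.1 q.2.1 * edgeInd ω q.1 q.2.2 * edgeInd ω q.2.1 q.2.2)
      ≤ 48000 * ℓ ^ 2 * (m + 1) ^ 3 := by
  have hrange : ∀ i, lev i ∈ Finset.range (m + 1) := fun i => Finset.mem_range_succ_iff.2 (hm i)
  rw [← Finset.sum_fiberwise_of_maps_to (g := fun q => (lev q.1, lev q.2.1, lev q.2.2))
    (t := Finset.range (m + 1) ×ˢ Finset.range (m + 1) ×ˢ Finset.range (m + 1))
    fun q _ => by simp only [Finset.mem_product, hrange, and_self]]
  refine (Finset.sum_le_card_nsmul _ _ _ fun t _ =>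
    h.sum_level_triangles_le hω hn hp ha hℓ hlev t).trans_eq ?_
  simp only [Finset.card_product, Finset.card_range, nsmul_eq_mul]
  push_cast
  ring

end SphereNorm

section SphereNormCliquePoly

variable {n : ℕ} {ω : Finset (Sym2 (Fin n))} {p a ℓ : ℝ}

open scoped Classical in
lemma abs_eval_cliquePoly_le_sum (G : SimpleGraph (Fin n)) {x y : Fin n → ℝ}
    (hxy : ∀ i, |x i| ≤ y i) :
    |eval x (cliquePoly G)| ≤ ∑ s ∈ G.cliqueFinset 4, ∏ i ∈ s, y i := by
  simp only [cliquePoly, map_sum, map_prod, eval_X]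
  refine (Finset.abs_sum_le_sum_abs _ _).trans (Finset.sum_le_sum fun s _ => ?_)
  rw [Finset.abs_prod]
  exact Finset.prod_le_prod (fun i _ => abs_nonneg _) fun i _ => hxy i

lemma Typical.abs_eval_cliquePoly_le (h : Typical ω p ℓ) (hω : ω ⊆ allEdges (Fin n))
    (hn : (n : ℝ) = a ^ 3) (hp : p * a = 1) (ha : 1 ≤ a) (hℓ : 1 ≤ ℓ) {m : ℕ} (hm : n ≤ 4 ^ m)
    {x : Fin n → ℝ} (hx : ∑ i, x i ^ 2 = 1) :
    |eval x (cliquePoly (edgeGraph ω))| ≤ 576000 * ℓ ^ 3 * (m + 1) ^ 3 := by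
  have hV : (Fintype.card (Fin n) : ℝ) = a ^ 3 := by rw [Fintype.card_fin, hn]
  obtain ⟨lev, hlev_le, hxlev, hcard⟩ := exists_dyadic_levels hx (m := m) (by simpa using hm)
  calc |eval x (cliquePoly (edgeGraph ω))|
      ≤ _ := abs_eval_cliquePoly_le_sum _ hxlev
    _ ≤ _ := sum_cliqueFinset_prod_le hω lev
    _ ≤ ∑ q ∈ sortedTriples lev,
          (1 / 2) ^ lev q.1 * (1 / 2) ^ lev q.2.1 * ((1 / 2) ^ lev q.2.2) ^ 2
          * (12 * ℓ * (edgeInd ω q.1 q.2.1 * edgeInd ω q.1 q.2.2 * edgeInd ω q.2.1 q.2.2)) := by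
        gcongr with q
        exact h.sum_sixProd_le hω hV hp hℓ _ _ _
    _ = 12 * ℓ * _ := by
        rw [Finset.mul_sum]
        exact Finset.sum_congr rfl fun q _ => mul_left_comm _ _ _
    _ ≤ 12 * ℓ * (48000 * ℓ ^ 2 * (m + 1) ^ 3) := by
        gcongr
        exact h.sum_sortedTriples_le hω hV hp ha hℓ hcard hlev_le
    _ = 576000 * ℓ ^ 3 * (m + 1) ^ 3 := by ring

lemma le_four_pow_ceil_log (n : ℕ) : n ≤ 4 ^ ⌈Real.log n⌉₊ := by
  rcases n.eq_zero_or_pos with rfl | hn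
  · exact Nat.zero_le _
  have hle : (n : ℝ) ≤ 4 ^ ⌈Real.log n⌉₊ := by
    calc (n : ℝ) = Real.exp (Real.log n) := (Real.exp_log (by exact_mod_cast hn)).symm
      _ ≤ Real.exp (⌈Real.log n⌉₊ * 1) := by
          rw [mul_one]
          exact Real.exp_le_exp.2 (Nat.le_ceil _)
      _ = Real.exp 1 ^ ⌈Real.log n⌉₊ := Real.exp_nat_mul _ _
      _ ≤ 4 ^ ⌈Real.log n⌉₊ := by
          gcongr
          exact Real.exp_one_lt_d9.le.trans (by norm_num)
  exact_mod_cast hle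

lemma Typical.sphereNorm_cliquePoly_le (h : Typical ω p (Real.log n)) (hω : ω ⊆ allEdges (Fin n))
    (hn : (n : ℝ) = a ^ 3) (hp : p * a = 1) (ha : 1 ≤ a) (hℓ : 3 ≤ Real.log n) :
    sphereNorm (cliquePoly (edgeGraph ω)) ≤ Real.log n ^ 22 := by
  set ℓ := Real.log n
  have hceil : (⌈ℓ⌉₊ : ℝ) + 1 ≤ 3 * ℓ := by
    linarith [Nat.ceil_lt_add_one (by linarith : 0 ≤ ℓ)]
  refine Real.sSup_le ?_ (by positivity)
  rintro r ⟨x, hx, rfl⟩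
  calc |eval x (cliquePoly (edgeGraph ω))|
      ≤ 576000 * ℓ ^ 3 * ((⌈ℓ⌉₊ : ℝ) + 1) ^ 3 :=
        h.abs_eval_cliquePoly_le hω hn hp ha (by linarith) (le_four_pow_ceil_log n) hx
    _ ≤ 576000 * ℓ ^ 3 * (3 * ℓ) ^ 3 := by gcongr
    _ = 15552000 * ℓ ^ 6 := by ring
    _ ≤ 3 ^ 16 * ℓ ^ 6 := by gcongr; norm_num
    _ ≤ ℓ ^ 16 * ℓ ^ 6 := by gcongr
    _ = ℓ ^ 22 := by ring

end SphereNormCliquePoly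

section SosLowerBound

variable {V : Type*} [Fintype V]

lemma exists_pairwise_disjoint_card_eq {k m : ℕ} (hm : k * m ≤ Fintype.card V) :
    ∃ U : Fin k → Finset V, Pairwise (fun b c => Disjoint (U b) (U c)) ∧ ∀ b, (U b).card = m := by
  obtain ⟨f⟩ : Nonempty (Fin k × Fin m ↪ V) :=
    Function.Embedding.nonempty_of_card_le (by simpa using hm)
  refine ⟨fun b => Finset.univ.map ((Function.Embedding.sectR b (Fin m)).trans f),
    fun b c hbc => ?_, fun b => by simp⟩
  refine Finset.disjoint_left.2 fun i hb hc => ?_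
  obtain ⟨t, -, rfl⟩ := Finset.mem_map.1 hb
  obtain ⟨u, -, hu⟩ := Finset.mem_map.1 hc
  exact hbc (congrArg Prod.fst (f.injective hu)).symm

variable [DecidableEq V] {p : unitInterval} {a ℓ : ℝ}

lemma Typical.sum_abs_edgeDev_le {ω : Finset (Sym2 V)} (h : Typical ω p ℓ)
    (hn : (Fintype.card V : ℝ) = a ^ 3) (hp : p * a = 1) (ha : 1 ≤ a) (hℓ : 1 ≤ ℓ)
    (A B : Finset V) : ∑ i ∈ A, ∑ j ∈ B, |edgeDev p ω i j| ≤ 13 * ℓ * a ^ 5 := by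
  have hrow : ∀ i, ∑ j ∈ B, |edgeDev p ω i j| ≤ 13 * ℓ * a ^ 2 := by
    intro i
    calc ∑ j ∈ B, |edgeDev p ω i j| ≤ ∑ j, |edgeDev p ω i j| :=
          Finset.sum_le_univ_sum_of_nonneg fun j => abs_nonneg _
      _ ≤ ∑ j, (edgeInd ω i j + p) := Finset.sum_le_sum fun j _ => abs_edgeDev_le p ω i j
      _ = ∑ j, edgeInd ω i j + a ^ 2 := by
          rw [Finset.sum_add_distrib, Finset.sum_const, Finset.card_univ, nsmul_eq_mul, hn]
          linear_combination a ^ 2 * hp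
      _ ≤ 12 * ℓ * a ^ 2 + ℓ * a ^ 2 :=
          add_le_add (h.deg_le hn hp ha hℓ i) (le_mul_of_one_le_left (sq_nonneg a) hℓ)
      _ = 13 * ℓ * a ^ 2 := by ring
  calc ∑ i ∈ A, ∑ j ∈ B, |edgeDev p ω i j| ≤ ∑ i, ∑ j ∈ B, |edgeDev p ω i j| :=
        Finset.sum_le_univ_sum_of_nonneg fun i => Finset.sum_nonneg fun j _ => abs_nonneg _
    _ ≤ ∑ _i : V, 13 * ℓ * a ^ 2 := Finset.sum_le_sum fun i _ => hrow i
    _ = 13 * ℓ * a ^ 5 := by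
        rw [Finset.sum_const, Finset.card_univ, nsmul_eq_mul, hn]
        ring

lemma bernoulliProb_exists_perm_not_cliqueFormBounded_le (hn : (Fintype.card V : ℝ) = a ^ 3)
    (hp : p * a = 1) (ha : 1 ≤ a) (hℓ : 1 ≤ Real.log (Fintype.card V)) {U : Fin 4 → Finset V}
    (hU : Pairwise fun b c => Disjoint (U b) (U c)) :
    bernoulliProb (allEdges V) p (fun ω => ∃ e ∈ (Finset.univ : Finset (Equiv.Perm (Fin 4))),
      Typical ω p (Real.log (Fintype.card V)) ∧ ¬ CliqueFormBounded p ω (U (e 0)) (U (e 1))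
        (U (e 2)) (U (e 3)) (3000 * Real.log (Fintype.card V) ^ 2 * √a))
      ≤ 648 / (Fintype.card V : ℝ) ^ 8 := by
  have hdisj : ∀ (e : Equiv.Perm (Fin 4)) {b c : Fin 4}, b ≠ c → Disjoint (U (e b)) (U (e c)) :=
    fun e _ _ hbc => hU (e.injective.ne hbc)
  refine (bernoulliProb_exists_le _ _).trans ((Finset.sum_le_sum fun e _ =>
    bernoulliProb_not_cliqueFormBounded_le hn hp ha hℓ (hdisj e (by decide)) (hdisj e (by decide))
      (hdisj e (by decide)) (hdisj e (by decide)) (hdisj e (by decide))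
      (hdisj e (by decide))).trans_eq ?_)
  rw [Finset.sum_const, Finset.card_univ, Fintype.card_perm, Fintype.card_fin, nsmul_eq_mul,
    ← mul_div_assoc]
  norm_num [Nat.factorial]

lemma second_moment_error_le {m p a : ℝ} (hp : p * a = 1) (ha : 1 ≤ a) (hm : a ^ 3 / 8 ≤ m) :
    24 / (m ^ 2 * p) + 16 / (m ^ 3 * p ^ 3) + 4 / (m ^ 4 * p ^ 6) ≤ 26112 / a ^ 5 := by
  have : 0 < a := one_pos.trans_le ha
  obtain rfl : p = 1 / a := eq_one_div_of_mul_eq_one_left hp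
  calc 24 / (m ^ 2 * (1 / a)) + 16 / (m ^ 3 * (1 / a) ^ 3) + 4 / (m ^ 4 * (1 / a) ^ 6)
      ≤ 24 / ((a ^ 3 / 8) ^ 2 * (1 / a)) + 16 / ((a ^ 3 / 8) ^ 3 * (1 / a) ^ 3)
        + 4 / ((a ^ 3 / 8) ^ 4 * (1 / a) ^ 6) := by gcongr
    _ = 1536 / a ^ 5 + 24576 / a ^ 6 := by field_simp; ring
    _ ≤ 1536 / a ^ 5 + 24576 / a ^ 5 := by gcongr; norm_num
    _ = 26112 / a ^ 5 := by ring

lemma failure_probability_le {x a : ℝ} (hx : x = a ^ 3) (ha : 2000 ≤ a) :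
    10 / x ^ 3 + (648 / x ^ 8 + 26112 / a ^ 5) ≤ 1 / x := by
  have ha1 : 1 ≤ a := by linarith
  subst hx
  calc 10 / (a ^ 3) ^ 3 + (648 / (a ^ 3) ^ 8 + 26112 / a ^ 5)
      ≤ 10 / a ^ 5 + (648 / a ^ 5 + 26112 / a ^ 5) := by
        rw [← pow_mul, ← pow_mul]
        gcongr <;> norm_num
    _ = 26770 / a ^ 2 / a ^ 3 := by field_simp; norm_num
    _ ≤ 1 / a ^ 3 := by
        gcongr
        rw [div_le_one (by positivity)]
        nlinarith

end SosLowerBound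

section SosLowerBoundCliquePoly

variable {n : ℕ} {p : unitInterval} {a ℓ : ℝ}

lemma one_sub_pow_mul_lower_bound {m x y a ℓ : ℝ} (hy : y * a = 1) (ha : 2 ≤ a) (hℓ : 1 ≤ ℓ)
    (hm : a ^ 3 / 8 ≤ m) (hx : m ^ 4 * y ^ 6 / 2 ≤ x) :
    1 / 10 ^ 12 * √a / ℓ ^ 22 * (96 * (3000 * ℓ ^ 2 * √a / 4) * (13 * ℓ * a ^ 5))
      ≤ (1 - y) ^ 6 * x := by
  have ha0 : 0 < a := by linarith
  have hy0 : 0 ≤ y := (pos_of_mul_pos_left (hy ▸ one_pos) ha0.le).le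
  have hx' : a ^ 6 / 8192 ≤ x := by
    have hya : y ^ 6 * a ^ 6 = 1 := by rw [← mul_pow, hy, one_pow]
    calc a ^ 6 / 8192 = (a ^ 3 / 8) ^ 4 * y ^ 6 / 2 := by
          linear_combination (-(a ^ 6 / 8192)) * hya
      _ ≤ m ^ 4 * y ^ 6 / 2 := by gcongr
      _ ≤ x := hx
  have hy2 : (1 / 2 : ℝ) ^ 6 ≤ (1 - y) ^ 6 := by
    gcongr
    nlinarith
  calc 1 / 10 ^ 12 * √a / ℓ ^ 22 * (96 * (3000 * ℓ ^ 2 * √a / 4) * (13 * ℓ * a ^ 5))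
      = 936000 / 10 ^ 12 * (√a * √a) * a ^ 5 / ℓ ^ 19 := by field_simp; ring
    _ = 936000 / 10 ^ 12 * a ^ 6 / ℓ ^ 19 := by rw [Real.mul_self_sqrt ha0.le]; ring
    _ ≤ 936000 / 10 ^ 12 * a ^ 6 := div_le_self (by positivity) (one_le_pow₀ hℓ)
    _ ≤ (1 / 2) ^ 6 * (a ^ 6 / 8192) := by linarith [pow_pos ha0 6]
    _ ≤ (1 - y) ^ 6 * x := mul_le_mul hy2 hx' (by positivity) (by positivity)

-- The pseudo-expectation gives the clique polynomial a value of order `a ^ 6` and the fourth power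
-- of the norm a value of order `√a * a ^ 5` up to logarithms; their ratio is of order `√a`.
lemma Typical.le_sosValue_cliquePoly {ω : Finset (Sym2 (Fin n))} (h : Typical ω p ℓ)
    (hω : ω ⊆ allEdges (Fin n)) (hn : (n : ℝ) = a ^ 3) (hp : p * a = 1) (ha : 2 ≤ a) (hℓ : 1 ≤ ℓ)
    {U : Fin 4 → Finset (Fin n)} (hU : Pairwise fun b c => Disjoint (U b) (U c)) {m : ℝ}
    (hm : a ^ 3 / 8 ≤ m)
    (hform : ∀ e : Equiv.Perm (Fin 4), CliqueFormBounded p ω (U (e 0)) (U (e 1)) (U (e 2)) (U (e 3))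
      (3000 * ℓ ^ 2 * √a))
    (hcount : m ^ 4 * (p : ℝ) ^ 6 / 2 ≤ cliqueCount ω (U 0) (U 1) (U 2) (U 3)) :
    1 / 10 ^ 12 * √a / ℓ ^ 22 ≤ sosValue 2 (cliquePoly (edgeGraph ω)) := by
  have h01 : Disjoint (U 0) (U 1) := hU (by decide)
  have h02 : Disjoint (U 0) (U 2) := hU (by decide)
  have h12 : Disjoint (U 1) (U 2) := hU (by decide)
  have h03 : Disjoint (U 0) (U 3) := hU (by decide)
  have h13 : Disjoint (U 1) (U 3) := hU (by decide)
  have h23 : Disjoint (U 2) (U 3) := hU (by decide)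
  have h0123 : CliqueFormBounded p ω (U 0) (U 1) (U 2) (U 3) (3000 * ℓ ^ 2 * √a) := hform 1
  have h0213 : CliqueFormBounded p ω (U 0) (U 2) (U 1) (U 3) (3000 * ℓ ^ 2 * √a) := by
    simpa [Equiv.swap_apply_def] using hform (Equiv.swap 1 2)
  have h0312 : CliqueFormBounded p ω (U 0) (U 3) (U 1) (U 2) (3000 * ℓ ^ 2 * √a) := by
    simpa [Equiv.swap_apply_def] using hform ((Equiv.swap 2 3).trans (Equiv.swap 1 3))
  have hmass := h.sum_abs_edgeDev_le (by simpa using hn) hp (by linarith) hℓ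
  refine le_sosValue (T := 96 * (3000 * ℓ ^ 2 * √a / 4) * (13 * ℓ * a ^ 5))
    (pseudoExp (edgeDev p ω) (U 0) (U 1) (U 2) (U 3) (3000 * ℓ ^ 2 * √a / 4))
    (fun q hq => pseudoExp_mul_self_nonneg (by positivity) h0123 h0213 h0312 hq)
    (exists_isMatrixRep_cliquePoly _) (by positivity) (by positivity) ?_ ?_
  · rw [sq (normSqPoly _)]
    exact pseudoExp_normSqPoly_le (by positivity) h01 h02 h12 h03 h13 h23 hmass
  · rw [pseudoExp_cliquePoly p hω h01 h02 h12 h03 h13 h23]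
    exact one_sub_pow_mul_lower_bound hp ha hℓ hm hcount

lemma one_sub_le_bernoulliProb_le_sosValue (hn : (n : ℝ) = a ^ 3) (hp : p * a = 1) (ha : 2000 ≤ a)
    (hℓ : 1 ≤ Real.log n) :
    1 - 1 / (n : ℝ) ≤ bernoulliProb (allEdges (Fin n)) p fun ω =>
      1 / 10 ^ 12 * √a / Real.log n ^ 22 ≤ sosValue 2 (cliquePoly (edgeGraph ω)) := by
  have ha1 : 1 ≤ a := by linarith
  have hn8 : 8 ≤ n := by
    have hcube : (8 : ℝ) ≤ n := hn ▸ (by norm_num : (8 : ℝ) ≤ 2 ^ 3).trans (by gcongr; linarith)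
    exact_mod_cast hcube
  have hm : a ^ 3 / 8 ≤ (n / 4 : ℕ) := by
    have hfloor : (n : ℝ) ≤ 8 * (n / 4 : ℕ) := by exact_mod_cast (by lia : n ≤ 8 * (n / 4))
    linarith
  obtain ⟨U, hU, hcard⟩ := exists_pairwise_disjoint_card_eq (V := Fin n) (k := 4) (m := n / 4)
    (by rw [Fintype.card_fin]; lia)
  have hcardV : Fintype.card (Fin n) = n := Fintype.card_fin n
  have hp0 : 0 < (p : ℝ) := pos_of_mul_pos_left (hp ▸ one_pos) (zero_le_one.trans ha1)
  have htyp := bernoulliProb_not_typical_le (V := Fin n) (p := p) (by lia)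
  have hform := bernoulliProb_exists_perm_not_cliqueFormBounded_le (V := Fin n) (p := p)
    (by rwa [hcardV]) hp ha1 (by rwa [hcardV]) hU
  have hcount := (bernoulliProb_cliqueCount_lt_le hU hcard hp0 (by lia)).trans
    (second_moment_error_le hp ha1 hm)
  rw [hcardV] at htyp hform
  rw [sub_le_comm, ← bernoulliProb_not]
  refine le_trans (bernoulliProb_mono fun ω hω hlt => ?_)
    ((bernoulliProb_or_le _ _).trans ((add_le_add htyp ((bernoulliProb_or_le _ _).trans
      (add_le_add hform hcount))).trans (failure_probability_le hn ha)))
  by_contra! hgood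
  exact hlt (hgood.1.le_sosValue_cliquePoly hω hn hp (by linarith) hℓ hU hm
    (fun e => hgood.2.1 e (Finset.mem_univ e) hgood.1) hgood.2.2)

lemma one_sub_le_bernoulliProb_sphereNorm_le (hn : (n : ℝ) = a ^ 3) (hp : p * a = 1) (ha : 1 ≤ a)
    (hn4 : 4 ≤ n) (hℓ : 3 ≤ Real.log n) :
    1 - 1 / (n : ℝ) ≤ bernoulliProb (allEdges (Fin n)) p fun ω =>
      sphereNorm (cliquePoly (edgeGraph ω)) ≤ Real.log n ^ 22 := by
  have hnR : (4 : ℝ) ≤ n := by exact_mod_cast hn4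
  have htyp := bernoulliProb_not_typical_le (V := Fin n) (p := p) (by rw [Fintype.card_fin]; lia)
  rw [Fintype.card_fin] at htyp
  rw [sub_le_comm, ← bernoulliProb_not]
  refine (bernoulliProb_mono fun ω hω hlt h => ?_).trans (htyp.trans ?_)
  · exact hlt (h.sphereNorm_cliquePoly_le hω hn hp ha hℓ)
  · rw [div_le_div_iff₀ (by positivity) (by positivity)]
    nlinarith [mul_nonneg (by linarith : (0 : ℝ) ≤ n) (sq_nonneg ((n : ℝ) - 4))]

end SosLowerBoundCliquePoly

section CliquePoly

variable {n : ℕ}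

lemma cliquePoly_isHomogeneous (G : SimpleGraph (Fin n)) : (cliquePoly G).IsHomogeneous 4 := by
  classical
  refine IsHomogeneous.sum _ _ _ fun s hs => ?_
  have h := IsHomogeneous.prod s (fun i => (X i : MvPolynomial (Fin n) ℝ)) (fun _ => 1)
    fun i _ => isHomogeneous_X ℝ i
  rwa [Finset.sum_const, smul_eq_mul, mul_one, (SimpleGraph.mem_cliqueFinset_iff.1 hs).card_eq] at h

lemma coeff_cliquePoly_nonneg (G : SimpleGraph (Fin n)) (α : Fin n →₀ ℕ) :
    0 ≤ (cliquePoly G).coeff α := by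
  classical
  rw [cliquePoly, coeff_sum]
  refine Finset.sum_nonneg fun s _ => ?_
  have hprod : ∏ i ∈ s, (X i : MvPolynomial (Fin n) ℝ)
      = monomial (∑ i ∈ s, Finsupp.single i 1) 1 := (monomial_sum_one _ _).symm
  rw [hprod, coeff_monomial]
  split_ifs <;> norm_num

lemma sosValue_zero_le (k : ℕ) : sosValue k (0 : MvPolynomial (Fin n) ℝ) ≤ 0 := by
  rw [sosValue]
  set S := {r : ℝ | ∃ M : Matrix (Fin k → Fin n) (Fin k → Fin n) ℝ,
    IsMatrixRep k (0 : MvPolynomial (Fin n) ℝ) M ∧ r = maxQuadForm M}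
  by_cases hS : BddBelow S
  · refine (csInf_le hS ⟨0, ⟨Matrix.isSymm_zero, fun x => by simp⟩, rfl⟩).trans ?_
    refine Real.sSup_le ?_ le_rfl
    rintro r ⟨z, -, rfl⟩
    simp
  · exact (Real.sInf_of_not_bddBelow hS).le

end CliquePoly

section Parameters

lemma natCast_le_log_of_three_pow_le {k : ℕ} {x : ℝ} (hx : 3 ^ k ≤ x) : k ≤ Real.log x := by
  rw [Real.le_log_iff_exp_le ((by positivity : (0 : ℝ) < 3 ^ k).trans_le hx)]
  exact (exp_natCast_le_three_pow k).trans hx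

lemma rpow_one_third_pow_three {x : ℝ} (hx : 0 ≤ x) : (x ^ (1 / 3 : ℝ)) ^ 3 = x := by
  rw [← Real.rpow_mul_natCast hx]
  norm_num

lemma sqrt_rpow_one_third {x : ℝ} (hx : 0 ≤ x) : √(x ^ (1 / 3 : ℝ)) = x ^ (1 / 6 : ℝ) := by
  rw [Real.sqrt_eq_rpow, ← Real.rpow_mul hx]
  norm_num

lemma edgeProb_mul_rpow_one_third {n : ℕ} (hn : 0 < n) :
    (edgeProb n : ℝ) * (n : ℝ) ^ (1 / 3 : ℝ) = 1 := by
  rw [edgeProb, ← Real.rpow_add (by exact_mod_cast hn)]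
  norm_num

end Parameters

theorem mainTheorem3 :
    ∃ (C : ℕ) (c : ℝ) (N : ℕ), 0 < c ∧ ∀ n : ℕ, N ≤ n →
      -- each of the two bounds holds with probability at least `1 - 1/n` for `G ∼ G(n, n^{-1/3})`
      (1 - 1 / (n : ℝ) ≤ (SimpleGraph.binomialRandom (Fin n) (edgeProb n)).real
        {G | sphereNorm (cliquePoly G) ≤ Real.log n ^ C}) ∧
      (1 - 1 / (n : ℝ) ≤ (SimpleGraph.binomialRandom (Fin n) (edgeProb n)).real
        {G | c * (n : ℝ) ^ (1 / 6 : ℝ) / Real.log n ^ C ≤ sosValue 2 (cliquePoly G)}) ∧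
      -- hence there is a form as desired, and it can be taken to be a `4`-clique polynomial
      ∃ f : MvPolynomial (Fin n) ℝ,
        (∃ G : SimpleGraph (Fin n), f = cliquePoly G) ∧
        f.IsHomogeneous 4 ∧ f.totalDegree = 4 ∧ (∀ α, 0 ≤ f.coeff α) ∧
        sphereNorm f ≤ Real.log n ^ C ∧
        c * (n : ℝ) ^ (1 / 6 : ℝ) / Real.log n ^ C ≤ sosValue 2 f := by
  refine ⟨22, 1 / 10 ^ 12, 10 ^ 10, by positivity, fun n hN => ?_⟩
  have hNR : (10 : ℝ) ^ 10 ≤ n := by exact_mod_cast hN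
  have hn := (rpow_one_third_pow_three n.cast_nonneg).symm
  have hp := edgeProb_mul_rpow_one_third (n := n) (by lia)
  have ha : 2000 ≤ (n : ℝ) ^ (1 / 3 : ℝ) :=
    le_of_pow_le_pow_left₀ three_ne_zero (by positivity) (hn ▸ le_trans (by norm_num) hNR)
  have hℓ : 3 ≤ Real.log n :=
    natCast_le_log_of_three_pow_le (k := 3) (le_trans (by norm_num) hNR)
  have hnorm := one_sub_le_bernoulliProb_sphereNorm_le hn hp (by linarith) (by lia) hℓ
  have hsos := one_sub_le_bernoulliProb_le_sosValue hn hp ha (by linarith)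
  rw [sqrt_rpow_one_third n.cast_nonneg] at hsos
  rw [binomialRandom_real_eq_bernoulliProb, binomialRandom_real_eq_bernoulliProb]
  have hn_inv : 1 / (n : ℝ) ≤ 1 / 10 ^ 10 := by gcongr
  obtain ⟨ω, -, hωnorm, hωsos⟩ := exists_of_one_lt_bernoulliProb_add
    (lt_of_lt_of_le (by norm_num at hn_inv ⊢; linarith) (add_le_add hnorm hsos))
  have hne : cliquePoly (edgeGraph ω) ≠ 0 := fun h0 =>
    (hωsos.trans (h0 ▸ sosValue_zero_le 2)).not_gt (by positivity)
  exact ⟨hnorm, hsos, _, ⟨_, rfl⟩, cliquePoly_isHomogeneous _,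
    (cliquePoly_isHomogeneous _).totalDegree hne, coeff_cliquePoly_nonneg _, hωnorm, hωsos⟩
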